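/- **Theorem (Batch deletion algorithm).** Let $n\ge 2$, let $G=(V,E)$ be a directed graph on $V=\{0,\dots,n-1\}$ with weights $w(u,v)\in[0,\infty)$ on its edges, given by its adjacency matrix, and let $c\ge 1$ be real. For $D\subseteq V$ let $\operatorname{dist}_{G\setminus D}(s,t)$ be the minimum length (sum of edge weights) of a path from $s$ to $t$ in the subgraph induced by $V\setminus D$ ($\infty$ if there is none). $\log$ without base in the layer indices is $\log_2$. Time is the number of elementary operations of a random access machine with unit-cost array access, integer operations, coin flips, and additions and comparisons of weights. *Algorithm 1 (preprocessing).* For each layer $i=1,\dots,\lceil\log n\rceil$ let $h_i=2^i$ and do the following. Put each node into the set of centers $C_i$ independently with probability $\min(x/h_i,1)$, where $x=1+3(c+1)\ln n$. Set $R_i=\emptyset$ and all counters $c_i(u)=0$. While $C_i\not\subseteq R_i$, visit a node of $C_i\setminus R_i$ with maximum counter $c_i$, and then, if $V\setminus(C_i\cup R_i)\ne\emptyset$, visit a node of this set with maximum counter $c_i$. To visit $v$: let $G_i^v$ be $G$ without all edges incident to nodes of $R_i$; by $h_i$ iterations of Bellman–Ford in $G_i^v$ and in its reverse, compute for every node $x$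 shortest $\le h_i$-edge paths $\pi_i^v(v,x)$ and $\pi_i^v(x,v)$ with the minimum number of edges; add $v$ to $R_i$; for every $u\notin R_i$ increase $c_i(u)$ by the number of $x$ such that $u$ lies on $\pi_i^v(v,x)$ or on $\pi_i^v(x,v)$; for all $s,t$ set $\delta_i(s,v,t)$ to the length of $\pi_i^v(s,v)$ plus the length of $\pi_i^v(v,t)$ ($\infty$ if one does not exist). When the loop has ended, for all $s,t$ store the list $L_i(s,t)$ of all $v\in R_i$ sorted by $\delta_i(s,v,t)$ (merge sort). All this is the data structure $\mathcal D$. *Algorithm 2 (deletion of a batch $D\neq\emptyset$, given $G$ and $\mathcal D$).* Let $h=\sqrt{n/|D|}$. For $i=1,\dots,\lfloor\log h\rfloor$ and every $v\in R_i$: let $U_i^v$ be the set of nodes $x$ such that $\pi_i^v(x,v)$ or $\pi_i^v(v,x)$ contains a node of $D$; let $H_i^v$ be the graph that consists of all edges of $G\setminus D$ incident to nodes of $U_i^v$ and, for every $y\notin U_i^v$, of the last edge of $\pi_i^v(v,y)$ and the first edge of $\pi_i^v(y,v)$ (if they exist); compute the distances from and to $v$ in $H_i^v$ by Dijkstra's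 algorithm; for all $(s,t)$ with $s\in U_i^v$ or $t\in U_i^v$ replace $\delta_i(s,v,t)$ by $\operatorname{dist}_{H_i^v}(s,v)+\operatorname{dist}_{H_i^v}(v,t)$. Then set $\delta_i(s,t)=\min_{v\in R_i}\delta_i(s,v,t)$ for all $s,t$, computed as the minimum of the replaced values and of the first value in $L_i(s,t)$ that was not replaced. Next, by Dijkstra's algorithm from and to every $v\in C_{\lceil\log h\rceil}$ in $G\setminus D$, set $\delta_{\lceil\log h\rceil}(s,t)=\min_{v\in C_{\lceil\log h\rceil}}\bigl(\operatorname{dist}_{G\setminus D}(s,v)+\operatorname{dist}_{G\setminus D}(v,t)\bigr)$ (where $C_0=\emptyset$). Output $\delta(s,t)=\min_{1\le i\le\lceil\log h\rceil}\delta_i(s,t)$ for all $s,t$. In both uses, Dijkstra's algorithm runs on adjacency lists, with a priority queue in which decreasing a key takes time $O(1)$ and extracting the minimum takes time $O(\sqrt n)$ (keys in an array divided into $O(\sqrt n)$ blocks of $O(\sqrt n)$ cells, each with its minimum). There is an absolute constant $K$ such that for all $c\ge1$, $n\ge2$, $G$ as above and every fixed nonempty $D\subseteq V$, over the random choices of Algorithm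 1: 1. with probability at least $1-1/n^c$, Algorithm 1 takes time at most $K\,c\,n^3\log^2 n$ and Algorithm 2 takes time at most $K\,c\,n^{2.5}\sqrt{|D|}\,\log n$; 2. with probability at least $1-1/n^c$, the output of Algorithm 2 satisfies $\delta(s,t)=\operatorname{dist}_{G\setminus D}(s,t)$ for all $s,t\in V\setminus D$. -/

import Mathlib

open scoped ENNReal NNReal

noncomputable section

namespace BatchDeletion

/-! ### Weighted directed graphs, paths and distances -/

/-- A directed graph on the nodes `0, …, n - 1` with non-negative real edge weights
(`weight u v` is only meaningful if `edge u v` holds). -/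
structure WDigraph (n : ℕ) where
  edge : Fin n → Fin n → Prop
  weight : Fin n → Fin n → ℝ≥0

/-- `p` is the list of nodes of a path from `s` to `t` in `G ∖ D`. -/
structure WDigraph.IsPath {n : ℕ} (G : WDigraph n) (D : Finset (Fin n)) (s t : Fin n)
    (p : List (Fin n)) : Prop where
  head : p.head? = some s
  last : p.getLast? = some t
  edges : p.IsChain G.edge
  avoids : ∀ v ∈ p, v ∉ D

/-- The length of a path: the sum of the weights of its edges. -/
def WDigraph.pathLength {n : ℕ} (G : WDigraph n) : List (Fin n) → ℝ≥0
  | [] => 0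
  | [_] => 0
  | u :: v :: p => G.weight u v + WDigraph.pathLength G (v :: p)

/-- The distance from `s` to `t` in `G ∖ D`; it is `∞` if there is no path. -/
def WDigraph.dist {n : ℕ} (G : WDigraph n) (D : Finset (Fin n)) (s t : Fin n) : ℝ≥0∞ :=
  ⨅ (p : List (Fin n)) (_ : G.IsPath D s t p), (G.pathLength p : ℝ≥0∞)

/-! ### The unit-cost random access machine

A program of type `Timed α` produces a value and counts the elementary operations that it executes.
Registers hold node names, integers, Booleans, pointers (to immutable linked lists and to arrays)
and weights, which are numbers of `[0, ∞]` that can be added and compared. The instructions that are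
charged are

* `step a`: computing `a` from a constant number of registers by one elementary operation (which
  includes the evaluation of `√(n / |D|)` and of its rounded logarithm, once per run),
* `alloc b`: creating an array, charged by its number of cells,
* `Arr.read`, `Arr.write`: access to one array cell,
* `forEach`: a loop, charged one unit for each iteration in addition to the cost of its body.

An array is never used again after it has been overwritten by `Arr.write`. -/

structure Timed (α : Type) where
  val : α
  cost : ℕ

instance : Monad Timed where
  pure a := ⟨a, 0⟩
  bind x f := ⟨(f x.val).val, x.cost + (f x.val).cost⟩

def step {α : Type} (a : α) : Timed α := ⟨a, 1⟩

/-- `for a in l do b ← body a b`, starting with `b = init`. -/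
def forEach {α β : Type} (l : List α) (init : β) (body : α → β → Timed β) : Timed β :=
  match l with
  | [] => pure init
  | a :: l => do
    let b ← body a init
    let b ← step b
    forEach l b body

/-- An array with cells indexed by `ι` and entries in `β`. -/
structure Arr (ι β : Type) where
  entry : ι → β

def alloc {ι β : Type} [Fintype ι] (b : β) : Timed (Arr ι β) := ⟨⟨fun _ => b⟩, Fintype.card ι⟩

def Arr.read {ι β : Type} (a : Arr ι β) (i : ι) : Timed β := ⟨a.entry i, 1⟩

def Arr.write {ι β : Type} [DecidableEq ι] (a : Arr ι β) (i : ι) (b : β) : Timed (Arr ι β) :=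
  ⟨⟨Function.update a.entry i b⟩, 1⟩

/-- All nodes, in increasing order. -/
def nodes (n : ℕ) : List (Fin n) := List.finRange n

/-- A new array indexed by the nodes, its cells filled one after the other. -/
def tabulate {n : ℕ} {β : Type} (b : β) (f : Fin n → Timed β) : Timed (Arr (Fin n) β) := do
  let a ← alloc b
  forEach (nodes n) a fun x a => do
    let y ← f x
    a.write x y

/-- A new array indexed by the pairs of nodes, its cells filled one after the other. -/
def tabulate₂ {n : ℕ} {β : Type} (b : β) (f : Fin n → Fin n → Timed β) :
    Timed (Arr (Fin n × Fin n) β) := do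
  let a ← alloc b
  forEach (nodes n) a fun x a =>
    forEach (nodes n) a fun y a => do
      let z ← f x y
      a.write (x, y) z

/-- A matrix of weights; as an adjacency matrix, the entry `∞` says that there is no edge. -/
abbrev WMatrix (n : ℕ) : Type := Arr (Fin n × Fin n) ℝ≥0∞

/-- The input format of a graph: its adjacency matrix. -/
def WDigraph.matrix {n : ℕ} (G : WDigraph n) : WMatrix n :=
  open Classical in ⟨fun e => if G.edge e.1 e.2 then (G.weight e.1 e.2 : ℝ≥0∞) else ⊤⟩

/-- The input format of a set of nodes: its characteristic vector. -/
def nodeSet {n : ℕ} (D : Finset (Fin n)) : Arr (Fin n) Bool := ⟨fun v => decide (v ∈ D)⟩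

/-! ### Bellman-Ford: shortest paths with a bounded number of edges -/

/-- The best path from the source to a node `x` that is known so far: its length and its nodes, in
the order from `x` back to the source. There is no path if `dist = ∞`, and then `path = []`. -/
structure Label (n : ℕ) where
  dist : ℝ≥0∞
  path : List (Fin n)

/-- One iteration of Bellman-Ford. A label is replaced only by a strictly shorter one, so that among
the shortest paths with at most `h` edges one with the minimum number of edges is stored. -/
def bellmanFordIter {n : ℕ} (M : WMatrix n) (lab : Arr (Fin n) (Label n)) :
    Timed (Arr (Fin n) (Label n)) :=
  tabulate ⟨⊤, []⟩ fun x => do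
    let l ← lab.read x
    forEach (nodes n) l fun u l => do
      let lu ← lab.read u
      let w ← M.read (u, x)
      let d ← step (lu.dist + w)
      let better ← step (decide (d < l.dist))
      step (if better then ⟨d, x :: lu.path⟩ else l)

/-- `h` iterations of Bellman-Ford from `v` in the graph with adjacency matrix `M`. -/
def bellmanFord {n : ℕ} (h : ℕ) (M : WMatrix n) (v : Fin n) : Timed (Arr (Fin n) (Label n)) := do
  let lab ← alloc ⟨⊤, []⟩
  let lab ← lab.write v ⟨0, [v]⟩
  forEach (List.range h) lab fun _ lab => bellmanFordIter M lab

/-! ### Merge sort -/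

def split {α : Type} : List α → Timed (List α × List α)
  | [] => step ([], [])
  | [a] => step ([a], [])
  | a :: b :: l => do
    let p ← split l
    step (a :: p.1, b :: p.2)

def merge {α : Type} : List (ℝ≥0∞ × α) → List (ℝ≥0∞ × α) → Timed (List (ℝ≥0∞ × α))
  | [], l => step l
  | a :: k, [] => step (a :: k)
  | a :: k, b :: l => do
    let le ← step (decide (a.1 ≤ b.1))
    if le then do
      let m ← merge k (b :: l)
      step (a :: m)
    else do
      let m ← merge (a :: k) l
      step (b :: m)
termination_by k l => k.length + l.length

/-- Merge sort by the first component; `fuel` bounds the depth of the recursion, and the length of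
the list is always enough. -/
def mergeSort {α : Type} (fuel : ℕ) (l : List (ℝ≥0∞ × α)) : Timed (List (ℝ≥0∞ × α)) :=
  match fuel, l with
  | 0, l => step l
  | _ + 1, [] => step []
  | _ + 1, [a] => step [a]
  | fuel + 1, a :: b :: l => do
    let p ← split (a :: b :: l)
    let k ← mergeSort fuel p.1
    let l ← mergeSort fuel p.2
    merge k l

/-! ### Preprocessing -/

/-- What is stored for one layer `i`:
the centers `C_i`, the visited nodes `R_i` (as a characteristic vector and as a list), the congestion
counters `c_i`, the paths `π_i^v (v, x)` at `pathFrom (v, x)` and `π_i^v (x, v)` at `pathTo (v, x)`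
(both as lists of nodes that start with `x` and end with `v`; `[]` if there is no path), the values
`δ_i (s, v, t)` at `through (s, v, t)`, and the sorted lists `L_i (s, t)`. -/
structure Layer (n : ℕ) where
  center : Arr (Fin n) Bool
  isVisited : Arr (Fin n) Bool
  visited : List (Fin n)
  congestion : Arr (Fin n) ℕ
  pathFrom : Arr (Fin n × Fin n) (List (Fin n))
  pathTo : Arr (Fin n × Fin n) (List (Fin n))
  through : Arr (Fin n × Fin n × Fin n) ℝ≥0∞
  sorted : Arr (Fin n × Fin n) (List (ℝ≥0∞ × Fin n))

/-- A layer without centers and without visited nodes. -/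
def newLayer (n : ℕ) : Timed (Layer n) := do
  let center ← alloc false
  let isVisited ← alloc false
  let congestion ← alloc 0
  let pathFrom ← alloc []
  let pathTo ← alloc []
  let through ← alloc ⊤
  let sorted ← alloc []
  pure ⟨center, isVisited, [], congestion, pathFrom, pathTo, through, sorted⟩

/-- Add `1` to the congestion counters (the first array) of the nodes of a path `p` that have not
been visited and have not yet been counted for the endpoint `x`; the second array stores for every
node the last endpoint it was counted for. -/
def countPath {n : ℕ} (isVisited : Arr (Fin n) Bool) (x : Fin n) (p : List (Fin n))
    (c : Arr (Fin n) ℕ × Arr (Fin n) (Option (Fin n))) :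
    Timed (Arr (Fin n) ℕ × Arr (Fin n) (Option (Fin n))) :=
  forEach p c fun u c => do
    let vis ← isVisited.read u
    let mark ← c.2.read u
    let skip ← step (vis || decide (mark = some x))
    if skip then pure c
    else do
      let k ← c.1.read u
      let c₁ ← c.1.write u (k + 1)
      let c₂ ← c.2.write u (some x)
      pure (c₁, c₂)

/-- The procedure `Visit (v, i)`, where `h = h_i`. -/
def visit {n : ℕ} (W : WMatrix n) (h : ℕ) (v : Fin n) (L : Layer n) : Timed (Layer n) := do
  -- the graph `G_i^v` and its reverse graph
  let M ← tabulate₂ ⊤ fun x y => do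
    let a ← L.isVisited.read x
    let b ← L.isVisited.read y
    if a || b then step ⊤ else W.read (x, y)
  let Mrev ← tabulate₂ ⊤ fun x y => M.read (y, x)
  let labFrom ← bellmanFord h M v
  let labTo ← bellmanFord h Mrev v
  let isVisited ← L.isVisited.write v true
  let visited ← step (v :: L.visited)
  -- congestion counters of the unvisited nodes
  let mark ← alloc none
  let c ← forEach (nodes n) (L.congestion, mark) fun x c => do
    let lf ← labFrom.read x
    let lt ← labTo.read x
    let c ← countPath isVisited x lt.path c
    countPath isVisited x lf.path c
  -- stored paths and distances through `v`
  let pathFrom ← forEach (nodes n) L.pathFrom fun x a => do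
    let lf ← labFrom.read x
    a.write (v, x) lf.path
  let pathTo ← forEach (nodes n) L.pathTo fun x a => do
    let lt ← labTo.read x
    a.write (v, x) lt.path
  let through ← forEach (nodes n) L.through fun s a =>
    forEach (nodes n) a fun t a => do
      let ls ← labTo.read s
      let lt ← labFrom.read t
      let d ← step (ls.dist + lt.dist)
      a.write (s, v, t) d
  pure ⟨L.center, isVisited, visited, c.1, pathFrom, pathTo, through, L.sorted⟩

/-- A node with the largest congestion counter among the eligible ones, if there is an eligible
node. -/
def argmaxCongestion {n : ℕ} (congestion : Arr (Fin n) ℕ) (eligible : Arr (Fin n) Bool) :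
    Timed (Option (Fin n)) := do
  let r ← forEach (nodes n) (none : Option (Fin n × ℕ)) fun v best => do
    let e ← eligible.read v
    let k ← congestion.read v
    step (match best with
      | none => if e then some (v, k) else none
      | some b => if e && decide (b.2 < k) then some (v, k) else some b)
  step (r.map Prod.fst)

/-- The while loop of the preprocessing: until all centers have been visited, visit the unvisited
center with the largest congestion and then the unvisited non-center with the largest congestion (if
there is one). The first argument bounds the number of rounds; as every round visits a center, `n`
rounds are always enough. -/
def visitLoop {n : ℕ} (W : WMatrix n) (h : ℕ) : ℕ → Layer n → Timed (Layer n)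
  | 0, L => pure L
  | rounds + 1, L => do
    let eligible ← tabulate false fun v => do
      let c ← L.center.read v
      let r ← L.isVisited.read v
      step (c && !r)
    let v ← argmaxCongestion L.congestion eligible
    match v with
    | none => pure L
    | some v => do
      let L ← visit W h v L
      let eligible ← tabulate false fun v => do
        let c ← L.center.read v
        let r ← L.isVisited.read v
        step (!c && !r)
      let v ← argmaxCongestion L.congestion eligible
      let L ← match v with
        | none => pure L
        | some v => visit W h v L
      visitLoop W h rounds L

/-- The index of the last layer, `⌈log₂ n⌉`. -/
def topLayer (n : ℕ) : ℕ := Nat.clog 2 n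

abbrev LayerIndex (n : ℕ) : Type := Fin (topLayer n + 1)

/-- The name of layer `i`, for `i ≤ ⌈log₂ n⌉`. -/
def layer (n i : ℕ) : LayerIndex n := Fin.ofNat (topLayer n + 1) i

/-- The computation for layer `i`; `coin v` is the outcome of the coin that is flipped to decide
whether `v` becomes a center. -/
def preprocessLayer {n : ℕ} (W : WMatrix n) (coin : Fin n → Bool) (i : ℕ) : Timed (Layer n) := do
  let L ← newLayer n
  let center ← forEach (nodes n) L.center fun v a => do
    let b ← step (coin v)
    a.write v b
  let h ← step (2 ^ i)
  let L ← visitLoop W h n { L with center := center }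
  let sorted ← forEach (nodes n) L.sorted fun s a =>
    forEach (nodes n) a fun t a => do
      let l ← forEach L.visited [] fun v l => do
        let d ← L.through.read (s, v, t)
        step ((d, v) :: l)
      let l ← mergeSort n l
      a.write (s, t) l
  pure { L with sorted := sorted }

/-- The outcomes of the coin flips of the preprocessing, one for each layer and each node. -/
abbrev Coins (n : ℕ) : Type := LayerIndex n × Fin n → Bool

/-- The data structure that the preprocessing computes: the layers `1, …, ⌈log₂ n⌉` (layer `0` has no
centers and no visited nodes). -/
abbrev Data (n : ℕ) : Type := Arr (LayerIndex n) (Layer n)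

/-- The preprocessing algorithm. -/
def preprocess {n : ℕ} (W : WMatrix n) (coins : Coins n) : Timed (Data n) := do
  let L ← newLayer n
  let data ← alloc L
  forEach (List.range' 1 (topLayer n)) data fun i data => do
    let L ← preprocessLayer W (fun v => coins (layer n i, v)) i
    data.write (layer n i) L

/-- A node becomes a center of layer `i` with probability `min (x / h_i, 1)`, where `h_i = 2 ^ i` and
`x = 1 + 3 (c + 1) ln n`. -/
def centerProb (n : ℕ) (c : ℝ) (i : ℕ) : unitInterval :=
  Set.projIcc 0 1 zero_le_one ((1 + 3 * (c + 1) * Real.log n) / 2 ^ i)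

/-- The coins are flipped independently. -/
def coinMeasure (n : ℕ) (c : ℝ) : MeasureTheory.Measure (Coins n) :=
  MeasureTheory.Measure.pi fun e =>
    ProbabilityTheory.bernoulliMeasure true false (centerProb n c e.1)

/-! ### Dijkstra's algorithm

The priority queue is an array of keys whose cells are grouped into blocks of `⌊√n⌋ + 1` consecutive
nodes, together with the node of smallest key of every block. -/

/-- A graph given by adjacency lists, for the outgoing and for the incoming edges. -/
structure AdjLists (n : ℕ) where
  out : Arr (Fin n) (List (Fin n × ℝ≥0∞))
  inc : Arr (Fin n) (List (Fin n × ℝ≥0∞))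

def newAdjLists (n : ℕ) : Timed (AdjLists n) := do
  let out ← alloc []
  let inc ← alloc []
  pure ⟨out, inc⟩

/-- Add the edge `(x, y)` of the graph with adjacency matrix `W`, provided that it exists and that
neither of its endpoints is deleted. -/
def AdjLists.addEdge {n : ℕ} (W : WMatrix n) (D : Arr (Fin n) Bool) (x y : Fin n)
    (A : AdjLists n) : Timed (AdjLists n) := do
  let w ← W.read (x, y)
  let dx ← D.read x
  let dy ← D.read y
  let skip ← step (decide (w = ⊤) || dx || dy)
  if skip then pure A
  else do
    let l ← A.out.read x
    let out ← A.out.write x ((y, w) :: l)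
    let l ← A.inc.read y
    let inc ← A.inc.write y ((x, w) :: l)
    pure ⟨out, inc⟩

def blockSize (n : ℕ) : ℕ := Nat.sqrt n + 1

/-- The (name of the) block that contains the node `x`; it is a number less than `blockSize n`. -/
def block {n : ℕ} (x : Fin n) : Fin n :=
  ⟨x.val / blockSize n, lt_of_le_of_lt (Nat.div_le_self _ _) x.isLt⟩

/-- `minKey.entry k` is a node of block `k` that has the smallest distance estimate among the
unsettled nodes of the block with a finite estimate. -/
structure Queue (n : ℕ) where
  dist : Arr (Fin n) ℝ≥0∞
  settled : Arr (Fin n) Bool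
  minKey : Arr (Fin n) (Option (Fin n))

/-- Of the best candidate so far and a new candidate `x` with key `d`, take the better one. -/
def better {n : ℕ} (best : Option (Fin n × ℝ≥0∞)) (x : Fin n) (d : ℝ≥0∞) :
    Option (Fin n × ℝ≥0∞) :=
  match best with
  | none => some (x, d)
  | some b => if d < b.2 then some (x, d) else some b

/-- The unsettled node with the smallest distance estimate. -/
def Queue.findMin {n : ℕ} (Q : Queue n) : Timed (Option (Fin n)) := do
  let r ← forEach (List.range (blockSize n)) (none : Option (Fin n × ℝ≥0∞)) fun k best => do
    if hk : k < n then do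
      let m ← Q.minKey.read ⟨k, hk⟩
      match m with
      | none => pure best
      | some x => do
        let d ← Q.dist.read x
        step (better best x d)
    else pure best
  step (r.map Prod.fst)

/-- Declare `x` settled, and update the smallest key of its block. -/
def Queue.settle {n : ℕ} (Q : Queue n) (x : Fin n) : Timed (Queue n) := do
  let settled ← Q.settled.write x true
  let first ← step ((block x).val * blockSize n)
  let r ← forEach (List.range (blockSize n)) (none : Option (Fin n × ℝ≥0∞)) fun j best => do
    if hy : first + j < n then do
      let f ← settled.read ⟨first + j, hy⟩
      let d ← Q.dist.read ⟨first + j, hy⟩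
      let skip ← step (f || decide (d = ⊤))
      if skip then pure best else step (better best ⟨first + j, hy⟩ d)
    else pure best
  let minKey ← Q.minKey.write (block x) (r.map Prod.fst)
  pure ⟨Q.dist, settled, minKey⟩

/-- Decrease the distance estimate of `y` to `d` if `d` is smaller. -/
def Queue.relax {n : ℕ} (Q : Queue n) (y : Fin n) (d : ℝ≥0∞) : Timed (Queue n) := do
  let old ← Q.dist.read y
  let smaller ← step (decide (d < old))
  if smaller then do
    let dist ← Q.dist.write y d
    let m ← Q.minKey.read (block y)
    match m with
    | none => do
      let minKey ← Q.minKey.write (block y) (some y)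
      pure ⟨dist, Q.settled, minKey⟩
    | some z => do
      let dz ← dist.read z
      let smaller ← step (decide (d < dz))
      if smaller then do
        let minKey ← Q.minKey.write (block y) (some y)
        pure ⟨dist, Q.settled, minKey⟩
      else pure ⟨dist, Q.settled, Q.minKey⟩
  else pure Q

/-- Dijkstra's algorithm: the distances from `v` in the graph whose adjacency lists are `adj`. -/
def dijkstra {n : ℕ} (adj : Arr (Fin n) (List (Fin n × ℝ≥0∞))) (v : Fin n) :
    Timed (Arr (Fin n) ℝ≥0∞) := do
  let dist ← alloc ⊤
  let dist ← dist.write v 0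
  let settled ← alloc false
  let minKey ← alloc none
  let minKey ← minKey.write (block v) (some v)
  let Q ← forEach (nodes n) (⟨dist, settled, minKey⟩ : Queue n) fun _ Q => do
    let x ← Q.findMin
    match x with
    | none => pure Q
    | some x => do
      let Q ← Q.settle x
      let dx ← Q.dist.read x
      let l ← adj.read x
      forEach l Q fun e Q => do
        let d ← step (dx + e.2)
        Q.relax e.1 d
  pure Q.dist

/-! ### Batch deletion -/

/-- Is some node of the path `p` deleted? -/
def hits {n : ℕ} (D : Arr (Fin n) Bool) (p : List (Fin n)) : Timed Bool :=
  forEach p false fun u b => do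
    let d ← D.read u
    step (b || d)

/-- The set `U_i^v` of affected nodes. -/
def affectedNodes {n : ℕ} (L : Layer n) (D : Arr (Fin n) Bool) (v : Fin n) :
    Timed (Arr (Fin n) Bool) :=
  tabulate false fun x => do
    let p ← L.pathTo.read (v, x)
    let a ← hits D p
    let p ← L.pathFrom.read (v, x)
    let b ← hits D p
    step (a || b)

/-- The sketch graph `H_i^v`, a subgraph of `G ∖ D`: all edges incident to affected nodes, and for
every non-affected node `y` the last edge of `π_i^v (v, y)` and the first edge of `π_i^v (y, v)`. -/
def sketchGraph {n : ℕ} (W : WMatrix n) (L : Layer n) (D : Arr (Fin n) Bool) (v : Fin n)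
    (U : Arr (Fin n) Bool) : Timed (AdjLists n) := do
  let H ← newAdjLists n
  forEach (nodes n) H fun y H => do
    let a ← U.read y
    if a then
      forEach (nodes n) H fun z H => do
        let H ← H.addEdge W D y z
        H.addEdge W D z y
    else do
      let p ← L.pathFrom.read (v, y)
      let H ← match p with
        | _ :: x :: _ => H.addEdge W D x y
        | _ => pure H
      let p ← L.pathTo.read (v, y)
      match p with
      | _ :: z :: _ => H.addEdge W D y z
      | _ => pure H

/-- Replace the entry of `a` at `e` by `d` if `d` is smaller. -/
def lowerTo {ι : Type} [DecidableEq ι] (a : Arr ι ℝ≥0∞) (e : ι) (d : ℝ≥0∞) :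
    Timed (Arr ι ℝ≥0∞) := do
  let old ← a.read e
  let smaller ← step (decide (d < old))
  if smaller then a.write e d else pure a

/-- The first value in a list `L_i (s, t)` that has not changed since the preprocessing, `∞` if there
is none. The value of `v` has changed if `s` or `t` belongs to `U_i^v`. -/
def firstUnchanged {n : ℕ} (U : Arr (Fin n) (Arr (Fin n) Bool)) (s t : Fin n) :
    List (ℝ≥0∞ × Fin n) → Timed ℝ≥0∞
  | [] => step ⊤
  | e :: l => do
    let Uv ← U.read e.2
    let a ← Uv.read s
    let b ← Uv.read t
    let changed ← step (a || b)
    if changed then firstUnchanged U s t l else step e.1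

/-- The matrix of all `δ_i (s, t)` for a layer. In the loop over `R_i`, the first array stores all the
sets `U_i^v`, and the second one the minimum over the values `δ_i (s, v, t)` recomputed so far. -/
def repairLayer {n : ℕ} (W : WMatrix n) (L : Layer n) (D : Arr (Fin n) Bool) :
    Timed (WMatrix n) := do
  let noNodes ← alloc false
  let affected ← alloc noNodes
  let changed ← alloc ⊤
  let r ← forEach L.visited ((affected, changed) : Arr (Fin n) (Arr (Fin n) Bool) × WMatrix n)
    fun v r => do
      let U ← affectedNodes L D v
      let H ← sketchGraph W L D v U
      let distFrom ← dijkstra H.out v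
      let distTo ← dijkstra H.inc v
      let changed ← forEach (nodes n) r.2 fun x m => do
        let a ← U.read x
        if a then
          forEach (nodes n) m fun y m => do
            let dx ← distTo.read x
            let dy ← distFrom.read y
            let d ← step (dx + dy)
            let m ← lowerTo m (x, y) d
            let dy ← distTo.read y
            let dx ← distFrom.read x
            let d ← step (dy + dx)
            lowerTo m (y, x) d
        else pure m
      let affected ← r.1.write v U
      pure (affected, changed)
  tabulate₂ ⊤ fun s t => do
    let d ← r.2.read (s, t)
    let l ← L.sorted.read (s, t)
    let d' ← firstUnchanged r.1 s t l
    step (min d d')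

/-- The distances of `G ∖ D` through the centers of a layer. -/
def throughCenters {n : ℕ} (W : WMatrix n) (L : Layer n) (D : Arr (Fin n) Bool) :
    Timed (WMatrix n) := do
  let A ← newAdjLists n
  let A ← forEach (nodes n) A fun x A => forEach (nodes n) A fun y A => A.addEdge W D x y
  let m ← alloc ⊤
  forEach (nodes n) m fun v m => do
    let c ← L.center.read v
    if c then do
      let distFrom ← dijkstra A.out v
      let distTo ← dijkstra A.inc v
      forEach (nodes n) m fun s m =>
        forEach (nodes n) m fun t m => do
          let ds ← distTo.read s
          let dt ← distFrom.read t
          let d ← step (ds + dt)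
          lowerTo m (s, t) d
    else pure m

/-- The deletion procedure for a single batch of nodes `D`; its result is the matrix of the values
`δ (s, t)`. -/
def batchDeletion {n : ℕ} (W : WMatrix n) (data : Data n) (D : Arr (Fin n) Bool) :
    Timed (WMatrix n) := do
  let size ← forEach (nodes n) (0 : ℕ) fun v k => do
    let b ← D.read v
    step (if b then k + 1 else k)
  let h : ℝ ← step (√((n : ℝ) / (size : ℝ)))
  let lo ← step ⌊Real.logb 2 h⌋₊
  let hi ← step ⌈Real.logb 2 h⌉₊
  let infinite ← alloc ⊤
  let δ ← alloc infinite
  let δ : Arr (LayerIndex n) (WMatrix n) ← forEach (List.range' 1 lo) δ fun i δ => do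
    let L ← data.read (layer n i)
    let m ← repairLayer W L D
    δ.write (layer n i) m
  let L ← data.read (layer n hi)
  let m ← throughCenters W L D
  let δ ← δ.write (layer n hi) m
  tabulate₂ ⊤ fun s t =>
    forEach (List.range' 1 hi) ⊤ fun i d => do
      let m ← δ.read (layer n i)
      let e ← m.read (s, t)
      step (min d e)

end BatchDeletion

end

open BatchDeletion

noncomputable section

namespace BatchDeletion

/-! ### Reasoning about timed programs -/

/-! Everything except two events of the coin flips is deterministic. Loops are handled by invariants
on the processed prefix, the state and the time spent (`forEach_spec`).

No reported value is too small. Dijkstra's output is characterised through potentials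
(`dijkstra_spec`): it is itself a potential, hence at most the length of every path present in the
lists, and it dominates every potential. The distances of G∖D are a potential for any adjacency
lists made of edges of G∖D, so neither the sketch graphs nor the final runs can undershoot them. An
unchanged value δ_i(s,v,t) comes from stored paths that avoid D.

No reported value is too large, provided that a shortest simple path p from s to t in G∖D contains a
center of its layer i. This is the layer with h_i comparable to the number of nodes of p, capped at
⌈log h⌉. If it is the capped layer, a Dijkstra run from that center finds the length of p. Otherwise
let v be the node of p that was visited first in layer i. It exists because all centers get visited.
When v was visited, no node of p had been removed, so p lies in G_i^v and has at most h_i edges. If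
s and t are unaffected, the stored value is thus at most the length of p. If not, the sketch graph
must not lose length (`sketch_le`). Take a counterexample that is minimal by length and then by
number of nodes. At an affected first node all edges are present and the first one can be peeled
off. At an unaffected first node the path is replaced by the stored one, which is no longer and, in
case of a tie, has no more edges, and whose first edge is present. The minimum number of edges is
what makes the induction work with edges of weight zero.

The time for deletion depends on the total size of the sets U_i^v, which is at most the sum over u
in D of c_i(u) + n. One visit raises the sum of all counters by at most T = 2n(h_i+1). Among centers
and among non-centers separately, a maximum is visited once per round, while the sum grows by at
most 2T. The potential in `CongBound` keeps every counter below 2T·H_n, with H_n the harmonic number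
(`CongBound.visit_max`, `CongBound.entry_le`). As a visited node has lost its edges, its counter
stays fixed. Each affected node costs O(n), in the construction of the sketch, in Dijkstra and in
the search through the sorted lists. So layer i costs about |D|·n²·h_i·log n for affected nodes,
plus n^{1.5} + n·h_i per visited node, plus smaller terms. There are O(nx/h_i) visited nodes. The
geometric sums up to h = √(n/|D|) and the n² per center of the last layer all give n^{2.5}·√|D|
times O(x + log n).

For the probabilities, shortest paths are fixed before the coins are looked at. A path with at least
h_i/2 nodes misses C_i with probability at most e^{-x/2}, and a union bound over all pairs finishes
(`prob_all_hit`, `prob_correct`). The time bounds need only that no layer has more than four times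
nx/h_i centers, which follows from Markov's inequality for 2^{|C_i|} (`prob_few_centers`). -/

@[simp] theorem bind_val {α β : Type} (x : Timed α) (f : α → Timed β) :
    (x >>= f).val = (f x.val).val := rfl

@[simp] theorem bind_cost {α β : Type} (x : Timed α) (f : α → Timed β) :
    (x >>= f).cost = x.cost + (f x.val).cost := rfl

@[simp] theorem pure_val {α : Type} (a : α) : (pure a : Timed α).val = a := rfl

@[simp] theorem pure_cost {α : Type} (a : α) : (pure a : Timed α).cost = 0 := rfl

@[simp] theorem step_val {α : Type} (a : α) : (step a).val = a := rfl

@[simp] theorem step_cost {α : Type} (a : α) : (step a).cost = 1 := rfl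

@[simp] theorem read_val {ι β : Type} (a : Arr ι β) (i : ι) : (a.read i).val = a.entry i := rfl

@[simp] theorem read_cost {ι β : Type} (a : Arr ι β) (i : ι) : (a.read i).cost = 1 := rfl

@[simp] theorem write_val {ι β : Type} [DecidableEq ι] (a : Arr ι β) (i : ι) (b : β) :
    (a.write i b).val = ⟨Function.update a.entry i b⟩ := rfl

@[simp] theorem write_cost {ι β : Type} [DecidableEq ι] (a : Arr ι β) (i : ι) (b : β) :
    (a.write i b).cost = 1 := rfl

@[simp] theorem alloc_val {ι β : Type} [Fintype ι] (b : β) :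
    (alloc b : Timed (Arr ι β)).val = ⟨fun _ => b⟩ := rfl

@[simp] theorem alloc_cost {ι β : Type} [Fintype ι] (b : β) :
    (alloc b : Timed (Arr ι β)).cost = Fintype.card ι := rfl

@[simp] theorem ite_val {α : Type} (p : Prop) [Decidable p] (x y : Timed α) :
    (if p then x else y).val = if p then x.val else y.val := by split_ifs <;> rfl

@[simp] theorem ite_cost {α : Type} (p : Prop) [Decidable p] (x y : Timed α) :
    (if p then x else y).cost = if p then x.cost else y.cost := by split_ifs <;> rfl

theorem read_bind_val {ι β γ : Type} (a : Arr ι β) (i : ι) (f : β → Timed γ) :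
    (a.read i >>= f).val = (f (a.entry i)).val := rfl

theorem read_bind_cost {ι β γ : Type} (a : Arr ι β) (i : ι) (f : β → Timed γ) :
    (a.read i >>= f).cost = 1 + (f (a.entry i)).cost := rfl

theorem step_bind_val {β γ : Type} (b : β) (f : β → Timed γ) :
    (step b >>= f).val = (f b).val := rfl

theorem step_bind_cost {β γ : Type} (b : β) (f : β → Timed γ) :
    (step b >>= f).cost = 1 + (f b).cost := rfl

theorem write_bind_val {ι β γ : Type} [DecidableEq ι] (a : Arr ι β) (i : ι) (b : β)
    (f : Arr ι β → Timed γ) :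
    (a.write i b >>= f).val = (f ⟨Function.update a.entry i b⟩).val := rfl

theorem write_bind_cost {ι β γ : Type} [DecidableEq ι] (a : Arr ι β) (i : ι) (b : β)
    (f : Arr ι β → Timed γ) :
    (a.write i b >>= f).cost = 1 + (f ⟨Function.update a.entry i b⟩).cost := rfl

@[simp] theorem forEach_nil {α β : Type} (init : β) (body : α → β → Timed β) :
    forEach [] init body = pure init := rfl

theorem forEach_cons_val {α β : Type} (a : α) (l : List α) (init : β) (body : α → β → Timed β) :
    (forEach (a :: l) init body).val = (forEach l (body a init).val body).val := rfl

theorem forEach_cons_cost {α β : Type} (a : α) (l : List α) (init : β)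
    (body : α → β → Timed β) :
    (forEach (a :: l) init body).cost =
      (body a init).cost + (1 + (forEach l (body a init).val body).cost) := rfl

/-- The loop rule: an invariant of the processed prefix, the state and the time spent so far. -/
theorem forEach_spec {α β : Type} {l : List α} {init : β} {body : α → β → Timed β}
    (Inv : List α → β → ℕ → Prop) (h0 : Inv [] init 0)
    (hstep : ∀ pre a post b k, l = pre ++ a :: post → Inv pre b k →
      Inv (pre ++ [a]) (body a b).val (k + (body a b).cost + 1)) :
    Inv l (forEach l init body).val (forEach l init body).cost := by
  suffices H : ∀ (post pre : List α) (b : β) (k : ℕ), l = pre ++ post → Inv pre b k →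
      Inv l (forEach post b body).val (k + (forEach post b body).cost) by
    simpa using H l [] init 0 rfl h0
  intro post
  induction post with
  | nil => intro pre b k hl h; simpa [hl] using h
  | cons a post ih =>
    intro pre b k hl h
    have := ih (pre ++ [a]) (body a b).val _ (by simp [hl]) (hstep pre a post b k hl h)
    rw [forEach_cons_val, forEach_cons_cost]
    convert this using 1
    ring

theorem forEach_val_spec {α β : Type} {l : List α} {init : β} {body : α → β → Timed β}
    (Inv : List α → β → Prop) (h0 : Inv [] init)
    (hstep : ∀ pre a post b, l = pre ++ a :: post → Inv pre b → Inv (pre ++ [a]) (body a b).val) :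
    Inv l (forEach l init body).val :=
  forEach_spec (fun pre b _ => Inv pre b) h0 fun pre a post b _ hl h => hstep pre a post b hl h

/-- The budget may depend on the loop element, which is needed whenever affected nodes cost more
than others; the added 1 is the charge for the iteration. -/
theorem forEach_cost_le_sum {α β : Type} {l : List α} {init : β} {body : α → β → Timed β}
    (k : α → ℕ) (P : β → Prop) (h0 : P init) (hstep : ∀ a ∈ l, ∀ b, P b → P (body a b).val)
    (hk : ∀ a ∈ l, ∀ b, P b → (body a b).cost ≤ k a) :
    (forEach l init body).cost ≤ (l.map fun a => k a + 1).sum := by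
  refine (forEach_spec (fun pre b c => P b ∧ c ≤ (pre.map fun a => k a + 1).sum) ⟨h0, by simp⟩
    fun pre a post b c hl h => ⟨hstep a (by simp [hl]) b h.1, ?_⟩).2
  have := hk a (by simp [hl]) b h.1
  simp only [List.map_append, List.map_cons, List.map_nil, List.sum_append, List.sum_cons,
    List.sum_nil]
  omega

theorem forEach_cost_le {α β : Type} {l : List α} {init : β} {body : α → β → Timed β}
    (k : ℕ) (hk : ∀ a ∈ l, ∀ b, (body a b).cost ≤ k) :
    (forEach l init body).cost ≤ l.length * (k + 1) := by
  have := forEach_cost_le_sum (l := l) (init := init) (body := body) (fun _ => k) (fun _ => True)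
    trivial (fun _ _ _ _ => trivial) fun a ha b _ => hk a ha b
  simpa using this

@[simp] theorem length_nodes (n : ℕ) : (nodes n).length = n := by simp [nodes]

@[simp] theorem mem_nodes {n : ℕ} (v : Fin n) : v ∈ nodes n := by simp [nodes]

theorem nodup_nodes (n : ℕ) : (nodes n).Nodup := List.nodup_finRange n

theorem sum_map_nodes {n : ℕ} {M : Type} [AddCommMonoid M] (f : Fin n → M) :
    ((nodes n).map f).sum = ∑ v, f v := by
  simp [nodes, Fin.sum_univ_def]

/-- A loop that writes a computed value to the cell `g a`, for all `a`. -/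
theorem forEach_write_val {α ι β : Type} [DecidableEq ι] {l : List α} (a : Arr ι β) (g : α → ι)
    (hg : Function.Injective g) (f : α → Timed β) (body : α → Arr ι β → Timed (Arr ι β))
    (hbody : ∀ x a, (body x a).val = ⟨Function.update a.entry (g x) (f x).val⟩) :
    (∀ x ∈ l, (forEach l a body).val.entry (g x) = (f x).val) ∧
      ∀ i, (∀ x ∈ l, g x ≠ i) → (forEach l a body).val.entry i = a.entry i := by
  refine forEach_val_spec (fun pre (b : Arr ι β) => (∀ x ∈ pre, b.entry (g x) = (f x).val) ∧
    ∀ i, (∀ x ∈ pre, g x ≠ i) → b.entry i = a.entry i) (by simp) ?_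
  intro pre x post b _ ⟨h1, h2⟩
  rw [hbody]
  constructor
  · intro y hy
    by_cases hxy : y = x
    · simp [hxy]
    · dsimp only
      rw [Function.update_of_ne (fun h => hxy (hg h))]
      exact h1 y (by simpa [hxy] using hy)
  · intro i hi
    simp only [List.mem_append, List.mem_singleton] at hi
    dsimp only
    rw [Function.update_of_ne (hi x (Or.inr rfl)).symm]
    exact h2 i fun y hy => hi y (Or.inl hy)

@[simp] theorem tabulate_val {n : ℕ} {β : Type} (b : β) (f : Fin n → Timed β) (x : Fin n) :
    (tabulate b f).val.entry x = (f x).val :=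
  (forEach_write_val (l := nodes n) ⟨fun _ => b⟩ id Function.injective_id f
    (fun x a => do let y ← f x; a.write x y) (fun _ _ => rfl)).1 x (mem_nodes x)

theorem tabulate_cost_le {n : ℕ} {β : Type} (b : β) (f : Fin n → Timed β) :
    (tabulate b f).cost ≤ n + ∑ x, ((f x).cost + 2) := by
  have := forEach_cost_le_sum (l := nodes n) (init := (⟨fun _ => b⟩ : Arr (Fin n) β))
    (body := fun x a => do let y ← f x; a.write x y) (fun x => (f x).cost + 1) (fun _ => True)
    trivial (fun _ _ _ _ => trivial) fun a ha b _ => by simp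
  rw [sum_map_nodes] at this
  simpa [tabulate, add_assoc] using this

theorem forEach_forEach_write_val {n : ℕ} {ι β : Type} [DecidableEq ι] (a : Arr ι β)
    (g : Fin n → Fin n → ι) (hg : ∀ x y x' y', g x y = g x' y' → x = x' ∧ y = y')
    (f : Fin n → Fin n → Timed β) (body : Fin n → Fin n → Arr ι β → Timed (Arr ι β))
    (hbody : ∀ x y a, (body x y a).val = ⟨Function.update a.entry (g x y) (f x y).val⟩) :
    (∀ x y, (forEach (nodes n) a fun x a => forEach (nodes n) a fun y a =>
      body x y a).val.entry (g x y) = (f x y).val) ∧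
      ∀ i, (∀ x y, g x y ≠ i) → (forEach (nodes n) a fun x a => forEach (nodes n) a fun y a =>
        body x y a).val.entry i = a.entry i := by
  have key := forEach_val_spec (l := nodes n) (init := a)
    (body := fun x a => forEach (nodes n) a fun y a => body x y a)
    (fun pre b => (∀ x ∈ pre, ∀ y, b.entry (g x y) = (f x y).val) ∧
    ∀ i, (∀ x ∈ pre, ∀ y, g x y ≠ i) → b.entry i = a.entry i) (by simp) (by
    intro pre x post b _ ⟨h1, h2⟩
    have hin := forEach_write_val (l := nodes n) b (g x) (fun y y' h => (hg _ _ _ _ h).2) (f x)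
      (body x) (hbody x)
    constructor
    · intro x' hx' y
      by_cases hxx : x' = x
      · rw [hxx]; exact hin.1 y (mem_nodes y)
      · rw [hin.2 _ fun y' _ h => hxx (hg _ _ _ _ h).1.symm]
        exact h1 x' (by simpa [hxx] using hx') y
    · intro i hi
      simp only [List.mem_append, List.mem_singleton] at hi
      rw [hin.2 i fun y _ => hi x (Or.inr rfl) y]
      exact h2 i fun y hy => hi y (Or.inl hy))
  exact ⟨fun x y => key.1 x (mem_nodes x) y, fun i hi => key.2 i fun x _ y => hi x y⟩

theorem forEach_forEach_cost_le {n : ℕ} {β : Type} (a : β) (body : Fin n → Fin n → β → Timed β)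
    (k : ℕ) (hk : ∀ x y b, (body x y b).cost ≤ k) :
    (forEach (nodes n) a fun x a => forEach (nodes n) a fun y a => body x y a).cost ≤
      n * (n * (k + 1) + 1) := by
  have := forEach_cost_le (l := nodes n) (init := a)
    (body := fun x a => forEach (nodes n) a fun y a => body x y a) (n * (k + 1)) fun x _ b => by
      have := forEach_cost_le (l := nodes n) (init := b) (body := fun y a => body x y a) k
        fun y _ b => hk x y b
      simpa using this
  simpa using this

@[simp] theorem tabulate₂_val {n : ℕ} {β : Type} (b : β) (f : Fin n → Fin n → Timed β)
    (x y : Fin n) : (tabulate₂ b f).val.entry (x, y) = (f x y).val :=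
  (forEach_forEach_write_val (⟨fun _ => b⟩ : Arr (Fin n × Fin n) β) (fun x y => (x, y))
    (by simp) f (fun x y a => do let z ← f x y; a.write (x, y) z) (fun _ _ _ => rfl)).1 x y

theorem tabulate₂_cost_le_sum {n : ℕ} {β : Type} (b : β) (f : Fin n → Fin n → Timed β) :
    (tabulate₂ b f).cost ≤ n * n + (∑ x, ((∑ y, ((f x y).cost + 2)) + 1)) := by
  have := forEach_cost_le_sum (l := nodes n) (init := (⟨fun _ => b⟩ : Arr (Fin n × Fin n) β))
    (body := fun x a => forEach (nodes n) a fun y a => do let z ← f x y; a.write (x, y) z)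
    (fun x => ∑ y, ((f x y).cost + 2)) (fun _ => True)
    trivial (fun _ _ _ _ => trivial) fun x hx b _ => by
      have := forEach_cost_le_sum (l := nodes n) (init := b)
        (body := fun y a => do let z ← f x y; a.write (x, y) z) (fun y => (f x y).cost + 1)
        (fun _ => True) trivial (fun _ _ _ _ => trivial) fun a ha b _ => by simp
      rw [sum_map_nodes] at this
      simpa [add_assoc] using this
  rw [sum_map_nodes] at this
  simpa [tabulate₂] using this

theorem tabulate₂_cost_le {n : ℕ} {β : Type} (b : β) (f : Fin n → Fin n → Timed β) (k : ℕ)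
    (hk : ∀ x y, (f x y).cost ≤ k) : (tabulate₂ b f).cost ≤ n * n * (k + 4) := by
  have h1 : (∑ x, ((∑ y, ((f x y).cost + 2)) + 1)) ≤ ∑ _x : Fin n, ((∑ _y : Fin n, (k + 2)) + 1) :=
    Finset.sum_le_sum fun x _ => Nat.add_le_add_right
      (Finset.sum_le_sum fun y _ => Nat.add_le_add_right (hk x y) 2) 1
  simp only [Finset.sum_const, Finset.card_univ, Fintype.card_fin, smul_eq_mul] at h1
  have := tabulate₂_cost_le_sum b f
  -- Per cell: 1 for the allocation, `k` for the value, 2 for writing and iterating. The `n` outer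
  -- iterations are absorbed by one more unit per cell.
  rcases Nat.eq_zero_or_pos n with rfl | hn
  · simpa using this
  · nlinarith

/-! ### Lists of nodes as paths -/

/-- The length of a list of nodes with respect to a matrix of edge lengths. -/
def listLen {n : ℕ} (N : Fin n → Fin n → ℝ≥0∞) : List (Fin n) → ℝ≥0∞
  | [] => 0
  | [_] => 0
  | u :: v :: p => N u v + listLen N (v :: p)

/-- The list `p` starts with `s` and ends with `t`. -/
def FromTo {n : ℕ} (p : List (Fin n)) (s t : Fin n) : Prop :=
  p.head? = some s ∧ p.getLast? = some t

section FromTo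

variable {n : ℕ} {N : Fin n → Fin n → ℝ≥0∞} {p q : List (Fin n)} {s t u v x : Fin n}

theorem FromTo.singleton (s : Fin n) : FromTo [s] s s := by simp [FromTo]

theorem FromTo.eq_cons (h : FromTo p s t) : ∃ q, p = s :: q := by
  cases p with
  | nil => simp [FromTo] at h
  | cons a q => exact ⟨q, by simp [FromTo] at h; simp [h.1]⟩

theorem fromTo_cons_cons : FromTo (u :: v :: p) s t ↔ u = s ∧ FromTo (v :: p) v t := by
  simp [FromTo]

theorem fromTo_singleton : FromTo [u] s t ↔ u = s ∧ u = t := by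
  simp [FromTo]

theorem FromTo.cons (h : FromTo p s t) (x : Fin n) : FromTo (x :: p) x t := by
  obtain ⟨q, rfl⟩ := h.eq_cons
  exact fromTo_cons_cons.2 ⟨rfl, h⟩

theorem FromTo.append (h : FromTo (p ++ [u]) s u) (h' : FromTo (u :: q) u t) :
    FromTo (p ++ u :: q) s t := by
  constructor
  · have := h.1; simp at this ⊢; exact this
  · have := h'.2; simp at this ⊢; exact this

theorem FromTo.split (h : FromTo (p ++ u :: q) s t) :
    FromTo (p ++ [u]) s u ∧ FromTo (u :: q) u t := by
  constructor
  · constructor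
    · have := h.1; simp at this ⊢; exact this
    · simp
  · constructor
    · simp
    · have := h.2; simp at this ⊢; exact this

theorem FromTo.reverse (h : FromTo p s t) : FromTo p.reverse t s := by
  simpa [FromTo, and_comm] using h

theorem FromTo.source_mem (h : FromTo p s t) : s ∈ p := List.mem_of_mem_head? h.1

theorem FromTo.length_pos (h : FromTo p s t) : 1 ≤ p.length :=
  List.length_pos_of_mem h.source_mem

theorem listLen_cons (h : FromTo p u t) : listLen N (x :: p) = N x u + listLen N p := by
  obtain ⟨q, rfl⟩ := h.eq_cons
  rfl

theorem listLen_append (p q : List (Fin n)) (u : Fin n) :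
    listLen N (p ++ u :: q) = listLen N (p ++ [u]) + listLen N (u :: q) := by
  induction p with
  | nil => simp [listLen]
  | cons a p ih =>
    cases p with
    | nil => simp [listLen]
    | cons b p => simp only [List.cons_append, listLen] at ih ⊢; rw [ih, add_assoc]

theorem listLen_reverse (p : List (Fin n)) :
    listLen N p.reverse = listLen (fun x y => N y x) p := by
  induction p with
  | nil => rfl
  | cons a p ih =>
    cases p with
    | nil => rfl
    | cons b p =>
      rw [List.reverse_cons, List.reverse_cons, List.append_assoc, List.singleton_append,
        listLen_append, ← List.reverse_cons, ih]
      simp [listLen, add_comm]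

theorem listLen_congr {N' : Fin n → Fin n → ℝ≥0∞} (p : List (Fin n))
    (h : ∀ x ∈ p, ∀ y ∈ p, N x y = N' x y) : listLen N p = listLen N' p := by
  induction p with
  | nil => rfl
  | cons a p ih =>
    cases p with
    | nil => rfl
    | cons b p =>
      simp only [listLen]
      rw [h a (by simp) b (by simp),
        ih fun x hx y hy => h x (List.mem_cons_of_mem _ hx) y (List.mem_cons_of_mem _ hy)]

theorem listLen_mono {N' : Fin n → Fin n → ℝ≥0∞} (p : List (Fin n))
    (h : ∀ x y, N x y ≤ N' x y) : listLen N p ≤ listLen N' p := by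
  induction p with
  | nil => exact le_rfl
  | cons a p ih =>
    cases p with
    | nil => exact le_rfl
    | cons b p => exact add_le_add (h a b) ih

/-- The nodes of a list of finite length avoid every node that has no edges, apart from lists of
a single node. -/
theorem notMem_of_listLen_ne_top (p : List (Fin n)) (h : listLen N p ≠ ⊤) (a : Fin n)
    (h1 : ∀ x, N a x = ⊤) (h2 : ∀ x, N x a = ⊤) (hp : p ≠ [a]) : a ∉ p := by
  induction p with
  | nil => simp
  | cons x p ih =>
    cases p with
    | nil => simpa [eq_comm] using hp
    | cons y p =>
      simp only [listLen, ne_eq, ENNReal.add_eq_top, not_or] at h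
      have hax : a ≠ x := fun e => h.1 (e ▸ h1 y)
      have hay : a ≠ y := fun e => h.1 (e ▸ h2 x)
      have := ih h.2 (by simp [hay.symm])
      simp only [List.mem_cons, not_or] at this ⊢
      exact ⟨hax, this⟩

end FromTo

/-! ### Distances as infima over lists of nodes -/

/-- The distance with respect to a matrix of edge lengths. -/
def mdist {n : ℕ} (N : Fin n → Fin n → ℝ≥0∞) (s t : Fin n) : ℝ≥0∞ :=
  ⨅ (p : List (Fin n)) (_ : FromTo p s t), listLen N p

section mdist

variable {n : ℕ} {N : Fin n → Fin n → ℝ≥0∞} {p q : List (Fin n)} {s t u v x : Fin n}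

theorem mdist_le (h : FromTo p s t) : mdist N s t ≤ listLen N p := iInf₂_le p h

theorem le_mdist {d : ℝ≥0∞} (h : ∀ p, FromTo p s t → d ≤ listLen N p) : d ≤ mdist N s t :=
  le_iInf₂ h

theorem mdist_self (N : Fin n → Fin n → ℝ≥0∞) (s : Fin n) : mdist N s s = 0 :=
  le_antisymm (mdist_le (FromTo.singleton s)) zero_le

theorem mdist_triangle (N : Fin n → Fin n → ℝ≥0∞) (s u t : Fin n) :
    mdist N s t ≤ mdist N s u + mdist N u t := by
  conv_rhs => rw [mdist, mdist]
  simp only [ENNReal.iInf_add, ENNReal.add_iInf]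
  refine le_iInf₂ fun p hp => le_iInf₂ fun q hq => ?_
  obtain ⟨p', hp'⟩ := hq.reverse.eq_cons
  obtain rfl : q = p'.reverse ++ [u] := by
    rw [← List.reverse_cons, ← hp', List.reverse_reverse]
  obtain ⟨q', rfl⟩ := hp.eq_cons
  rw [← listLen_append]
  exact mdist_le (hq.append hp)

theorem mdist_le_edge (N : Fin n → Fin n → ℝ≥0∞) (s t : Fin n) : mdist N s t ≤ N s t := by
  simpa [listLen] using mdist_le (N := N) (p := [s, t]) (s := s) (t := t) (by simp [FromTo])

/-- A function that is zero at the target and respects all edges is bounded by the distance to the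
target. -/
theorem le_listLen_of_edges {r : Fin n → ℝ≥0∞} (hv : r v = 0)
    (hr : ∀ x y, r x ≤ N x y + r y) (p : List (Fin n)) (x : Fin n) (hp : FromTo p x v) :
    r x ≤ listLen N p := by
  induction p generalizing x with
  | nil => simp [FromTo] at hp
  | cons a p ih =>
    cases p with
    | nil =>
      obtain ⟨rfl, rfl⟩ := fromTo_singleton.1 hp
      simp [hv]
    | cons b p =>
      obtain ⟨rfl, h⟩ := fromTo_cons_cons.1 hp
      exact (hr a b).trans (by simpa [listLen] using add_le_add_right (ih b h) (N a b))

end mdist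

/-! ### Bellman-Ford -/

/-- The labels describe shortest paths to `v` with at most `h` edges, with the minimum number of
edges. -/
structure BestLabels {n : ℕ} (N : Fin n → Fin n → ℝ≥0∞) (v : Fin n) (h : ℕ)
    (lab : Fin n → Label n) : Prop where
  fromTo : ∀ x, (lab x).dist ≠ ⊤ → FromTo (lab x).path x v
  path_nil : ∀ x, (lab x).dist = ⊤ → (lab x).path = []
  length_path : ∀ x, (lab x).path.length ≤ h + 1
  listLen_path : ∀ x, listLen N (lab x).path ≤ (lab x).dist
  dist_le : ∀ x q, FromTo q x v → q.length ≤ h + 1 → (lab x).dist ≤ listLen N q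
  length_le : ∀ x q, FromTo q x v → q.length ≤ h + 1 → listLen N q ≤ (lab x).dist →
    (lab x).path.length ≤ q.length

/-- One cell of one iteration of Bellman-Ford. -/
def relaxLabel {n : ℕ} (M : WMatrix n) (lab : Arr (Fin n) (Label n)) (x : Fin n) :
    Timed (Label n) := do
  let l ← lab.read x
  forEach (nodes n) l fun u l => do
    let lu ← lab.read u
    let w ← M.read (u, x)
    let d ← step (lu.dist + w)
    let better ← step (decide (d < l.dist))
    step (if better then ⟨d, x :: lu.path⟩ else l)

theorem bellmanFordIter_eq {n : ℕ} (M : WMatrix n) (lab : Arr (Fin n) (Label n)) :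
    bellmanFordIter M lab = tabulate ⟨⊤, []⟩ (relaxLabel M lab) := rfl

/-- The last alternative records that a label changes only when it gets strictly shorter; the
minimality of the number of edges rests on this. -/
theorem relaxLabel_spec {n : ℕ} (M : WMatrix n) (lab : Arr (Fin n) (Label n)) (x : Fin n) :
    (relaxLabel M lab x).val.dist ≤ (lab.entry x).dist ∧
    (∀ u, (relaxLabel M lab x).val.dist ≤ (lab.entry u).dist + M.entry (u, x)) ∧
    ((relaxLabel M lab x).val = lab.entry x ∨
      (relaxLabel M lab x).val.dist < (lab.entry x).dist ∧
      ∃ u, (relaxLabel M lab x).val.dist = (lab.entry u).dist + M.entry (u, x) ∧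
        (relaxLabel M lab x).val.path = x :: (lab.entry u).path) := by
  have := forEach_val_spec (l := nodes n) (init := lab.entry x)
    (body := fun u l => do
      let lu ← lab.read u
      let w ← M.read (u, x)
      let d ← step (lu.dist + w)
      let better ← step (decide (d < l.dist))
      step (if better then ⟨d, x :: lu.path⟩ else l))
    (fun pre l => l.dist ≤ (lab.entry x).dist ∧
      (∀ u ∈ pre, l.dist ≤ (lab.entry u).dist + M.entry (u, x)) ∧
      (l = lab.entry x ∨ l.dist < (lab.entry x).dist ∧
        ∃ u, l.dist = (lab.entry u).dist + M.entry (u, x) ∧ l.path = x :: (lab.entry u).path))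
    (by simp) (by
      intro pre u post l _ ⟨h1, h2, h3⟩
      simp only [bind_val, read_val, step_val]
      by_cases hlt : (lab.entry u).dist + M.entry (u, x) < l.dist
      · simp only [hlt, decide_true, if_true]
        refine ⟨hlt.le.trans h1, ?_, Or.inr ⟨hlt.trans_le h1, u, rfl, rfl⟩⟩
        intro u' hu'
        rcases List.mem_append.1 hu' with hu' | hu'
        · exact hlt.le.trans (h2 u' hu')
        · rw [List.mem_singleton.1 hu']
      · simp only [hlt, decide_false, Bool.false_eq_true, if_false]
        refine ⟨h1, ?_, h3⟩
        intro u' hu'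
        rcases List.mem_append.1 hu' with hu' | hu'
        · exact h2 u' hu'
        · rw [List.mem_singleton.1 hu']; exact not_lt.1 hlt)
  exact ⟨this.1, fun u => this.2.1 u (mem_nodes u), this.2.2⟩

theorem bestLabels_init {n : ℕ} (N : Fin n → Fin n → ℝ≥0∞) (v : Fin n) :
    BestLabels N v 0 (Function.update (fun _ => ⟨⊤, []⟩) v ⟨0, [v]⟩) := by
  have hq : ∀ (q : List (Fin n)) x, FromTo q x v → q.length ≤ 0 + 1 → x = v ∧ q = [v] := by
    intro q x hq hl
    obtain ⟨q', rfl⟩ := hq.eq_cons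
    obtain rfl : q' = [] := by
      apply List.eq_nil_of_length_eq_zero; simp at hl; simpa using hl
    obtain ⟨-, rfl⟩ := fromTo_singleton.1 hq
    exact ⟨rfl, rfl⟩
  refine ⟨?_, ?_, ?_, ?_, ?_, ?_⟩
  · intro x hx
    rcases eq_or_ne x v with rfl | hne
    · simpa using FromTo.singleton x
    · simp [hne] at hx
  · intro x hx
    rcases eq_or_ne x v with rfl | hne
    · simp at hx
    · simp [hne]
  · intro x
    rcases eq_or_ne x v with rfl | hne
    · simp
    · simp [hne]
  · intro x
    rcases eq_or_ne x v with rfl | hne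
    · simp [listLen]
    · simp [hne]
  · intro x q h1 h2
    obtain ⟨rfl, rfl⟩ := hq q x h1 h2
    simp
  · intro x q h1 h2 _
    obtain ⟨rfl, rfl⟩ := hq q x h1 h2
    simp

/-- A label that changes in this round is strictly shorter than every path with at most `h` edges,
so a path that competes with it has exactly `h + 1` edges, and the new label has no more than that.
A label that does not change has at most `h` edges itself. `listLen_path` is only an inequality,
since a label without a path has an infinite distance and the empty list. -/
theorem BestLabels.iter {n : ℕ} {M : WMatrix n} {v : Fin n} {h : ℕ} {lab : Arr (Fin n) (Label n)}
    (H : BestLabels (fun x y => M.entry (y, x)) v h lab.entry) :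
    BestLabels (fun x y => M.entry (y, x)) v (h + 1) (bellmanFordIter M lab).val.entry := by
  set N : Fin n → Fin n → ℝ≥0∞ := fun x y => M.entry (y, x) with hN
  simp only [bellmanFordIter_eq]
  have hval : ∀ x, (tabulate ⟨⊤, []⟩ (relaxLabel M lab)).val.entry x =
      (relaxLabel M lab x).val := fun x => tabulate_val _ _ x
  have hle : ∀ x q, FromTo q x v → q.length ≤ h + 1 + 1 →
      (relaxLabel M lab x).val.dist ≤ listLen N q := by
    intro x q hq hl
    obtain ⟨h1, h2, h3⟩ := relaxLabel_spec M lab x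
    by_cases hl' : q.length ≤ h + 1
    · exact h1.trans (H.dist_le x q hq hl')
    · obtain ⟨q', rfl⟩ := hq.eq_cons
      cases q' with
      | nil => simp at hl'
      | cons u q' =>
        obtain ⟨-, hq'⟩ := fromTo_cons_cons.1 hq
        have := H.dist_le u _ hq' (by simpa using hl)
        refine (h2 u).trans ?_
        rw [listLen, add_comm]
        exact add_le_add le_rfl this
  refine ⟨?_, ?_, ?_, ?_, ?_, ?_⟩
  · intro x hx
    rw [hval] at hx ⊢
    obtain ⟨h1, h2, h3 | ⟨-, u, h3, h4⟩⟩ := relaxLabel_spec M lab x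
    · rw [h3] at hx ⊢; exact H.fromTo x hx
    · rw [h4]
      rw [h3] at hx
      exact (H.fromTo u fun h => hx (by simp [h])).cons x
  · intro x hx
    rw [hval] at hx ⊢
    obtain ⟨h1, h2, h3 | ⟨h5, u, h3, h4⟩⟩ := relaxLabel_spec M lab x
    · rw [h3] at hx ⊢; exact H.path_nil x hx
    · exact absurd (hx ▸ h5) not_top_lt
  · intro x
    rw [hval]
    obtain ⟨h1, h2, h3 | ⟨h5, u, h3, h4⟩⟩ := relaxLabel_spec M lab x
    · rw [h3]; exact (H.length_path x).trans (by omega)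
    · rw [h4]; simpa using H.length_path u
  · intro x
    rw [hval]
    obtain ⟨h1, h2, h3 | ⟨h5, u, h3, h4⟩⟩ := relaxLabel_spec M lab x
    · rw [h3]; exact H.listLen_path x
    · by_cases hu : (lab.entry u).dist = ⊤
      · rw [h3, hu]; simp
      · rw [h4, h3, listLen_cons (H.fromTo u hu), add_comm]
        exact add_le_add (H.listLen_path u) le_rfl
  · intro x q hq hl
    rw [hval]
    exact hle x q hq hl
  · intro x q hq hl hd
    rw [hval] at hd ⊢
    by_cases hl' : q.length ≤ h + 1
    · obtain ⟨h1, h2, h3 | ⟨h5, u, h3, h4⟩⟩ := relaxLabel_spec M lab x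
      · rw [h3] at hd ⊢; exact H.length_le x q hq hl' hd
      · exact absurd (H.dist_le x q hq hl') (not_le.2 (hd.trans_lt h5))
    · obtain ⟨h1, h2, h3 | ⟨h5, u, h3, h4⟩⟩ := relaxLabel_spec M lab x
      · rw [h3]; exact (H.length_path x).trans (by omega)
      · rw [h4]
        have := H.length_path u
        simp only [List.length_cons]; omega

/-- Labels list their nodes from `x` back to the source, so they are paths to `v` for the transposed
matrix. -/
theorem bellmanFord_spec {n : ℕ} (h : ℕ) (M : WMatrix n) (v : Fin n) :
    BestLabels (fun x y => M.entry (y, x)) v h (bellmanFord h M v).val.entry := by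
  have := forEach_val_spec (l := List.range h)
    (init := (⟨Function.update (fun _ => ⟨⊤, []⟩) v ⟨0, [v]⟩⟩ : Arr (Fin n) (Label n)))
    (body := fun _ lab => bellmanFordIter M lab)
    (fun pre lab => BestLabels (fun x y => M.entry (y, x)) v pre.length lab.entry)
    (bestLabels_init _ v) (by
      intro pre a post lab _ H
      simpa using H.iter)
  simpa [bellmanFord] using this

theorem bellmanFordIter_cost_le {n : ℕ} (M : WMatrix n) (lab : Arr (Fin n) (Label n)) :
    (bellmanFordIter M lab).cost ≤ 10 * (n * n) := by
  have h1 : ∀ x, (relaxLabel M lab x).cost ≤ 1 + n * 6 := by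
    intro x
    have := forEach_cost_le (l := nodes n) (init := lab.entry x) (body := fun u l => do
      let lu ← lab.read u
      let w ← M.read (u, x)
      let d ← step (lu.dist + w)
      let better ← step (decide (d < l.dist))
      step (if better then (⟨d, x :: lu.path⟩ : Label n) else l)) 5 (by simp)
    simpa [relaxLabel] using this
  have h2 := tabulate_cost_le (⟨⊤, []⟩ : Label n) (relaxLabel M lab)
  rw [← bellmanFordIter_eq] at h2
  have h3 : ∑ x, ((relaxLabel M lab x).cost + 2) ≤ ∑ _x : Fin n, (1 + n * 6 + 2) :=
    Finset.sum_le_sum fun x _ => Nat.add_le_add_right (h1 x) 2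
  simp only [Finset.sum_const, Finset.card_univ, Fintype.card_fin, smul_eq_mul] at h3
  rcases Nat.eq_zero_or_pos n with rfl | hn
  · simpa using h2
  · nlinarith

theorem bellmanFord_cost_le {n : ℕ} (h : ℕ) (M : WMatrix n) (v : Fin n) :
    (bellmanFord h M v).cost ≤ 11 * (h + 1) * (n * n) := by
  have := forEach_cost_le (l := List.range h)
    (init := (⟨Function.update (fun _ => ⟨⊤, []⟩) v ⟨0, [v]⟩⟩ : Arr (Fin n) (Label n)))
    (body := fun _ lab => bellmanFordIter M lab) (10 * (n * n))
    fun _ _ lab => bellmanFordIter_cost_le M lab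
  have h2 : (bellmanFord h M v).cost ≤ n + 1 + h * (10 * (n * n) + 1) := by
    simp only [List.length_range] at this
    simp only [bellmanFord, bind_cost, alloc_cost, alloc_val, write_cost, write_val,
      Fintype.card_fin]
    omega
  have hn : 1 ≤ n := Fin.pos v
  nlinarith [Nat.mul_le_mul hn hn, Nat.mul_le_mul (le_refl h) (Nat.mul_le_mul hn hn)]

/-! ### Dijkstra's algorithm -/

/-- The invariant of the priority queue. -/
structure Queue.Valid {n : ℕ} (Q : Queue n) : Prop where
  eq_top_of_none : ∀ k, Q.minKey.entry k = none → ∀ x, block x = k → Q.settled.entry x = false →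
    Q.dist.entry x = ⊤
  block_minKey : ∀ k z, Q.minKey.entry k = some z → block z = k
  settled_minKey : ∀ k z, Q.minKey.entry k = some z → Q.settled.entry z = false
  dist_minKey : ∀ k z, Q.minKey.entry k = some z → Q.dist.entry z ≠ ⊤
  minKey_le : ∀ k z, Q.minKey.entry k = some z → ∀ x, block x = k → Q.settled.entry x = false →
    Q.dist.entry z ≤ Q.dist.entry x

/-- Since n < (⌊√n⌋ + 1)², there are no more blocks than cells in a block, and the scan in
`Queue.findMin` reaches every block. -/
theorem block_val_lt {n : ℕ} (x : Fin n) : (block x).val < blockSize n := by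
  have h := Nat.lt_succ_sqrt n
  exact Nat.div_lt_of_lt_mul (x.isLt.trans h)

theorem better_spec {n : ℕ} (best : Option (Fin n × ℝ≥0∞)) (x : Fin n) (d : ℝ≥0∞) :
    ∃ b, better best x d = some b ∧ b.2 ≤ d ∧ (b = (x, d) ∨ best = some b) ∧
      ∀ b', best = some b' → b.2 ≤ b'.2 := by
  cases best with
  | none => exact ⟨(x, d), rfl, le_rfl, Or.inl rfl, by simp⟩
  | some b =>
    by_cases h : d < b.2
    · exact ⟨(x, d), by simp [better, h], le_rfl, Or.inl rfl, by simpa using h.le⟩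
    · exact ⟨b, by simp [better, h], not_lt.1 h, Or.inr rfl, by simp⟩

/-- The body of the loop of `Queue.findMin`. -/
def findMinBody {n : ℕ} (Q : Queue n) (k : ℕ) (best : Option (Fin n × ℝ≥0∞)) :
    Timed (Option (Fin n × ℝ≥0∞)) := do
  if hk : k < n then do
    let m ← Q.minKey.read ⟨k, hk⟩
    match m with
    | none => pure best
    | some x => do
      let d ← Q.dist.read x
      step (better best x d)
  else pure best

/-- The body of the loop of `Queue.settle`. -/
def settleBody {n : ℕ} (S : Fin n → Bool) (dist : Arr (Fin n) ℝ≥0∞) (first j : ℕ)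
    (best : Option (Fin n × ℝ≥0∞)) : Timed (Option (Fin n × ℝ≥0∞)) := do
  if hy : first + j < n then do
    let f ← (⟨S⟩ : Arr (Fin n) Bool).read ⟨first + j, hy⟩
    let d ← dist.read ⟨first + j, hy⟩
    let skip ← step (f || decide (d = ⊤))
    if skip then pure best else step (better best ⟨first + j, hy⟩ d)
  else pure best

theorem settleBody_of_lt {n : ℕ} (S : Fin n → Bool) (dist : Arr (Fin n) ℝ≥0∞) (first j : ℕ)
    (best : Option (Fin n × ℝ≥0∞)) (hy : first + j < n) :
    settleBody S dist first j best = ⟨if S ⟨first + j, hy⟩ = true ∨ dist.entry ⟨first + j, hy⟩ = ⊤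
      then best else better best ⟨first + j, hy⟩ (dist.entry ⟨first + j, hy⟩),
      3 + if S ⟨first + j, hy⟩ = true ∨ dist.entry ⟨first + j, hy⟩ = ⊤ then 0 else 1⟩ := by
  rw [settleBody, dif_pos hy]
  by_cases h : S ⟨first + j, hy⟩ = true ∨ dist.entry ⟨first + j, hy⟩ = ⊤
  · have h' : (S ⟨first + j, hy⟩ || decide (dist.entry ⟨first + j, hy⟩ = ⊤)) = true := by
      simpa using h
    rw [if_pos h, if_pos h]
    show (⟨(if (S ⟨first + j, hy⟩ || decide (dist.entry ⟨first + j, hy⟩ = ⊤)) = true then pure best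
      else step (better best ⟨first + j, hy⟩ (dist.entry ⟨first + j, hy⟩)) : Timed _).val,
      1 + (1 + (1 + (if (S ⟨first + j, hy⟩ || decide (dist.entry ⟨first + j, hy⟩ = ⊤)) = true
      then pure best else step (better best ⟨first + j, hy⟩
        (dist.entry ⟨first + j, hy⟩)) : Timed _).cost))⟩ : Timed _) = _
    rw [if_pos h']
    rfl
  · have h' : ¬ (S ⟨first + j, hy⟩ || decide (dist.entry ⟨first + j, hy⟩ = ⊤)) = true := by
      simpa using h
    rw [if_neg h, if_neg h]
    show (⟨(if (S ⟨first + j, hy⟩ || decide (dist.entry ⟨first + j, hy⟩ = ⊤)) = true then pure best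
      else step (better best ⟨first + j, hy⟩ (dist.entry ⟨first + j, hy⟩)) : Timed _).val,
      1 + (1 + (1 + (if (S ⟨first + j, hy⟩ || decide (dist.entry ⟨first + j, hy⟩ = ⊤)) = true
      then pure best else step (better best ⟨first + j, hy⟩
        (dist.entry ⟨first + j, hy⟩)) : Timed _).cost))⟩ : Timed _) = _
    rw [if_neg h']
    rfl

/-- The node found by `Queue.findMin`. -/
theorem Queue.findMin_spec {n : ℕ} {Q : Queue n} (hQ : Q.Valid) :
    (Q.findMin.val = none → ∀ x, Q.settled.entry x = false → Q.dist.entry x = ⊤) ∧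
    (∀ x, Q.findMin.val = some x → Q.settled.entry x = false ∧ Q.dist.entry x ≠ ⊤ ∧
      ∀ y, Q.settled.entry y = false → Q.dist.entry x ≤ Q.dist.entry y) := by
  have key := forEach_val_spec (l := List.range (blockSize n))
    (init := (none : Option (Fin n × ℝ≥0∞)))
    (body := findMinBody Q)
    (fun pre best => (best = none → ∀ k : Fin n, k.val ∈ pre → Q.minKey.entry k = none) ∧
      ∀ b, best = some b → b.2 = Q.dist.entry b.1 ∧ (∃ k, Q.minKey.entry k = some b.1) ∧
        ∀ k : Fin n, k.val ∈ pre → ∀ z, Q.minKey.entry k = some z → b.2 ≤ Q.dist.entry z)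
    (by simp) (by
      intro pre k post best _ ⟨h1, h2⟩
      by_cases hk : k < n
      · have hmem : ∀ k' : Fin n, k'.val ∈ pre ++ [k] → k'.val ∈ pre ∨ k' = ⟨k, hk⟩ := by
          intro k' hk'
          simpa [Fin.ext_iff] using hk'
        simp only [findMinBody, hk, dite_true, bind_val, read_val]
        cases hm : Q.minKey.entry ⟨k, hk⟩ with
        | none =>
          refine ⟨?_, ?_⟩
          · intro hb k' hk'
            rcases hmem k' hk' with h | rfl
            · exact h1 hb k' h
            · exact hm
          · intro b hb
            refine ⟨(h2 b hb).1, (h2 b hb).2.1, ?_⟩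
            intro k' hk' z hz
            rcases hmem k' hk' with h | rfl
            · exact (h2 b hb).2.2 k' h z hz
            · simp [hm] at hz
        | some x =>
          obtain ⟨b, hb, hb1, hb2, hb3⟩ := better_spec best x (Q.dist.entry x)
          simp only [bind_val, read_val, step_val, hb]
          refine ⟨by simp, ?_⟩
          rintro b' hb'
          obtain rfl := Option.some.inj hb'
          refine ⟨?_, ?_, ?_⟩
          · rcases hb2 with rfl | h
            · rfl
            · exact (h2 _ h).1
          · rcases hb2 with rfl | h
            · exact ⟨_, hm⟩
            · exact (h2 _ h).2.1
          · intro k' hk' z hz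
            rcases hmem k' hk' with h | rfl
            · cases hbest : best with
              | none => simp [h1 hbest k' h] at hz
              | some b' => exact (hb3 b' hbest).trans ((h2 b' hbest).2.2 k' h z hz)
            · rw [hm] at hz
              rw [← Option.some.inj hz]
              exact hb1
      · have hmem : ∀ k' : Fin n, k'.val ∈ pre ++ [k] → k'.val ∈ pre := by
          intro k' hk'
          have : k'.val ≠ k := fun h => hk (h ▸ k'.isLt)
          simpa [this] using hk'
        simp only [findMinBody, hk, dite_false, pure_val]
        exact ⟨fun hb k' hk' => h1 hb k' (hmem k' hk'), fun b hb => ⟨(h2 b hb).1, (h2 b hb).2.1,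
          fun k' hk' => (h2 b hb).2.2 k' (hmem k' hk')⟩⟩)
  have hfind : Q.findMin.val = (forEach (List.range (blockSize n))
    (none : Option (Fin n × ℝ≥0∞)) (findMinBody Q)).val.map Prod.fst := rfl
  obtain ⟨h1, h2⟩ := key
  rw [hfind]
  have hin : ∀ x : Fin n, (block x).val ∈ List.range (blockSize n) := fun x =>
    List.mem_range.2 (block_val_lt x)
  constructor
  · intro h x hx
    exact hQ.eq_top_of_none _ (h1 (by simpa using h) (block x) (hin x)) x rfl hx
  · intro x h
    obtain ⟨b, hb, rfl⟩ := Option.map_eq_some_iff.1 h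
    obtain ⟨h3, ⟨k, hk⟩, h5⟩ := h2 b hb
    refine ⟨hQ.settled_minKey k _ hk, hQ.dist_minKey k _ hk, fun y hy => ?_⟩
    cases hm : Q.minKey.entry (block y) with
    | none => rw [hQ.eq_top_of_none _ hm y rfl hy]; exact le_top
    | some z => exact h3 ▸ (h5 _ (hin y) z hm).trans (hQ.minKey_le _ z hm y rfl hy)

theorem Queue.findMin_cost_le {n : ℕ} (Q : Queue n) : Q.findMin.cost ≤ 4 * blockSize n + 1 := by
  have := forEach_cost_le (l := List.range (blockSize n)) (init := (none : Option (Fin n × ℝ≥0∞)))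
    (body := findMinBody Q) 3 (by
      intro k _ best
      by_cases hk : k < n
      · simp only [findMinBody, hk, dite_true, bind_cost, read_val, read_cost]
        cases Q.minKey.entry ⟨k, hk⟩ <;> simp
      · simp [findMinBody, hk])
  simp only [List.length_range] at this
  exact (Nat.add_le_add_right this 1).trans (by omega)

/-- Only the block of `x` has lost a candidate, and the rescan covers exactly the nodes of that
block. In other blocks the stored node stays valid, being different from `x`. -/
theorem Queue.settle_spec {n : ℕ} {Q : Queue n} (hQ : Q.Valid) (x : Fin n) :
    (Q.settle x).val.Valid ∧ (Q.settle x).val.dist = Q.dist ∧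
      (Q.settle x).val.settled.entry = Function.update Q.settled.entry x true := by
  refine ⟨?_, rfl, rfl⟩
  set S := Function.update Q.settled.entry x true with hS
  set B := blockSize n
  set first := (block x).val * B with hfirst
  set body := settleBody S Q.dist first with hbody
  have key := forEach_val_spec (l := List.range B) (init := (none : Option (Fin n × ℝ≥0∞)))
    (body := body)
    (fun pre best => (best = none → ∀ y : Fin n, ∀ j ∈ pre, y.val = first + j → S y = false →
        Q.dist.entry y = ⊤) ∧
      ∀ b, best = some b → b.2 = Q.dist.entry b.1 ∧ (∃ j ∈ pre, b.1.val = first + j) ∧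
        S b.1 = false ∧ b.2 ≠ ⊤ ∧
        ∀ y : Fin n, ∀ j ∈ pre, y.val = first + j → S y = false → b.2 ≤ Q.dist.entry y)
    (by simp) (by
      intro pre j post best _ ⟨h1, h2⟩
      by_cases hj : first + j < n
      · by_cases hskip : S ⟨first + j, hj⟩ = true ∨ Q.dist.entry ⟨first + j, hj⟩ = ⊤
        · have hv : (body j best).val = best := by
            rw [hbody, settleBody_of_lt _ _ _ _ _ hj, if_pos hskip]
          have hnew : ∀ y : Fin n, y.val = first + j → S y = false → Q.dist.entry y = ⊤ := by
            intro y hy hSy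
            obtain rfl : y = ⟨first + j, hj⟩ := Fin.ext hy
            exact hskip.resolve_left (by simp [hSy])
          rw [hv]
          refine ⟨fun hb y j' hj' hy hSy => ?_, fun b hb => ?_⟩
          · rcases List.mem_append.1 hj' with h | h
            · exact h1 hb y j' h hy hSy
            · rw [List.mem_singleton.1 h] at hy
              exact hnew y hy hSy
          · obtain ⟨h3, ⟨j', hj', h4⟩, h5, h6, h7⟩ := h2 b hb
            refine ⟨h3, ⟨j', List.mem_append_left _ hj', h4⟩, h5, h6, fun y j' hj' hy hSy => ?_⟩
            rcases List.mem_append.1 hj' with h | h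
            · exact h7 y j' h hy hSy
            · rw [List.mem_singleton.1 h] at hy
              rw [hnew y hy hSy]
              exact le_top
        · have hv : (body j best).val =
              better best ⟨first + j, hj⟩ (Q.dist.entry ⟨first + j, hj⟩) := by
            rw [hbody, settleBody_of_lt _ _ _ _ _ hj, if_neg hskip]
          obtain ⟨hs1, hs2⟩ := not_or.1 hskip
          obtain ⟨b, hb, hb1, hb2, hb3⟩ :=
            better_spec best ⟨first + j, hj⟩ (Q.dist.entry ⟨first + j, hj⟩)
          rw [hv, hb]
          refine ⟨by simp, ?_⟩
          rintro b' hb'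
          obtain rfl := Option.some.inj hb'
          refine ⟨?_, ?_, ?_, ?_, ?_⟩
          · rcases hb2 with rfl | h
            · rfl
            · exact (h2 _ h).1
          · rcases hb2 with rfl | h
            · exact ⟨j, by simp, rfl⟩
            · obtain ⟨j', hj', h4⟩ := (h2 _ h).2.1
              exact ⟨j', List.mem_append_left _ hj', h4⟩
          · rcases hb2 with rfl | h
            · simpa using hs1
            · exact (h2 _ h).2.2.1
          · rcases hb2 with rfl | h
            · exact hs2
            · exact (h2 _ h).2.2.2.1
          · intro y j' hj' hy hSy
            rcases List.mem_append.1 hj' with h | h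
            · cases hbest : best with
              | none => rw [h1 hbest y j' h hy hSy]; exact le_top
              | some b' => exact (hb3 b' hbest).trans ((h2 b' hbest).2.2.2.2 y j' h hy hSy)
            · rw [List.mem_singleton.1 h] at hy
              obtain rfl : y = ⟨first + j, hj⟩ := Fin.ext hy
              exact hb1
      · have hv : (body j best).val = best := by simp [hbody, settleBody, hj]
        rw [hv]
        refine ⟨fun hb y j' hj' hy hSy => ?_, fun b hb => ?_⟩
        · rcases List.mem_append.1 hj' with h | h
          · exact h1 hb y j' h hy hSy
          · rw [List.mem_singleton.1 h] at hy
            exact absurd (hy ▸ y.isLt) hj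
        · obtain ⟨h3, ⟨j', hj', h4⟩, h5, h6, h7⟩ := h2 b hb
          refine ⟨h3, ⟨j', List.mem_append_left _ hj', h4⟩, h5, h6, fun y j' hj' hy hSy => ?_⟩
          rcases List.mem_append.1 hj' with h | h
          · exact h7 y j' h hy hSy
          · rw [List.mem_singleton.1 h] at hy
            exact absurd (hy ▸ y.isLt) hj)
  have hkey : (Q.settle x).val.minKey.entry = Function.update Q.minKey.entry (block x)
    ((forEach (List.range B) none body).val.map Prod.fst) := rfl
  have hB : 0 < B := Nat.succ_pos _
  -- The offset within the block is the remainder modulo the block size; `hin` and `hout` together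
  -- say that the scanned cells are exactly the block.
  have hin : ∀ y : Fin n, block y = block x → ∃ j ∈ List.range B, y.val = first + j := by
    intro y hy
    refine ⟨y.val % B, List.mem_range.2 (Nat.mod_lt _ hB), ?_⟩
    rw [hfirst, ← hy]
    show y.val = y.val / B * B + y.val % B
    rw [Nat.div_add_mod']
  have hout : ∀ y : Fin n, (∃ j ∈ List.range B, y.val = first + j) → block y = block x := by
    rintro y ⟨j, hj, hy⟩
    apply Fin.ext
    show y.val / B = _
    rw [hy, hfirst, mul_comm, Nat.mul_add_div hB, Nat.div_eq_of_lt (List.mem_range.1 hj), add_zero]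
  have hSS : ∀ y, S y = false → Q.settled.entry y = false := by
    intro y hy
    by_cases hyx : y = x
    · simp [hS, hyx] at hy
    · simpa [hS, hyx] using hy
  obtain ⟨h1, h2⟩ := key
  refine ⟨?_, ?_, ?_, ?_, ?_⟩
  · intro k hk y hy hSy
    rw [hkey] at hk
    by_cases hkx : k = block x
    · subst hkx
      rw [Function.update_self] at hk
      obtain ⟨j, hj, hyj⟩ := hin y hy
      exact h1 (by simpa using hk) y j hj hyj hSy
    · rw [Function.update_of_ne hkx] at hk
      exact hQ.eq_top_of_none k hk y hy (hSS y hSy)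
  all_goals
    intro k z hk
    rw [hkey] at hk
    by_cases hkx : k = block x
  · subst hkx
    rw [Function.update_self] at hk
    obtain ⟨b, hb, rfl⟩ := Option.map_eq_some_iff.1 hk
    exact hout _ (h2 b hb).2.1
  · rw [Function.update_of_ne hkx] at hk
    exact hQ.block_minKey k z hk
  · subst hkx
    rw [Function.update_self] at hk
    obtain ⟨b, hb, rfl⟩ := Option.map_eq_some_iff.1 hk
    exact (h2 b hb).2.2.1
  · rw [Function.update_of_ne hkx] at hk
    show S z = false
    rw [hS, Function.update_of_ne (fun h => hkx (by rw [← h, hQ.block_minKey k z hk]))]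
    exact hQ.settled_minKey k z hk
  · subst hkx
    rw [Function.update_self] at hk
    obtain ⟨b, hb, rfl⟩ := Option.map_eq_some_iff.1 hk
    obtain ⟨h3, -, -, h4, -⟩ := h2 b hb
    exact h3 ▸ h4
  · rw [Function.update_of_ne hkx] at hk
    exact hQ.dist_minKey k z hk
  · subst hkx
    rw [Function.update_self] at hk
    obtain ⟨b, hb, rfl⟩ := Option.map_eq_some_iff.1 hk
    obtain ⟨h3, -, -, -, h4⟩ := h2 b hb
    intro y hy hSy
    obtain ⟨j, hj, hyj⟩ := hin y hy
    exact h3 ▸ h4 y j hj hyj hSy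
  · rw [Function.update_of_ne hkx] at hk
    exact fun y hy hSy => hQ.minKey_le k z hk y hy (hSS y hSy)

theorem Queue.settle_cost_le {n : ℕ} (Q : Queue n) (x : Fin n) :
    (Q.settle x).cost ≤ 5 * blockSize n + 3 := by
  have := forEach_cost_le (l := List.range (blockSize n)) (init := (none : Option (Fin n × ℝ≥0∞)))
    (body := settleBody (Function.update Q.settled.entry x true) Q.dist
      ((block x).val * blockSize n)) 4 (by
      intro k _ best
      by_cases hk : (block x).val * blockSize n + k < n
      · rw [settleBody_of_lt _ _ _ _ _ hk]
        show 3 + _ ≤ 4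
        split_ifs <;> simp
      · simp [settleBody, hk])
  simp only [List.length_range] at this
  exact (Nat.add_le_add_left (Nat.add_le_add_left (Nat.add_le_add_right this 1) 1) 1).trans
    (by omega)

/-- The hypothesis `hy` excludes an improvement of a settled node, which would otherwise enter
`minKey`. Lowering one key can only make its own node the new minimum of the block, so a single
comparison with the stored node suffices. -/
theorem Queue.relax_spec {n : ℕ} {Q : Queue n} (hQ : Q.Valid) (y : Fin n) (d : ℝ≥0∞)
    (hy : Q.settled.entry y = true → Q.dist.entry y ≤ d) :
    (Q.relax y d).val.Valid ∧ (Q.relax y d).val.settled = Q.settled ∧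
      (Q.relax y d).val.dist.entry =
        Function.update Q.dist.entry y (min (Q.dist.entry y) d) := by
  by_cases hlt : d < Q.dist.entry y
  · have hyS : Q.settled.entry y = false := by
      by_contra h
      exact absurd (hy (by simpa using h)) (not_le.2 hlt)
    set dist := Function.update Q.dist.entry y d with hdist
    have hmono : ∀ x, dist x ≤ Q.dist.entry x := by
      intro x
      by_cases hxy : x = y
      · rw [hxy, hdist, Function.update_self]; exact hlt.le
      · rw [hdist, Function.update_of_ne hxy]
    -- The case in which the stored node of the block is still at least as good as `y`.
    have hkeep : Q.minKey.entry (block y) ≠ none → ∀ (m : Fin n → Option (Fin n)),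
        (∀ k z, m k = some z → Q.minKey.entry k = some z ∧
          (k = block y → dist z ≤ d)) → (∀ k, m k = none → Q.minKey.entry k = none) →
          (⟨⟨dist⟩, Q.settled, ⟨m⟩⟩ : Queue n).Valid := by
      intro hb m h1 h2
      refine ⟨?_, ?_, ?_, ?_, ?_⟩
      · intro k hk x hx hSx
        have hxy : x ≠ y := by
          rintro rfl
          exact hb (h2 _ (hx ▸ hk))
        show dist x = ⊤
        rw [hdist, Function.update_of_ne hxy]
        exact hQ.eq_top_of_none k (h2 k hk) x hx hSx
      · exact fun k z hk => hQ.block_minKey k z (h1 k z hk).1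
      · exact fun k z hk => hQ.settled_minKey k z (h1 k z hk).1
      · exact fun k z hk => ne_top_of_le_ne_top (hQ.dist_minKey k z (h1 k z hk).1) (hmono z)
      · intro k z hk x hx hSx
        obtain ⟨h3, h4⟩ := h1 k z hk
        show dist z ≤ dist x
        by_cases hxy : x = y
        · subst hxy
          rw [hdist, Function.update_self]
          exact h4 hx.symm
        · conv_rhs => rw [hdist, Function.update_of_ne hxy]
          exact (hmono z).trans (hQ.minKey_le k z h3 x hx hSx)
    -- The case in which `y` becomes the stored node of its block.
    have hnew : (∀ x, block x = block y → x ≠ y → Q.settled.entry x = false →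
        d ≤ Q.dist.entry x) →
        (⟨⟨dist⟩, Q.settled, ⟨Function.update Q.minKey.entry (block y) (some y)⟩⟩ :
          Queue n).Valid := by
      intro hmin
      have hother : ∀ x, block x ≠ block y → dist x = Q.dist.entry x := by
        intro x hx
        rw [hdist, Function.update_of_ne (fun h => hx (by rw [h]))]
      refine ⟨?_, ?_, ?_, ?_, ?_⟩
      · intro k hk x hx hSx
        by_cases hkx : k = block y
        · subst hkx
          simp at hk
        · simp only [Function.update_of_ne hkx] at hk
          show dist x = ⊤
          rw [hother x (hx ▸ hkx)]
          exact hQ.eq_top_of_none k hk x hx hSx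
      all_goals
        intro k z hk
        by_cases hkx : k = block y
      · subst hkx
        simp only [Function.update_self, Option.some.injEq] at hk
        rw [hk]
      · simp only [Function.update_of_ne hkx] at hk
        exact hQ.block_minKey k z hk
      · subst hkx
        simp only [Function.update_self, Option.some.injEq] at hk
        rw [← hk]; exact hyS
      · simp only [Function.update_of_ne hkx] at hk
        exact hQ.settled_minKey k z hk
      · subst hkx
        simp only [Function.update_self, Option.some.injEq] at hk
        show dist z ≠ ⊤
        rw [← hk, hdist, Function.update_self]
        exact hlt.ne_top
      · simp only [Function.update_of_ne hkx] at hk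
        exact ne_top_of_le_ne_top (hQ.dist_minKey k z hk) (hmono z)
      · subst hkx
        simp only [Function.update_self, Option.some.injEq] at hk
        subst hk
        intro x hx hSx
        show dist y ≤ dist x
        by_cases hxy : x = y
        · rw [hxy]
        · rw [hdist, Function.update_self, Function.update_of_ne hxy]
          exact hmin x hx hxy hSx
      · simp only [Function.update_of_ne hkx] at hk
        intro x hx hSx
        show dist z ≤ dist x
        rw [hother x (hx ▸ hkx)]
        exact (hmono z).trans (hQ.minKey_le k z hk x hx hSx)
    rw [min_eq_right hlt.le]
    cases hm : Q.minKey.entry (block y) with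
    | none =>
      have hv : (Q.relax y d).val =
          ⟨⟨dist⟩, Q.settled, ⟨Function.update Q.minKey.entry (block y) (some y)⟩⟩ := by
        simp [Queue.relax, hlt, hm, hdist]
      rw [hv]
      refine ⟨hnew fun x hx _ hSx => ?_, rfl, rfl⟩
      rw [hQ.eq_top_of_none _ hm x hx hSx]
      exact le_top
    | some z =>
      by_cases hz : d < dist z
      · have hv : (Q.relax y d).val =
            ⟨⟨dist⟩, Q.settled, ⟨Function.update Q.minKey.entry (block y) (some y)⟩⟩ := by
          simp [Queue.relax, hlt, hm, ← hdist, hz]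
        rw [hv]
        refine ⟨hnew fun x hx _ hSx => ?_, rfl, rfl⟩
        exact hz.le.trans ((hmono z).trans (hQ.minKey_le _ z hm x hx hSx))
      · have hv : (Q.relax y d).val = ⟨⟨dist⟩, Q.settled, Q.minKey⟩ := by
          simp [Queue.relax, hlt, hm, ← hdist, hz]
        rw [hv]
        refine ⟨hkeep (by simp [hm]) Q.minKey.entry ?_ fun k hk => hk, rfl, rfl⟩
        refine fun k z' hk => ⟨hk, ?_⟩
        rintro rfl
        rw [hm] at hk
        rw [← Option.some.inj hk]
        exact not_lt.1 hz
  · have hv : (Q.relax y d).val = Q := by simp [Queue.relax, hlt]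
    rw [hv, min_eq_left (not_lt.1 hlt), Function.update_eq_self]
    exact ⟨hQ, rfl, rfl⟩

theorem Queue.relax_cost_le {n : ℕ} (Q : Queue n) (y : Fin n) (d : ℝ≥0∞) :
    (Q.relax y d).cost ≤ 7 := by
  by_cases hlt : d < Q.dist.entry y
  · cases hm : Q.minKey.entry (block y) with
    | none => simp [Queue.relax, hlt, hm]
    | some z =>
      by_cases hz : d < Function.update Q.dist.entry y d z
      · simp [Queue.relax, hlt, hm, hz]
      · simp [Queue.relax, hlt, hm, hz]
  · simp [Queue.relax, hlt]

/-- One round of Dijkstra's algorithm. -/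
def dijkstraRound {n : ℕ} (adj : Arr (Fin n) (List (Fin n × ℝ≥0∞))) (Q : Queue n) :
    Timed (Queue n) := do
  let x ← Q.findMin
  match x with
  | none => pure Q
  | some x => do
    let Q ← Q.settle x
    let dx ← Q.dist.read x
    let l ← adj.read x
    forEach l Q fun e Q => do
      let d ← step (dx + e.2)
      Q.relax e.1 d

/-- A function that is a lower bound for all distances from `v`. -/
structure IsPotential {n : ℕ} (adj : Fin n → List (Fin n × ℝ≥0∞)) (v : Fin n)
    (φ : Fin n → ℝ≥0∞) : Prop where
  source : φ v = 0
  edge_le : ∀ x, ∀ e ∈ adj x, φ e.1 ≤ φ x + e.2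

/-- The invariant of the main loop of Dijkstra's algorithm. -/
structure DijkstraInv {n : ℕ} (adj : Fin n → List (Fin n × ℝ≥0∞)) (v : Fin n) (Q : Queue n) :
    Prop where
  valid : Q.Valid
  source : Q.dist.entry v = 0
  edge_le : ∀ x, Q.settled.entry x = true → ∀ e ∈ adj x,
    Q.dist.entry e.1 ≤ Q.dist.entry x + e.2
  settled_le : ∀ x y, Q.settled.entry x = true → Q.settled.entry y = false →
    Q.dist.entry x ≤ Q.dist.entry y
  potential_le : ∀ φ, IsPotential adj v φ → ∀ y, φ y ≤ Q.dist.entry y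

/-- The settled nodes. -/
def Queue.settledSet {n : ℕ} (Q : Queue n) : Finset (Fin n) :=
  {x | Q.settled.entry x = true}

/-- The estimate `dx` of the extracted node separates the settled estimates from the unsettled ones.
As lengths are non-negative, relaxing an edge out of `x` never lowers a settled estimate nor brings
an unsettled one below `dx`, so the separation survives. The second alternative exhibits the newly
settled node, to which the scan of its adjacency list is charged. -/
theorem dijkstraRound_spec {n : ℕ} {adj : Arr (Fin n) (List (Fin n × ℝ≥0∞))} {v : Fin n}
    {Q : Queue n} (hQ : DijkstraInv adj.entry v Q) :
    DijkstraInv adj.entry v (dijkstraRound adj Q).val ∧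
    (((dijkstraRound adj Q).val = Q ∧ (∀ x, Q.settled.entry x = false → Q.dist.entry x = ⊤) ∧
      (dijkstraRound adj Q).cost ≤ 4 * blockSize n + 1) ∨
     ∃ x, x ∉ Q.settledSet ∧ (dijkstraRound adj Q).val.settledSet = insert x Q.settledSet ∧
      (dijkstraRound adj Q).cost ≤ 9 * blockSize n + 6 + 9 * (adj.entry x).length) := by
  obtain ⟨hnone, hsome⟩ := Queue.findMin_spec hQ.valid
  have hcost := Q.findMin_cost_le
  cases hx : Q.findMin.val with
  | none =>
    have hv : (dijkstraRound adj Q).val = Q := by simp [dijkstraRound, hx]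
    have hc : (dijkstraRound adj Q).cost = Q.findMin.cost := by simp [dijkstraRound, hx]
    rw [hv, hc]
    exact ⟨hQ, Or.inl ⟨rfl, hnone hx, hcost⟩⟩
  | some x =>
    obtain ⟨hxS, hxd, hxmin⟩ := hsome x hx
    obtain ⟨hval1, hdist1, hset1⟩ := Queue.settle_spec hQ.valid x
    set Q1 := (Q.settle x).val with hQ1
    have hv : (dijkstraRound adj Q).val = (forEach (adj.entry x) Q1 fun e Q => do
        let d ← step (Q1.dist.entry x + e.2)
        Q.relax e.1 d).val := by
      simp only [dijkstraRound, bind_val, hx, read_val]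
      rfl
    have hc : (dijkstraRound adj Q).cost = Q.findMin.cost + ((Q.settle x).cost + (1 + (1 +
        (forEach (adj.entry x) Q1 fun e Q => do
        let d ← step (Q1.dist.entry x + e.2)
        Q.relax e.1 d).cost))) := by
      simp only [dijkstraRound, bind_cost, hx, read_val, read_cost]
      rfl
    set dx := Q.dist.entry x with hdx
    have hset_cases : ∀ y, Q1.settled.entry y = true → y = x ∨ Q.settled.entry y = true := by
      intro y hy
      by_cases hyx : y = x
      · exact Or.inl hyx
      · rw [hset1, Function.update_of_ne hyx] at hy
        exact Or.inr hy
    have hsettled_le : ∀ y, Q1.settled.entry y = true → Q.dist.entry y ≤ dx := by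
      intro y hy
      rcases hset_cases y hy with rfl | hy
      · exact le_rfl
      · exact hQ.settled_le y x hy hxS
    have key := forEach_val_spec (l := adj.entry x) (init := Q1) (body := fun e Q => do
        let d ← step (Q1.dist.entry x + e.2)
        Q.relax e.1 d)
      (fun pre Q' => Q'.Valid ∧ Q'.settled = Q1.settled ∧
        (∀ y, Q'.dist.entry y ≤ Q.dist.entry y) ∧
        (∀ y, Q1.settled.entry y = true → Q'.dist.entry y = Q.dist.entry y) ∧
        (∀ y, Q1.settled.entry y = false → dx ≤ Q'.dist.entry y) ∧
        (∀ e ∈ pre, Q'.dist.entry e.1 ≤ dx + e.2) ∧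
        ∀ φ, IsPotential adj.entry v φ → ∀ y, φ y ≤ Q'.dist.entry y)
      ⟨hval1, rfl, fun y => by rw [hdist1], fun y _ => by rw [hdist1], fun y hy => by
          rw [hdist1]
          refine hxmin y ?_
          by_cases hyx : y = x
          · rw [hyx]; exact hxS
          · rwa [hset1, Function.update_of_ne hyx] at hy,
        by simp, fun φ hφ y => by rw [hdist1]; exact hQ.potential_le φ hφ y⟩ (by
      intro pre e post Q' hl ⟨h1, h2, h3, h4, h5, h6, h7⟩
      have hde : Q1.dist.entry x + e.2 = dx + e.2 := by rw [hdist1]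
      simp only [bind_val, step_val, hde]
      have hmem : e ∈ adj.entry x := by rw [hl]; simp
      obtain ⟨r1, r2, r3⟩ := Queue.relax_spec h1 e.1 (dx + e.2) (by
        intro h
        rw [h2] at h
        rw [h4 e.1 h]
        exact (hsettled_le e.1 h).trans le_self_add)
      have r3' : ∀ y, (Q'.relax e.1 (dx + e.2)).val.dist.entry y =
          if y = e.1 then min (Q'.dist.entry e.1) (dx + e.2) else Q'.dist.entry y := by
        intro y
        rw [r3, Function.update_apply]
      refine ⟨r1, r2.trans h2, ?_, ?_, ?_, ?_, ?_⟩
      · intro y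
        rw [r3']
        split_ifs with h
        · rw [h]; exact (min_le_left _ _).trans (h3 _)
        · exact h3 y
      · intro y hy
        rw [r3']
        split_ifs with h
        · subst h
          rw [h4 _ hy, min_eq_left ((hsettled_le e.1 hy).trans le_self_add)]
        · exact h4 y hy
      · intro y hy
        rw [r3']
        split_ifs with h
        · subst h
          exact le_min (h5 _ hy) le_self_add
        · exact h5 y hy
      · intro e' he'
        rw [r3']
        rcases List.mem_append.1 he' with he' | he'
        · split_ifs with h
          · rw [← h]; exact (min_le_left _ _).trans (h6 e' he')
          · exact h6 e' he'
        · rw [List.mem_singleton.1 he', if_pos rfl]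
          exact min_le_right _ _
      · intro φ hφ y
        rw [r3']
        split_ifs with h
        · rw [h]
          exact le_min (h7 φ hφ _) ((hφ.edge_le x e hmem).trans
            (add_le_add (hQ.potential_le φ hφ x) le_rfl))
        · exact h7 φ hφ y)
    rw [← hv] at key
    obtain ⟨k1, k2, k3, k4, k5, k6, k7⟩ := key
    have hxS1 : Q1.settled.entry x = true := by rw [hset1]; simp
    refine ⟨⟨k1, ?_, ?_, ?_, k7⟩, Or.inr ⟨x, by simp [Queue.settledSet, hxS], ?_, ?_⟩⟩
    · exact le_antisymm ((k3 v).trans hQ.source.le) zero_le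
    · intro y hy e he
      rw [k2] at hy
      rw [k4 y hy]
      rcases hset_cases y hy with rfl | hy'
      · exact k6 e he
      · exact (k3 e.1).trans (hQ.edge_le y hy' e he)
    · intro a y ha hy
      rw [k2] at ha hy
      rw [k4 a ha]
      exact (hsettled_le a ha).trans (k5 y hy)
    · ext y
      simp only [Queue.settledSet, Finset.mem_filter, Finset.mem_univ, true_and, Finset.mem_insert,
        k2]
      constructor
      · exact hset_cases y
      · rintro (rfl | h)
        · exact hxS1
        · by_cases hyx : y = x
          · rw [hyx]; exact hxS1
          · rw [hset1, Function.update_of_ne hyx]; exact h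
    · rw [hc]
      have h1 := Q.settle_cost_le x
      have h2 := forEach_cost_le (l := adj.entry x) (init := Q1) (body := fun e Q => do
        let d ← step (Q1.dist.entry x + e.2)
        Q.relax e.1 d) 8 (by
          intro e _ Q'
          have := Q'.relax_cost_le e.1 (Q1.dist.entry x + e.2)
          simp only [bind_cost, step_cost, step_val]
          omega)
      omega

theorem dijkstraInv_init {n : ℕ} (adj : Fin n → List (Fin n × ℝ≥0∞)) (v : Fin n) :
    DijkstraInv adj v ⟨⟨Function.update (fun _ => ⊤) v 0⟩, ⟨fun _ => false⟩,
      ⟨Function.update (fun _ => none) (block v) (some v)⟩⟩ := by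
  have hz : ∀ (k z : Fin n),
      Function.update (fun _ => none) (block v) (some v) k = some z → k = block v ∧ z = v := by
    intro k z h
    by_cases hk : k = block v
    · subst hk
      simp only [Function.update_self, Option.some.injEq] at h
      exact ⟨rfl, h.symm⟩
    · simp [hk] at h
  refine ⟨⟨?_, ?_, ?_, ?_, ?_⟩, ?_, ?_, ?_, ?_⟩
  · intro k hk x hx _
    have : x ≠ v := by
      rintro rfl
      simp [hx] at hk
    simp [this]
  · intro k z h
    obtain ⟨rfl, rfl⟩ := hz k z h
    rfl
  · intro k z h
    rfl
  · intro k z h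
    obtain ⟨rfl, rfl⟩ := hz k z h
    simp
  · intro k z h x _ _
    obtain ⟨rfl, rfl⟩ := hz k z h
    simp
  · simp
  · intro x hx
    simp at hx
  · intro x y hx
    simp at hx
  · intro φ hφ y
    by_cases hy : y = v
    · rw [hy, hφ.source]; exact zero_le
    · simp [hy]

/-- Dijkstra's algorithm computes the largest potential; each adjacency list is scanned at most
once. -/
theorem dijkstra_spec {n : ℕ} (adj : Arr (Fin n) (List (Fin n × ℝ≥0∞))) (v : Fin n) :
    IsPotential adj.entry v (dijkstra adj v).val.entry ∧
    (∀ φ, IsPotential adj.entry v φ → ∀ y, φ y ≤ (dijkstra adj v).val.entry y) ∧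
    (dijkstra adj v).cost ≤ 21 * (n * blockSize n) + 9 * ∑ x, (adj.entry x).length := by
  set Q0 : Queue n := ⟨⟨Function.update (fun _ => ⊤) v 0⟩, ⟨fun _ => false⟩,
      ⟨Function.update (fun _ => none) (block v) (some v)⟩⟩ with hQ0
  set loop := forEach (nodes n) Q0 fun _ Q => dijkstraRound adj Q with hloop
  have hv : (dijkstra adj v).val = loop.val.dist := rfl
  have hc : (dijkstra adj v).cost =
      Fintype.card (Fin n) + (1 + (Fintype.card (Fin n) + (Fintype.card (Fin n) + (1 +
        (loop.cost + 0))))) := rfl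
  -- Either every round so far has settled a new node, so that all nodes are settled after `n`
  -- rounds, or the reachable part is exhausted and later rounds are idle. The time for scanning
  -- lists is charged to the set of settled nodes.
  have key := forEach_spec (l := nodes n) (init := Q0) (body := fun _ Q => dijkstraRound adj Q)
    (fun pre Q k => DijkstraInv adj.entry v Q ∧
      (Q.settledSet.card = pre.length ∨
        ∀ x, Q.settled.entry x = false → Q.dist.entry x = ⊤) ∧
      k ≤ pre.length * (9 * blockSize n + 7) + 9 * ∑ x ∈ Q.settledSet, (adj.entry x).length)
    ⟨dijkstraInv_init _ v, Or.inl (by simp [Queue.settledSet, hQ0]), by simp⟩ (by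
      intro pre a post Q k hl ⟨h1, h2, h3⟩
      obtain ⟨h4, ⟨h5, h6, h7⟩ | ⟨x, h5, h6, h7⟩⟩ := dijkstraRound_spec h1
      · rw [h5] at h4 ⊢
        refine ⟨h4, Or.inr h6, ?_⟩
        simp only [List.length_append, List.length_singleton]
        nlinarith
      · refine ⟨h4, ?_, ?_⟩
        · rcases h2 with h2 | h2
          · left
            rw [h6, Finset.card_insert_of_notMem h5, h2]
            simp
          · right
            intro y hy
            have hy' : Q.settled.entry y = false := by
              have : y ∉ (dijkstraRound adj Q).val.settledSet := by
                simp [Queue.settledSet, hy]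
              rw [h6] at this
              simpa [Queue.settledSet] using fun h => this (Finset.mem_insert_of_mem h)
            have hx' : Q.settled.entry x = false := by simpa [Queue.settledSet] using h5
            -- When no unsettled estimate is finite, `findMin` returns nothing and this round cannot
            -- settle a node.
            exfalso
            have hxt := h2 x hx'
            obtain ⟨hnone, hsome⟩ := Queue.findMin_spec h1.valid
            cases hf : Q.findMin.val with
            | none =>
              have : (dijkstraRound adj Q).val = Q := by simp [dijkstraRound, hf]
              rw [this] at h6
              exact h5 (h6 ▸ Finset.mem_insert_self _ _)
            | some z => exact (hsome z hf).2.1 (h2 z (hsome z hf).1)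
        · rw [h6, Finset.sum_insert h5]
          simp only [List.length_append, List.length_singleton]
          nlinarith)
  rw [← hloop] at key
  obtain ⟨k1, k2, k3⟩ := key
  -- Nodes that are never settled have an infinite estimate, which makes the potential inequality
  -- trivial for their outgoing edges.
  have hend : ∀ x, loop.val.settled.entry x = false → loop.val.dist.entry x = ⊤ := by
    rcases k2 with k2 | k2
    · intro x hx
      exfalso
      rw [length_nodes] at k2
      have : loop.val.settledSet = Finset.univ := by
        rw [← Finset.card_eq_iff_eq_univ, k2, Fintype.card_fin]
      have hx' : x ∈ loop.val.settledSet := this ▸ Finset.mem_univ x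
      simp [Queue.settledSet, hx] at hx'
    · exact k2
  refine ⟨⟨?_, ?_⟩, ?_, ?_⟩
  · rw [hv]; exact k1.source
  · intro x e he
    rw [hv]
    cases hx : loop.val.settled.entry x with
    | true => exact k1.edge_le x hx e he
    | false => rw [hend x hx]; simp
  · intro φ hφ
    rw [hv]
    exact k1.potential_le φ hφ
  · rw [hc]
    have hsum : ∑ x ∈ loop.val.settledSet, (adj.entry x).length ≤ ∑ x, (adj.entry x).length :=
      Finset.sum_le_sum_of_subset (Finset.subset_univ _)
    simp only [length_nodes] at k3
    simp only [Fintype.card_fin]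
    have hn : 1 ≤ n := Fin.pos v
    have hB : 1 ≤ blockSize n := Nat.succ_pos _
    nlinarith [Nat.mul_le_mul hn hB, Nat.mul_le_mul (le_refl n) hB]

/-! ### Adjacency lists -/

/-- Remove the edges incident to the nodes of a set. -/
def restrict {n : ℕ} (N : Fin n → Fin n → ℝ≥0∞) (S : Fin n → Bool) (x y : Fin n) : ℝ≥0∞ :=
  if S x = true ∨ S y = true then ⊤ else N x y

theorem restrict_of_not {n : ℕ} {N : Fin n → Fin n → ℝ≥0∞} {S : Fin n → Bool} {x y : Fin n}
    (hx : S x = false) (hy : S y = false) : restrict N S x y = N x y := by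
  simp [restrict, hx, hy]

theorem le_restrict {n : ℕ} (N : Fin n → Fin n → ℝ≥0∞) (S : Fin n → Bool) (x y : Fin n) :
    N x y ≤ restrict N S x y := by
  rw [restrict]
  split_ifs
  · exact le_top
  · exact le_rfl

/-- The entries of a matrix as a function of two nodes. -/
def Arr.curried {n : ℕ} (W : WMatrix n) (x y : Fin n) : ℝ≥0∞ := W.entry (x, y)

/-- The edge `(x, y)` occurs in the adjacency lists with length `w`. -/
def AdjLists.Has {n : ℕ} (A : AdjLists n) (x y : Fin n) (w : ℝ≥0∞) : Prop :=
  (y, w) ∈ A.out.entry x ∧ (x, w) ∈ A.inc.entry y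

/-- The adjacency lists contain at most `m` edges, all of them with the lengths given by `N`. -/
structure AdjLists.Within {n : ℕ} (A : AdjLists n) (N : Fin n → Fin n → ℝ≥0∞) (m : ℕ) :
    Prop where
  out_eq : ∀ x, ∀ e ∈ A.out.entry x, N x e.1 = e.2
  inc_eq : ∀ y, ∀ e ∈ A.inc.entry y, N e.1 y = e.2
  out_card : ∑ x, (A.out.entry x).length ≤ m
  inc_card : ∑ x, (A.inc.entry x).length ≤ m

/-- All edges of `A` occur in `B`. -/
def AdjLists.Sub {n : ℕ} (A B : AdjLists n) : Prop := ∀ x y w, A.Has x y w → B.Has x y w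

theorem AdjLists.Sub.trans {n : ℕ} {A B C : AdjLists n} (h : A.Sub B) (h' : B.Sub C) : A.Sub C :=
  fun x y w hA => h' x y w (h x y w hA)

theorem AdjLists.Sub.refl {n : ℕ} (A : AdjLists n) : A.Sub A := fun _ _ _ h => h

/-- The edge `(x, y)` of `N` occurs in the adjacency lists, if it exists. -/
def AdjLists.HasEdge {n : ℕ} (A : AdjLists n) (N : Fin n → Fin n → ℝ≥0∞) (x y : Fin n) : Prop :=
  N x y ≠ ⊤ → A.Has x y (N x y)

theorem AdjLists.HasEdge.mono {n : ℕ} {A B : AdjLists n} {N : Fin n → Fin n → ℝ≥0∞} {x y : Fin n}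
    (h : A.HasEdge N x y) (hAB : A.Sub B) : B.HasEdge N x y := fun hN => hAB _ _ _ (h hN)

theorem sum_length_update_cons {n : ℕ} {β : Type} (f : Fin n → List β) (x : Fin n) (b : β) :
    ∑ y, (Function.update f x (b :: f x) y).length = (∑ y, (f y).length) + 1 := by
  have : ∀ y, (Function.update f x (b :: f x) y).length =
      (f y).length + if y = x then 1 else 0 := by
    intro y
    by_cases h : y = x
    · subst h; simp
    · simp [h]
  simp [this, Finset.sum_add_distrib]

/-- A missing edge and an edge with a deleted endpoint both have length ∞ in the restricted matrix,
so the threefold test of the program becomes a single one. -/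
theorem AdjLists.addEdge_eq {n : ℕ} (W : WMatrix n) (D : Arr (Fin n) Bool) (x y : Fin n)
    (A : AdjLists n) :
    A.addEdge W D x y = if restrict W.curried D.entry x y = ⊤ then ⟨A, 4⟩ else
      ⟨⟨⟨Function.update A.out.entry x ((y, restrict W.curried D.entry x y) :: A.out.entry x)⟩,
        ⟨Function.update A.inc.entry y ((x, restrict W.curried D.entry x y) ::
          A.inc.entry y)⟩⟩, 8⟩ := by
  have hstep : A.addEdge W D x y = ⟨(if (decide (W.entry (x, y) = ⊤) || D.entry x || D.entry y)
      = true then (⟨A, 0⟩ : Timed _) else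
      ⟨⟨⟨Function.update A.out.entry x ((y, W.entry (x, y)) :: A.out.entry x)⟩,
        ⟨Function.update A.inc.entry y ((x, W.entry (x, y)) :: A.inc.entry y)⟩⟩, 4⟩).val,
      1 + (1 + (1 + (1 + (if (decide (W.entry (x, y) = ⊤) || D.entry x || D.entry y)
      = true then (⟨A, 0⟩ : Timed _) else
      ⟨⟨⟨Function.update A.out.entry x ((y, W.entry (x, y)) :: A.out.entry x)⟩,
        ⟨Function.update A.inc.entry y ((x, W.entry (x, y)) :: A.inc.entry y)⟩⟩, 4⟩).cost)))⟩ :=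
    rfl
  rw [hstep]
  by_cases hD : D.entry x = true ∨ D.entry y = true
  · have h1 : restrict W.curried D.entry x y = ⊤ := by rw [restrict, if_pos hD]
    have h2 : (decide (W.entry (x, y) = ⊤) || D.entry x || D.entry y) = true := by
      rcases hD with h | h <;> simp [h]
    rw [if_pos h1, if_pos h2]
    rfl
  · have h1 : restrict W.curried D.entry x y = W.entry (x, y) := by rw [restrict, if_neg hD]; rfl
    rw [h1]
    by_cases hW : W.entry (x, y) = ⊤
    · have h2 : (decide (W.entry (x, y) = ⊤) || D.entry x || D.entry y) = true := by simp [hW]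
      rw [if_pos hW, if_pos h2]
      rfl
    · have h2 : ¬ (decide (W.entry (x, y) = ⊤) || D.entry x || D.entry y) = true := by
        simpa [hW] using hD
      rw [if_neg hW, if_neg h2]
      rfl

theorem AdjLists.addEdge_cost_le {n : ℕ} (W : WMatrix n) (D : Arr (Fin n) Bool) (x y : Fin n)
    (A : AdjLists n) : (A.addEdge W D x y).cost ≤ 8 := by
  rw [addEdge_eq]
  split_ifs <;> simp

/-- An edge may be inserted repeatedly; this is harmless, as only an upper bound for the number of
entries and the correctness of their lengths are kept. -/
theorem AdjLists.addEdge_spec {n : ℕ} (W : WMatrix n) (D : Arr (Fin n) Bool) (x y : Fin n)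
    (A : AdjLists n) {m : ℕ} (hA : A.Within (restrict W.curried D.entry) m) :
    (A.addEdge W D x y).val.Within (restrict W.curried D.entry) (m + 1) ∧
      A.Sub (A.addEdge W D x y).val ∧
      (A.addEdge W D x y).val.HasEdge (restrict W.curried D.entry) x y := by
  rw [addEdge_eq]
  split_ifs with h
  · exact ⟨⟨hA.out_eq, hA.inc_eq, hA.out_card.trans (by omega), hA.inc_card.trans (by omega)⟩,
      Sub.refl _, fun h' => absurd h h'⟩
  · refine ⟨⟨?_, ?_, ?_, ?_⟩, ?_, ?_⟩
    · intro a e he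
      by_cases hax : a = x
      · subst hax
        simp only [Function.update_self, List.mem_cons] at he
        rcases he with rfl | he
        · rfl
        · exact hA.out_eq _ e he
      · simp only [Function.update_of_ne hax] at he
        exact hA.out_eq _ e he
    · intro a e he
      by_cases hax : a = y
      · subst hax
        simp only [Function.update_self, List.mem_cons] at he
        rcases he with rfl | he
        · rfl
        · exact hA.inc_eq _ e he
      · simp only [Function.update_of_ne hax] at he
        exact hA.inc_eq _ e he
    · rw [sum_length_update_cons]; exact Nat.add_le_add_right hA.out_card 1
    · rw [sum_length_update_cons]; exact Nat.add_le_add_right hA.inc_card 1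
    · rintro a b w ⟨h1, h2⟩
      constructor
      · by_cases hax : a = x
        · subst hax; simp [h1]
        · simpa [hax] using h1
      · by_cases hax : b = y
        · subst hax; simp [h2]
        · simpa [hax] using h2
    · intro _
      simp [Has]

theorem AdjLists.empty_within {n : ℕ} (N : Fin n → Fin n → ℝ≥0∞) :
    (⟨⟨fun _ => []⟩, ⟨fun _ => []⟩⟩ : AdjLists n).Within N 0 :=
  ⟨by simp, by simp, by simp, by simp⟩

theorem AdjLists.Within.mono {n : ℕ} {A : AdjLists n} {N : Fin n → Fin n → ℝ≥0∞} {m m' : ℕ}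
    (h : A.Within N m) (hm : m ≤ m') : A.Within N m' :=
  ⟨h.out_eq, h.inc_eq, h.out_card.trans hm, h.inc_card.trans hm⟩

/-- The adjacency lists of the graph without the deleted nodes. -/
def allEdges {n : ℕ} (W : WMatrix n) (D : Arr (Fin n) Bool) (A : AdjLists n) :
    Timed (AdjLists n) :=
  forEach (nodes n) A fun x A => forEach (nodes n) A fun y A => A.addEdge W D x y

theorem allEdges_spec {n : ℕ} (W : WMatrix n) (D : Arr (Fin n) Bool) (A : AdjLists n)
    (hA : A.Within (restrict W.curried D.entry) 0) :
    (allEdges W D A).val.Within (restrict W.curried D.entry) (n * n) ∧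
      ∀ x y, (allEdges W D A).val.HasEdge (restrict W.curried D.entry) x y := by
  have key := forEach_val_spec (l := nodes n) (init := A)
    (body := fun x A => forEach (nodes n) A fun y A => A.addEdge W D x y)
    (fun pre A => A.Within (restrict W.curried D.entry) (pre.length * n) ∧
      ∀ x ∈ pre, ∀ y, A.HasEdge (restrict W.curried D.entry) x y) ⟨by simpa using hA, by simp⟩ (by
    intro pre x post A _ ⟨h1, h2⟩
    have inner := forEach_val_spec (l := nodes n) (init := A)
      (body := fun y A => A.addEdge W D x y)
      (fun pre' A' => A'.Within (restrict W.curried D.entry) (pre.length * n + pre'.length) ∧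
        A.Sub A' ∧ ∀ y ∈ pre', A'.HasEdge (restrict W.curried D.entry) x y)
      ⟨by simpa using h1, AdjLists.Sub.refl _, by simp⟩ (by
      intro pre' y post' A' _ ⟨h3, h4, h5⟩
      obtain ⟨h6, h7, h8⟩ := AdjLists.addEdge_spec W D x y A' h3
      refine ⟨by simpa [add_assoc] using h6, h4.trans h7, ?_⟩
      intro z hz
      rcases List.mem_append.1 hz with hz | hz
      · exact (h5 z hz).mono h7
      · rw [List.mem_singleton.1 hz]; exact h8)
    obtain ⟨h3, h4, h5⟩ := inner
    refine ⟨by simpa [add_mul] using h3, ?_⟩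
    intro z hz y
    rcases List.mem_append.1 hz with hz | hz
    · exact (h2 z hz y).mono h4
    · rw [List.mem_singleton.1 hz]; exact h5 y (mem_nodes y))
  rw [length_nodes] at key
  exact ⟨key.1, fun x y => key.2 x (mem_nodes x) y⟩

theorem allEdges_cost_le {n : ℕ} (W : WMatrix n) (D : Arr (Fin n) Bool) (A : AdjLists n) :
    (allEdges W D A).cost ≤ n * (n * 9 + 1) :=
  forEach_forEach_cost_le A (fun x y A => A.addEdge W D x y) 8
    fun x y A => A.addEdge_cost_le W D x y

/-! ### The sketch graph -/

/-- The edges that the sketch graph contains for a node `y`. -/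
structure SketchEdges {n : ℕ} (N : Fin n → Fin n → ℝ≥0∞) (U : Fin n → Bool)
    (pf pt : Fin n → List (Fin n)) (A : AdjLists n) (y : Fin n) : Prop where
  affected_out : U y = true → ∀ z, A.HasEdge N y z
  affected_inc : U y = true → ∀ z, A.HasEdge N z y
  pathFrom : U y = false → ∀ a x p, pf y = a :: x :: p → A.HasEdge N x y
  pathTo : U y = false → ∀ a x p, pt y = a :: x :: p → A.HasEdge N y x

theorem SketchEdges.mono {n : ℕ} {N : Fin n → Fin n → ℝ≥0∞} {U : Fin n → Bool}
    {pf pt : Fin n → List (Fin n)} {A B : AdjLists n} {y : Fin n}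
    (h : SketchEdges N U pf pt A y) (hAB : A.Sub B) : SketchEdges N U pf pt B y :=
  ⟨fun hU z => (h.affected_out hU z).mono hAB, fun hU z => (h.affected_inc hU z).mono hAB,
    fun hU a x p hp => (h.pathFrom hU a x p hp).mono hAB,
    fun hU a x p hp => (h.pathTo hU a x p hp).mono hAB⟩

/-- Add the second edge of a path, in one of the two directions. -/
def addFirstEdge {n : ℕ} (W : WMatrix n) (D : Arr (Fin n) Bool) (y : Fin n) (fwd : Bool)
    (p : List (Fin n)) (A : AdjLists n) : Timed (AdjLists n) :=
  match p with
  | _ :: x :: _ => if fwd then A.addEdge W D y x else A.addEdge W D x y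
  | _ => pure A

theorem addFirstEdge_spec {n : ℕ} (W : WMatrix n) (D : Arr (Fin n) Bool) (y : Fin n) (fwd : Bool)
    (p : List (Fin n)) (A : AdjLists n) {m : ℕ} (hA : A.Within (restrict W.curried D.entry) m) :
    (addFirstEdge W D y fwd p A).val.Within (restrict W.curried D.entry) (m + 1) ∧
      A.Sub (addFirstEdge W D y fwd p A).val ∧
      (∀ a x q, p = a :: x :: q → (addFirstEdge W D y fwd p A).val.HasEdge
        (restrict W.curried D.entry) (if fwd then y else x) (if fwd then x else y)) ∧
      (addFirstEdge W D y fwd p A).cost ≤ 8 := by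
  unfold addFirstEdge
  split
  · rename_i a x q
    cases fwd with
    | true =>
      obtain ⟨h1, h2, h3⟩ := AdjLists.addEdge_spec W D y x A hA
      refine ⟨h1, h2, ?_, A.addEdge_cost_le W D y x⟩
      rintro a' x' q' h
      obtain ⟨-, h, -⟩ := by simpa using h
      simpa [← h] using h3
    | false =>
      obtain ⟨h1, h2, h3⟩ := AdjLists.addEdge_spec W D x y A hA
      refine ⟨h1, h2, ?_, A.addEdge_cost_le W D x y⟩
      rintro a' x' q' h
      obtain ⟨-, h, -⟩ := by simpa using h
      simpa [← h] using h3
  · rename_i hp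
    exact ⟨hA.mono (Nat.le_succ m), AdjLists.Sub.refl _,
      fun a x q h => absurd h (hp a x q), by simp⟩

/-- The part of the construction of the sketch graph for one node. -/
def sketchNode {n : ℕ} (W : WMatrix n) (L : Layer n) (D : Arr (Fin n) Bool) (v : Fin n)
    (U : Arr (Fin n) Bool) (y : Fin n) (H : AdjLists n) : Timed (AdjLists n) := do
  let a ← U.read y
  if a then
    forEach (nodes n) H fun z H => do
      let H ← H.addEdge W D y z
      H.addEdge W D z y
  else do
    let p ← L.pathFrom.read (v, y)
    let H ← addFirstEdge W D y false p H
    let p ← L.pathTo.read (v, y)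
    addFirstEdge W D y true p H

/-- Stored paths start at `y` in both directions, so the second entry is the predecessor of `y` on a
path from `v` and its successor on a path to `v`. This lets one auxiliary program serve both cases.
-/
theorem sketchGraph_eq {n : ℕ} (W : WMatrix n) (L : Layer n) (D : Arr (Fin n) Bool) (v : Fin n)
    (U : Arr (Fin n) Bool) :
    sketchGraph W L D v U = (do
      let H ← newAdjLists n
      forEach (nodes n) H (sketchNode W L D v U)) := by
  unfold sketchGraph
  congr 1
  funext H
  congr 1
  funext y H
  unfold sketchNode
  congr 1
  funext a
  cases a with
  | true => rfl
  | false =>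
    simp only [Bool.false_eq_true, if_false]
    congr 1
    funext p
    unfold addFirstEdge
    have hread : L.pathTo.read (v, y) = ⟨L.pathTo.entry (v, y), 1⟩ := rfl
    rw [hread]
    generalize L.pathTo.entry (v, y) = q
    rcases p with _ | ⟨a, _ | ⟨b, p⟩⟩ <;> rcases q with _ | ⟨c, _ | ⟨d, q⟩⟩ <;> rfl

theorem sketchNode_spec {n : ℕ} (W : WMatrix n) (L : Layer n) (D : Arr (Fin n) Bool) (v : Fin n)
    (U : Arr (Fin n) Bool) (y : Fin n) (H : AdjLists n) {m : ℕ}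
    (hH : H.Within (restrict W.curried D.entry) m) :
    (sketchNode W L D v U y H).val.Within (restrict W.curried D.entry)
        (m + if U.entry y then 2 * n else 2) ∧
      H.Sub (sketchNode W L D v U y H).val ∧
      SketchEdges (restrict W.curried D.entry) U.entry (fun x => L.pathFrom.entry (v, x))
        (fun x => L.pathTo.entry (v, x)) (sketchNode W L D v U y H).val y ∧
      (sketchNode W L D v U y H).cost ≤ 19 + if U.entry y then 17 * n else 0 := by
  cases hU : U.entry y with
  | true =>
    have hv : sketchNode W L D v U y H = ⟨(forEach (nodes n) H fun z H => do
      let H ← H.addEdge W D y z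
      H.addEdge W D z y).val, 1 + (forEach (nodes n) H fun z H => do
      let H ← H.addEdge W D y z
      H.addEdge W D z y).cost⟩ := by
      show (⟨(if U.entry y then _ else _ : Timed _).val,
        1 + (if U.entry y then _ else _ : Timed _).cost⟩ : Timed _) = _
      rw [if_pos hU]
    rw [hv]
    have inner := forEach_val_spec (l := nodes n) (init := H)
      (body := fun z H => do
        let H ← H.addEdge W D y z
        H.addEdge W D z y)
      (fun pre H' => H'.Within (restrict W.curried D.entry) (m + 2 * pre.length) ∧ H.Sub H' ∧
        ∀ z ∈ pre, H'.HasEdge (restrict W.curried D.entry) y z ∧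
          H'.HasEdge (restrict W.curried D.entry) z y)
      ⟨by simpa using hH, AdjLists.Sub.refl _, by simp⟩ (by
        intro pre z post H' _ ⟨h1, h2, h3⟩
        obtain ⟨h4, h5, h6⟩ := AdjLists.addEdge_spec W D y z H' h1
        obtain ⟨h7, h8, h9⟩ := AdjLists.addEdge_spec W D z y _ h4
        refine ⟨?_, (h2.trans h5).trans h8, ?_⟩
        · simp only [List.length_append, List.length_singleton, bind_val]
          exact h7.mono (by omega)
        · intro z' hz'
          rcases List.mem_append.1 hz' with hz' | hz'
          · exact ⟨(h3 z' hz').1.mono (h5.trans h8), (h3 z' hz').2.mono (h5.trans h8)⟩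
          · rw [List.mem_singleton.1 hz']
            exact ⟨h6.mono h8, h9⟩)
    obtain ⟨h1, h2, h3⟩ := inner
    refine ⟨by simpa using h1, h2, ⟨fun _ z => (h3 z (mem_nodes z)).1,
      fun _ z => (h3 z (mem_nodes z)).2, by simp [hU], by simp [hU]⟩, ?_⟩
    have := forEach_cost_le (l := nodes n) (init := H)
      (body := fun z H => do
        let H ← H.addEdge W D y z
        H.addEdge W D z y) 16 (by
        intro z _ H
        have h1 := H.addEdge_cost_le W D y z
        have h2 := (H.addEdge W D y z).val.addEdge_cost_le W D z y
        simp only [bind_cost]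
        omega)
    simp only [length_nodes] at this
    simp only [if_true]
    omega
  | false =>
    have hv : sketchNode W L D v U y H = ⟨(addFirstEdge W D y true (L.pathTo.entry (v, y))
        (addFirstEdge W D y false (L.pathFrom.entry (v, y)) H).val).val,
        1 + (1 + ((addFirstEdge W D y false (L.pathFrom.entry (v, y)) H).cost + (1 +
        (addFirstEdge W D y true (L.pathTo.entry (v, y))
        (addFirstEdge W D y false (L.pathFrom.entry (v, y)) H).val).cost)))⟩ := by
      show (⟨(if U.entry y then _ else _ : Timed _).val,
        1 + (if U.entry y then _ else _ : Timed _).cost⟩ : Timed _) = _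
      rw [if_neg (by simp [hU])]
      rfl
    rw [hv]
    obtain ⟨h1, h2, h3, h4⟩ := addFirstEdge_spec W D y false (L.pathFrom.entry (v, y)) H hH
    obtain ⟨h5, h6, h7, h8⟩ := addFirstEdge_spec W D y true (L.pathTo.entry (v, y)) _ h1
    refine ⟨by simpa [add_assoc] using h5, h2.trans h6, ⟨by simp [hU], by simp [hU], ?_, ?_⟩, ?_⟩
    · intro _ a x p hp
      simpa using (h3 a x p hp).mono h6
    · intro _ a x p hp
      simpa using h7 a x p hp
    · simp only [Bool.false_eq_true, if_false]
      omega

/-- Only affected nodes contribute a linear number of edges, at most 2n, against at most 2 for any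
other node. The size and the construction time are thus O(n + n·|U|) instead of n². -/
theorem sketchGraph_spec {n : ℕ} (W : WMatrix n) (L : Layer n) (D : Arr (Fin n) Bool) (v : Fin n)
    (U : Arr (Fin n) Bool) :
    (sketchGraph W L D v U).val.Within (restrict W.curried D.entry)
        (∑ y, if U.entry y then 2 * n else 2) ∧
      (∀ y, SketchEdges (restrict W.curried D.entry) U.entry (fun x => L.pathFrom.entry (v, x))
        (fun x => L.pathTo.entry (v, x)) (sketchGraph W L D v U).val y) ∧
      (sketchGraph W L D v U).cost ≤ 2 * n + ∑ y, (20 + if U.entry y then 17 * n else 0) := by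
  rw [sketchGraph_eq]
  have key := forEach_spec (l := nodes n) (init := (⟨⟨fun _ => []⟩, ⟨fun _ => []⟩⟩ : AdjLists n))
    (body := sketchNode W L D v U)
    (fun pre H k => H.Within (restrict W.curried D.entry)
        (pre.map fun y => if U.entry y then 2 * n else 2).sum ∧
      (∀ y ∈ pre, SketchEdges (restrict W.curried D.entry) U.entry
        (fun x => L.pathFrom.entry (v, x)) (fun x => L.pathTo.entry (v, x)) H y) ∧
      k ≤ (pre.map fun y => 20 + if U.entry y then 17 * n else 0).sum)
    ⟨AdjLists.empty_within _, by simp, by simp⟩ (by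
      intro pre y post H k _ ⟨h1, h2, h3⟩
      obtain ⟨h4, h5, h6, h7⟩ := sketchNode_spec W L D v U y H h1
      refine ⟨by simpa using h4, ?_, ?_⟩
      · intro z hz
        rcases List.mem_append.1 hz with hz | hz
        · exact (h2 z hz).mono h5
        · rw [List.mem_singleton.1 hz]; exact h6
      · simp only [List.map_append, List.map_cons, List.map_nil, List.sum_append, List.sum_cons,
          List.sum_nil]
        omega)
  rw [sum_map_nodes, sum_map_nodes] at key
  obtain ⟨h1, h2, h3⟩ := key
  refine ⟨h1, fun y => h2 y (mem_nodes y), ?_⟩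
  have hc : (do
      let H ← newAdjLists n
      forEach (nodes n) H (sketchNode W L D v U)).cost = Fintype.card (Fin n) +
      (Fintype.card (Fin n) + 0) + (forEach (nodes n)
        (⟨⟨fun _ => []⟩, ⟨fun _ => []⟩⟩ : AdjLists n) (sketchNode W L D v U)).cost := rfl
  rw [hc, Fintype.card_fin]
  omega

/-! ### Distances in the sketch graph -/

/-- In the sketch graph, the distances to `v` are at most the lengths of the paths with at most `h`
edges that avoid the deleted nodes. -/
theorem sketch_le {n : ℕ} {N : Fin n → Fin n → ℝ≥0∞} {v : Fin n} {h : ℕ} {lab : Fin n → Label n}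
    (H : BestLabels N v h lab) {D U : Fin n → Bool}
    (hU : ∀ x, U x = false → ∀ u ∈ (lab x).path, D u = false) {r : Fin n → ℝ≥0∞} (hv : r v = 0)
    (haff : ∀ x y, U x = true → D x = false → D y = false → r x ≤ N x y + r y)
    (hun : ∀ x, U x = false → ∀ a z p, (lab x).path = a :: z :: p → D x = false → D z = false →
      r x ≤ N x z + r z)
    (q : List (Fin n)) (x : Fin n) (hq : FromTo q x v) (hl : q.length ≤ h + 1)
    (hD : ∀ u ∈ q, D u = false) : r x ≤ listLen N q := by
  -- Minimal counterexample over all start nodes, ordered by length first and number of nodes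
  -- second. Length alone would not do, since edges may have weight zero. Minimality is available
  -- because only finitely many lists have at most `h + 1` nodes.
  set bad : Set (List (Fin n)) := {q | q.length ≤ h + 1 ∧ (∀ u ∈ q, D u = false) ∧
    ∃ x, FromTo q x v ∧ listLen N q < r x} with hbad
  by_contra hcon
  have hne : bad.Nonempty := ⟨q, hl, hD, x, hq, not_le.1 hcon⟩
  have hfin : bad.Finite := (List.finite_length_le (Fin n) (h + 1)).subset fun q hq => hq.1
  obtain ⟨q, ⟨hl, hD, x, hq, hlt⟩, hmin⟩ := hfin.exists_minimalFor
    (fun q => toLex (listLen N q, q.length)) bad hne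
  have hsmall : ∀ q' y, q'.length ≤ h + 1 → (∀ u ∈ q', D u = false) → FromTo q' y v →
      toLex (listLen N q', q'.length) < toLex (listLen N q, q.length) → r y ≤ listLen N q' := by
    intro q' y h1 h2 h3 h4
    by_contra h5
    exact absurd (hmin ⟨h1, h2, y, h3, not_le.1 h5⟩ h4.le) (not_le.2 h4)
  cases hUx : U x with
  -- Affected start: the first edge of `q` belongs to the sketch graph, and the remaining path is no
  -- longer and has one node less.
  | true =>
    obtain ⟨q', rfl⟩ := hq.eq_cons
    cases q' with
    | nil =>
      obtain ⟨-, rfl⟩ := fromTo_singleton.1 hq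
      simp [hv] at hlt
    | cons y q' =>
      obtain ⟨-, hq'⟩ := fromTo_cons_cons.1 hq
      have hy := hsmall (y :: q') y (by simp at hl ⊢; omega)
        (fun u hu => hD u (List.mem_cons_of_mem _ hu)) hq' (by
          rw [Prod.Lex.toLex_lt_toLex']
          refine ⟨?_, fun _ => by simp⟩
          rw [listLen]
          exact le_add_self)
      refine absurd hlt (not_lt.2 ((haff x y hUx (hD x (by simp)) (hD y (by simp))).trans ?_))
      rw [listLen]
      exact add_le_add le_rfl hy
  -- Unaffected start: `q` is exchanged for the stored path, which avoids the deleted nodes. Its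
  -- first edge belongs to the sketch graph, and its tail has to be smaller than `q`.
  | false =>
    have hd := H.dist_le x q hq hl
    have hne : (lab x).dist ≠ ⊤ := ne_top_of_le_ne_top hlt.ne_top hd
    have hp := H.fromTo x hne
    have hpD := hU x hUx
    have hpl := H.length_path x
    have hplen := (H.listLen_path x).trans hd
    obtain ⟨p', hp'⟩ := hp.eq_cons
    cases p' with
    | nil =>
      rw [hp'] at hp
      obtain ⟨-, rfl⟩ := fromTo_singleton.1 hp
      simp [hv] at hlt
    | cons y p' =>
      have hmin' := H.length_le x q hq hl
      have hlistp := H.listLen_path x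
      have hun' := hun x hUx x y p' hp'
      rw [hp'] at hp hpD hpl hplen hmin' hlistp
      obtain ⟨-, hq'⟩ := fromTo_cons_cons.1 hp
      have hsuf : listLen N (y :: p') ≤ listLen N (x :: y :: p') := by
        rw [listLen]
        exact le_add_self
      have hy := hsmall (y :: p') y (by simp at hpl ⊢; omega)
        (fun u hu => hpD u (List.mem_cons_of_mem _ hu)) hq' (by
          rw [Prod.Lex.toLex_lt_toLex']
          refine ⟨hsuf.trans hplen, fun heq => ?_⟩
          have heq' : listLen N (y :: p') = listLen N q := heq
          -- In a tie `q` is at most as long as the label, so the label has no more nodes than `q`,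
          -- and its tail has strictly fewer.
          have := hmin' (heq' ▸ hsuf.trans hlistp)
          simpa using this)
      refine absurd hlt (not_lt.2 ((hun' (hpD x (by simp)) (hpD y (by simp))).trans ?_))
      refine le_trans ?_ hplen
      rw [listLen]
      exact add_le_add le_rfl hy

/-! ### Consequences of the data stored for one visited node -/

/-- What is stored for a visited node `v`, where `S` is the set of the nodes visited before. -/
def VisitData {n : ℕ} (N : Fin n → Fin n → ℝ≥0∞) (h : ℕ) (S : Fin n → Bool) (v : Fin n)
    (pf pt : Fin n → List (Fin n)) (thr : Fin n → Fin n → ℝ≥0∞) : Prop :=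
  S v = false ∧ ∃ labFrom labTo : Fin n → Label n,
    BestLabels (fun x y => restrict N S y x) v h labFrom ∧
    BestLabels (restrict N S) v h labTo ∧ (∀ x, pf x = (labFrom x).path) ∧
    (∀ x, pt x = (labTo x).path) ∧ ∀ s t, thr s t = (labTo s).dist + (labFrom t).dist

/-- The nodes that have a stored path with a deleted node. -/
def IsAffected {n : ℕ} (D : Fin n → Bool) (pf pt : Fin n → List (Fin n)) (U : Fin n → Bool) :
    Prop :=
  ∀ x, U x = true ↔ (∃ u ∈ pt x, D u = true) ∨ ∃ u ∈ pf x, D u = true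

section VisitData

variable {n : ℕ} {N : Fin n → Fin n → ℝ≥0∞} {h : ℕ} {S D U : Fin n → Bool} {v : Fin n}
  {pf pt : Fin n → List (Fin n)} {thr : Fin n → Fin n → ℝ≥0∞} {A : AdjLists n} {m : ℕ}

theorem IsAffected.pt_eq_false (hU : IsAffected D pf pt U) {x : Fin n} (hx : U x = false) :
    ∀ u ∈ pt x, D u = false := by
  intro u hu
  by_contra h
  simp [(hU x).2 (Or.inl ⟨u, hu, by simpa using h⟩)] at hx

theorem IsAffected.pf_eq_false (hU : IsAffected D pf pt U) {x : Fin n} (hx : U x = false) :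
    ∀ u ∈ pf x, D u = false := by
  intro u hu
  by_contra h
  simp [(hU x).2 (Or.inr ⟨u, hu, by simpa using h⟩)] at hx

theorem listLen_restrict_eq (p : List (Fin n)) (hp : ∀ u ∈ p, S u = false) :
    listLen (restrict N S) p = listLen N p :=
  listLen_congr p fun x hx y hy => restrict_of_not (hp x hx) (hp y hy)

/-- The lists need not contain all edges: fewer edges mean fewer constraints. Hence the distances of
the full graph G∖D bound from below what Dijkstra computes in any sketch graph. -/
theorem isPotential_mdist_out (hA : A.Within N m) (v : Fin n) :
    IsPotential A.out.entry v (mdist N v) := by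
  refine ⟨mdist_self N v, fun x e he => ?_⟩
  rw [← hA.out_eq x e he]
  exact (mdist_triangle N v x e.1).trans (add_le_add le_rfl (mdist_le_edge N x e.1))

theorem isPotential_mdist_inc (hA : A.Within N m) (v : Fin n) :
    IsPotential A.inc.entry v (fun x => mdist N x v) := by
  refine ⟨mdist_self N v, fun x e he => ?_⟩
  rw [← hA.inc_eq x e he, add_comm]
  exact (mdist_triangle N e.1 x v).trans (add_le_add (mdist_le_edge N e.1 x) le_rfl)

theorem IsPotential.out_le {r : Fin n → ℝ≥0∞} (hr : IsPotential A.out.entry v r) {x y : Fin n}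
    (h : A.HasEdge N x y) : r y ≤ r x + N x y := by
  by_cases hN : N x y = ⊤
  · simp [hN]
  · exact hr.edge_le x _ (h hN).1

theorem IsPotential.inc_le {r : Fin n → ℝ≥0∞} (hr : IsPotential A.inc.entry v r) {x y : Fin n}
    (h : A.HasEdge N x y) : r x ≤ N x y + r y := by
  by_cases hN : N x y = ⊤
  · simp [hN]
  · rw [add_comm]; exact hr.edge_le y _ (h hN).2

/-- The sketch graph lives in the graph without `D`, the stored paths in the graph without the
previously visited nodes `S`. For an edge between undeleted nodes the length without `D` is the
original one, which never exceeds the length without `S`. -/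
theorem restrict_comm_le {x y : Fin n} {a b : ℝ≥0∞} (hx : D x = false) (hy : D y = false)
    (h : a ≤ restrict N D x y + b) : a ≤ restrict N S x y + b := by
  rw [restrict_of_not hx hy] at h
  exact h.trans (add_le_add (le_restrict N S x y) le_rfl)

/-- Distances through `v` in the sketch graph are small. -/
theorem VisitData.sketch_le (hV : VisitData N h S v pf pt thr) (hU : IsAffected D pf pt U)
    (hA : ∀ y, SketchEdges (restrict N D) U pf pt A y) {rf rt : Fin n → ℝ≥0∞}
    (hrf : IsPotential A.out.entry v rf) (hrt : IsPotential A.inc.entry v rt)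
    {p q : List (Fin n)} {s t : Fin n} (hp : FromTo (p ++ v :: q) s t)
    (hl : (p ++ v :: q).length ≤ h + 1) (hS : ∀ u ∈ p ++ v :: q, S u = false)
    (hD : ∀ u ∈ p ++ v :: q, D u = false) : rt s + rf t ≤ listLen N (p ++ v :: q) := by
  obtain ⟨-, labF, labT, hF, hT, hpf, hpt, -⟩ := hV
  obtain ⟨h1, h2⟩ := hp.split
  have hpart1 : ∀ u ∈ p ++ [v], u ∈ p ++ v :: q := by
    intro u hu; simp at hu ⊢; tauto
  have hpart2 : ∀ u ∈ v :: q, u ∈ p ++ v :: q := fun u hu => List.mem_append_right _ hu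
  have hl1 : (p ++ [v]).length ≤ h + 1 := by simp at hl ⊢; omega
  have hl2 : (v :: q).length ≤ h + 1 := by simp at hl ⊢; omega
  rw [listLen_append]
  refine add_le_add ?_ ?_
  · rw [← listLen_restrict_eq (S := S) (p ++ [v]) fun u hu => hS u (hpart1 u hu)]
    refine BatchDeletion.sketch_le hT (U := U) (D := D)
      (fun x hx => hpt x ▸ hU.pt_eq_false hx) hrt.source ?_ ?_ _ s h1 hl1
      fun u hu => hD u (hpart1 u hu)
    · intro x y hx hDx hDy
      exact restrict_comm_le hDx hDy (hrt.inc_le ((hA x).affected_out hx y))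
    · intro x hx a z p' hp' hDx hDz
      exact restrict_comm_le hDx hDz (hrt.inc_le ((hA x).pathTo hx a z p' (hpt x ▸ hp')))
  · rw [← listLen_restrict_eq (S := S) (v :: q) fun u hu => hS u (hpart2 u hu),
      ← List.reverse_reverse (v :: q), listLen_reverse]
    refine BatchDeletion.sketch_le hF (U := U) (D := D)
      (fun x hx => hpf x ▸ hU.pf_eq_false hx) hrf.source ?_ ?_ _ t h2.reverse (by simpa using hl2)
      fun u hu => hD u (hpart2 u (List.mem_reverse.1 hu))
    · intro x y hx hDx hDy
      have := hrf.out_le ((hA x).affected_inc hx y)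
      rw [add_comm] at this
      exact restrict_comm_le hDy hDx this
    · intro x hx a z p' hp' hDx hDz
      have := hrf.out_le ((hA x).pathFrom hx a z p' (hpf x ▸ hp'))
      rw [add_comm] at this
      exact restrict_comm_le hDz hDx this

/-- A path through `v` that avoids the previously visited nodes survives in the graph in which
Bellman-Ford ran. Its two halves have at most `h` edges each, so they compete with the labels. -/
theorem VisitData.through_le (hV : VisitData N h S v pf pt thr)
    {p q : List (Fin n)} {s t : Fin n} (hp : FromTo (p ++ v :: q) s t)
    (hl : (p ++ v :: q).length ≤ h + 1) (hS : ∀ u ∈ p ++ v :: q, S u = false) :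
    thr s t ≤ listLen N (p ++ v :: q) := by
  obtain ⟨-, labF, labT, hF, hT, -, -, hthr⟩ := hV
  obtain ⟨h1, h2⟩ := hp.split
  have hpart1 : ∀ u ∈ p ++ [v], u ∈ p ++ v :: q := by
    intro u hu; simp at hu ⊢; tauto
  have hl1 : (p ++ [v]).length ≤ h + 1 := by simp at hl ⊢; omega
  have hl2 : (v :: q).length ≤ h + 1 := by simp at hl ⊢; omega
  rw [listLen_append, hthr]
  refine add_le_add ?_ ?_
  · rw [← listLen_restrict_eq (S := S) (p ++ [v]) fun u hu => hS u (hpart1 u hu)]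
    exact hT.dist_le s _ h1 hl1
  · rw [← listLen_restrict_eq (S := S) (v :: q) fun u hu => hS u (List.mem_append_right _ hu),
      ← List.reverse_reverse (v :: q), listLen_reverse]
    exact hF.dist_le t _ h2.reverse (by simpa using hl2)

/-- For unaffected endpoints both stored paths avoid `D`, so the old value is the length of an
actual walk in G∖D, or infinite. -/
theorem VisitData.mdist_le_through (hV : VisitData N h S v pf pt thr) (hU : IsAffected D pf pt U)
    {s t : Fin n} (hs : U s = false) (ht : U t = false) :
    mdist (restrict N D) s t ≤ thr s t := by
  obtain ⟨-, labF, labT, hF, hT, hpf, hpt, hthr⟩ := hV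
  rw [hthr]
  refine (mdist_triangle _ s v t).trans (add_le_add ?_ ?_)
  · by_cases hd : (labT s).dist = ⊤
    · rw [hd]; exact le_top
    · refine (mdist_le (hT.fromTo s hd)).trans (le_trans ?_ (hT.listLen_path s))
      rw [listLen_restrict_eq _ (hpt s ▸ hU.pt_eq_false hs)]
      exact listLen_mono _ (le_restrict N S)
  · by_cases hd : (labF t).dist = ⊤
    · rw [hd]; exact le_top
    · refine (mdist_le (hF.fromTo t hd).reverse).trans (le_trans ?_ (hF.listLen_path t))
      rw [listLen_restrict_eq _ fun u hu => hU.pf_eq_false ht u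
        (hpf t ▸ List.mem_reverse.1 hu), listLen_reverse]
      exact listLen_mono _ fun x y => le_restrict N S y x

theorem VisitData.length_pf (hV : VisitData N h S v pf pt thr) (x : Fin n) :
    (pf x).length ≤ h + 1 := by
  obtain ⟨-, labF, labT, hF, hT, hpf, hpt, hthr⟩ := hV
  exact hpf x ▸ hF.length_path x

theorem VisitData.length_pt (hV : VisitData N h S v pf pt thr) (x : Fin n) :
    (pt x).length ≤ h + 1 := by
  obtain ⟨-, labF, labT, hF, hT, hpf, hpt, hthr⟩ := hV
  exact hpt x ▸ hT.length_path x

/-- Nodes of `S` are isolated in the restricted graph, so they could occur only as a path with a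
single node, and that node would be `v`. This is why the counters of visited nodes may stay fixed:
later paths do not contain them. -/
theorem notMem_of_restrict {p : List (Fin n)} {x : Fin n} (hp : FromTo p x v)
    (hv : S v = false) (hlen : listLen (restrict N S) p ≠ ⊤) {u : Fin n} (hu : S u = true) :
    u ∉ p := by
  refine notMem_of_listLen_ne_top p hlen u (fun x => by simp [restrict, hu])
    (fun x => by simp [restrict, hu]) ?_
  rintro rfl
  obtain ⟨-, rfl⟩ := fromTo_singleton.1 hp
  simp [hv] at hu

theorem VisitData.notMem_pt (hV : VisitData N h S v pf pt thr) {u : Fin n} (hu : S u = true)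
    (x : Fin n) : u ∉ pt x := by
  obtain ⟨hv, labF, labT, hF, hT, hpf, hpt, hthr⟩ := hV
  rw [hpt]
  by_cases hd : (labT x).dist = ⊤
  · simp [hT.path_nil x hd]
  · exact notMem_of_restrict (hT.fromTo x hd) hv
      (ne_top_of_le_ne_top hd (hT.listLen_path x)) hu

theorem VisitData.notMem_pf (hV : VisitData N h S v pf pt thr) {u : Fin n} (hu : S u = true)
    (x : Fin n) : u ∉ pf x := by
  obtain ⟨hv, labF, labT, hF, hT, hpf, hpt, hthr⟩ := hV
  rw [hpf]
  by_cases hd : (labF x).dist = ⊤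
  · simp [hF.path_nil x hd]
  · have h1 : (fun x y => restrict N S y x) = restrict (fun x y => N y x) S := by
      funext x y
      simp only [restrict, or_comm]
    have h2 := ne_top_of_le_ne_top hd (hF.listLen_path x)
    rw [h1] at h2
    exact notMem_of_restrict (hF.fromTo x hd) hv h2 hu

end VisitData

/-! ### Affected nodes -/

theorem hits_val {n : ℕ} (D : Arr (Fin n) Bool) (p : List (Fin n)) :
    (hits D p).val = true ↔ ∃ u ∈ p, D.entry u = true := by
  refine forEach_val_spec (l := p) (init := false) (body := fun u b => do
    let d ← D.read u
    step (b || d)) (fun pre b => b = true ↔ ∃ u ∈ pre, D.entry u = true) (by simp) ?_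
  intro pre u post b _ hb
  simp only [bind_val, read_val, step_val, Bool.or_eq_true, hb]
  simp [or_and_right, exists_or]

theorem hits_cost_le {n : ℕ} (D : Arr (Fin n) Bool) (p : List (Fin n)) :
    (hits D p).cost ≤ p.length * 3 :=
  forEach_cost_le (l := p) (init := false) (body := fun u b => do
    let d ← D.read u
    step (b || d)) 2 (by simp)

theorem affectedNodes_spec {n : ℕ} (L : Layer n) (D : Arr (Fin n) Bool) (v : Fin n) :
    IsAffected D.entry (fun x => L.pathFrom.entry (v, x)) (fun x => L.pathTo.entry (v, x))
      (affectedNodes L D v).val.entry := by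
  intro x
  rw [affectedNodes, tabulate_val]
  simp [hits_val]

theorem affectedNodes_cost_le {n : ℕ} (L : Layer n) (D : Arr (Fin n) Bool) (v : Fin n) (h : ℕ)
    (hpf : ∀ x, (L.pathFrom.entry (v, x)).length ≤ h + 1)
    (hpt : ∀ x, (L.pathTo.entry (v, x)).length ≤ h + 1) :
    (affectedNodes L D v).cost ≤ 12 * (n * (h + 1)) := by
  have h1 := tabulate_cost_le false (fun x => do
    let p ← L.pathTo.read (v, x)
    let a ← hits D p
    let p ← L.pathFrom.read (v, x)
    let b ← hits D p
    step (a || b))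
  refine h1.trans ?_
  have h2 : ∀ x ∈ (Finset.univ : Finset (Fin n)), ((do
    let p ← L.pathTo.read (v, x)
    let a ← hits D p
    let p ← L.pathFrom.read (v, x)
    let b ← hits D p
    step (a || b) : Timed Bool).cost + 2) ≤ 6 * (h + 1) + 5 := by
    intro x _
    simp only [bind_cost, read_cost, read_val, step_cost]
    have := hits_cost_le D (L.pathTo.entry (v, x))
    have := hits_cost_le D (L.pathFrom.entry (v, x))
    have := hpf x
    have := hpt x
    omega
  have h3 := Finset.sum_le_sum h2
  simp only [Finset.sum_const, Finset.card_univ, Fintype.card_fin, smul_eq_mul] at h3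
  nlinarith

/-! ### Congestion counters -/

/-- The marks pay for the counters: a node can acquire the mark `x` only together with an increment,
and every unvisited node of `p` ends up marked. The sum of the counters grows by at most the number
of nodes of `p`. -/
theorem countPath_spec {n : ℕ} (isVisited : Arr (Fin n) Bool) (x : Fin n) (p : List (Fin n))
    (c : Arr (Fin n) ℕ × Arr (Fin n) (Option (Fin n))) :
    (∀ u, isVisited.entry u = true →
      (countPath isVisited x p c).val.1.entry u = c.1.entry u) ∧
    (∀ u, c.1.entry u ≤ (countPath isVisited x p c).val.1.entry u) ∧
    (∑ u, (countPath isVisited x p c).val.1.entry u ≤ ∑ u, c.1.entry u + p.length) ∧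
    (∀ u, (countPath isVisited x p c).val.2.entry u = c.2.entry u ∨
      (countPath isVisited x p c).val.2.entry u = some x) ∧
    (∀ u ∈ p, isVisited.entry u = false →
      (countPath isVisited x p c).val.2.entry u = some x) ∧
    (∀ u, (countPath isVisited x p c).val.2.entry u = some x → c.2.entry u = some x ∨
      c.1.entry u + 1 ≤ (countPath isVisited x p c).val.1.entry u) := by
  refine forEach_val_spec (l := p) (init := c) (fun pre c' =>
    (∀ u, isVisited.entry u = true → c'.1.entry u = c.1.entry u) ∧
    (∀ u, c.1.entry u ≤ c'.1.entry u) ∧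
    (∑ u, c'.1.entry u ≤ ∑ u, c.1.entry u + pre.length) ∧
    (∀ u, c'.2.entry u = c.2.entry u ∨ c'.2.entry u = some x) ∧
    (∀ u ∈ pre, isVisited.entry u = false → c'.2.entry u = some x) ∧
    (∀ u, c'.2.entry u = some x → c.2.entry u = some x ∨ c.1.entry u + 1 ≤ c'.1.entry u))
    ⟨fun _ _ => rfl, fun _ => le_rfl, by simp, fun _ => Or.inl rfl, by simp,
      fun _ h => Or.inl h⟩ ?_
  intro pre w post c' _ ⟨h1, h2, h3, h4, h5, h6⟩
  simp only [read_bind_val, step_bind_val, write_bind_val, ite_val, pure_val]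
  by_cases hs : isVisited.entry w = true ∨ c'.2.entry w = some x
  · rw [if_pos (by simpa using hs)]
    refine ⟨h1, h2, ?_, h4, ?_, h6⟩
    · rw [List.length_append]; exact h3.trans (by omega)
    · intro u hu hvis
      rcases List.mem_append.1 hu with hu | hu
      · exact h5 u hu hvis
      · rw [List.mem_singleton.1 hu] at hvis ⊢
        exact hs.resolve_left (by simp [hvis])
  · rw [if_neg (by simpa using hs)]
    obtain ⟨hs1, hs2⟩ := not_or.1 hs
    dsimp only
    have hle : ∀ u, c'.1.entry u ≤ Function.update c'.1.entry w (c'.1.entry w + 1) u := by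
      intro u
      by_cases huw : u = w
      · subst huw; simp
      · simp [huw]
    refine ⟨?_, fun u => (h2 u).trans (hle u), ?_, ?_, ?_, ?_⟩
    · intro u hu
      have huw : u ≠ w := by rintro rfl; exact hs1 hu
      rw [Function.update_of_ne huw]
      exact h1 u hu
    · rw [List.length_append, List.length_singleton]
      have : ∀ u, Function.update c'.1.entry w (c'.1.entry w + 1) u =
          c'.1.entry u + if u = w then 1 else 0 := by
        intro u
        by_cases huw : u = w
        · subst huw; simp
        · simp [huw]
      simp only [this, Finset.sum_add_distrib, Finset.sum_ite_eq', Finset.mem_univ, if_true]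
      omega
    · intro u
      by_cases huw : u = w
      · subst huw; simp
      · simpa [huw] using h4 u
    · intro u hu hvis
      by_cases huw : u = w
      · subst huw; simp
      · rw [Function.update_of_ne huw]
        exact h5 u (by simpa [huw] using hu) hvis
    · intro u hu
      by_cases huw : u = w
      · subst huw
        right
        simpa using h2 u
      · rw [Function.update_of_ne huw] at hu ⊢
        exact h6 u hu

theorem countPath_cost_le {n : ℕ} (isVisited : Arr (Fin n) Bool) (x : Fin n) (p : List (Fin n))
    (c : Arr (Fin n) ℕ × Arr (Fin n) (Option (Fin n))) :
    (countPath isVisited x p c).cost ≤ p.length * 7 := by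
  refine forEach_cost_le 6 fun u _ c => ?_
  simp only [read_bind_cost, step_bind_cost, write_bind_cost, ite_cost, pure_cost]
  split_ifs <;> omega

/-- The number of endpoints `x` such that `u` lies on a stored path between `v` and `x`. -/
def hitCount {n : ℕ} (pf pt : Fin n → List (Fin n)) (u : Fin n) : ℕ :=
  (Finset.univ.filter fun x => u ∈ pt x ∨ u ∈ pf x).card

theorem hitCount_le {n : ℕ} (pf pt : Fin n → List (Fin n)) (u : Fin n) : hitCount pf pt u ≤ n :=
  (Finset.card_le_univ _).trans (by simp)

/-- The loop of the procedure `visit` that updates the congestion counters. -/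
def countLoop {n : ℕ} (isVisited : Arr (Fin n) Bool) (labFrom labTo : Arr (Fin n) (Label n))
    (c : Arr (Fin n) ℕ × Arr (Fin n) (Option (Fin n))) :
    Timed (Arr (Fin n) ℕ × Arr (Fin n) (Option (Fin n))) :=
  forEach (nodes n) c fun x c => do
    let lf ← labFrom.read x
    let lt ← labTo.read x
    let c ← countPath isVisited x lt.path c
    countPath isVisited x lf.path c

/-- Every endpoint is processed once, so no node carries the mark `x` before the turn of `x`, and
each node on a path for `x` gains at least one. Two one-sided bounds are enough: each counter from
below, to control the affected nodes, and the total from above, for the greedy argument. -/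
theorem countLoop_spec {n : ℕ} (isVisited : Arr (Fin n) Bool)
    (labFrom labTo : Arr (Fin n) (Label n)) (c : Arr (Fin n) ℕ) :
    (∀ u, isVisited.entry u = true →
      (countLoop isVisited labFrom labTo (c, ⟨fun _ => none⟩)).val.1.entry u = c.entry u) ∧
    (∀ u, isVisited.entry u = false →
      c.entry u + hitCount (fun x => (labFrom.entry x).path) (fun x => (labTo.entry x).path) u ≤
      (countLoop isVisited labFrom labTo (c, ⟨fun _ => none⟩)).val.1.entry u) ∧
    (∑ u, (countLoop isVisited labFrom labTo (c, ⟨fun _ => none⟩)).val.1.entry u ≤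
      ∑ u, c.entry u + ∑ x, ((labTo.entry x).path.length + (labFrom.entry x).path.length)) := by
  have key := forEach_val_spec (l := nodes n)
    (init := ((c, ⟨fun _ => none⟩) : Arr (Fin n) ℕ × Arr (Fin n) (Option (Fin n))))
    (body := fun x c => do
      let lf ← labFrom.read x
      let lt ← labTo.read x
      let c ← countPath isVisited x lt.path c
      countPath isVisited x lf.path c)
    (fun pre c' => (∀ u, isVisited.entry u = true → c'.1.entry u = c.entry u) ∧
      (∀ u, isVisited.entry u = false → c.entry u +
        (pre.map fun x => if u ∈ (labTo.entry x).path ∨ u ∈ (labFrom.entry x).path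
          then 1 else 0).sum ≤ c'.1.entry u) ∧
      (∑ u, c'.1.entry u ≤ ∑ u, c.entry u +
        (pre.map fun x => (labTo.entry x).path.length + (labFrom.entry x).path.length).sum) ∧
      ∀ u x, c'.2.entry u = some x → x ∈ pre)
    ⟨fun _ _ => rfl, by simp, by simp, by simp⟩ (by
    intro pre x post c0 hl ⟨h1, h2, h3, h4⟩
    -- The current endpoint is new, hence its mark is not yet present anywhere.
    have hx : x ∉ pre := by
      have := nodup_nodes n
      rw [hl, List.nodup_append] at this
      exact fun h => this.2.2 x h x (by simp) rfl
    simp only [bind_val, read_val]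
    obtain ⟨a1, a2, a3, a4, a5, a6⟩ := countPath_spec isVisited x (labTo.entry x).path c0
    set c1 := (countPath isVisited x (labTo.entry x).path c0).val
    obtain ⟨b1, b2, b3, b4, b5, b6⟩ := countPath_spec isVisited x (labFrom.entry x).path c1
    set c2 := (countPath isVisited x (labFrom.entry x).path c1).val
    refine ⟨fun u hu => by rw [b1 u hu, a1 u hu, h1 u hu], fun u hu => ?_, ?_, ?_⟩
    · simp only [List.map_append, List.map_cons, List.map_nil, List.sum_append, List.sum_cons,
        List.sum_nil]
      have hc := h2 u hu
      have ha := a2 u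
      have hb := b2 u
      split_ifs with hmem
      · have hm : c2.2.entry u = some x := by
          rcases hmem with hm | hm
          · rcases b4 u with h | h
            · rw [h]; exact a5 u hm hu
            · exact h
          · exact b5 u hm hu
        rcases b6 u hm with h | h
        · rcases a6 u h with h | h
          · exact absurd (h4 u x h) hx
          · omega
        · omega
      · omega
    · simp only [List.map_append, List.map_cons, List.map_nil, List.sum_append, List.sum_cons,
        List.sum_nil]
      omega
    · intro u y hy
      rw [List.mem_append, List.mem_singleton]
      rcases b4 u with h | h
      · rw [h] at hy
        rcases a4 u with h | h
        · rw [h] at hy; exact Or.inl (h4 u y hy)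
        · rw [h] at hy; exact Or.inr (Option.some.inj hy).symm
      · rw [h] at hy; exact Or.inr (Option.some.inj hy).symm)
  obtain ⟨h1, h2, h3, -⟩ := key
  refine ⟨h1, fun u hu => ?_, ?_⟩
  · have := h2 u hu
    rw [sum_map_nodes] at this
    rw [hitCount, Finset.card_filter]
    exact this
  · rw [sum_map_nodes] at h3
    exact h3

/-! ### Visiting a node -/

/-- The adjacency matrix of the graph without the edges incident to visited nodes. -/
def visitMatrix {n : ℕ} (W : WMatrix n) (L : Layer n) : Timed (WMatrix n) :=
  tabulate₂ ⊤ fun x y => do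
    let a ← L.isVisited.read x
    let b ← L.isVisited.read y
    if a || b then step ⊤ else W.read (x, y)

/-- The adjacency matrix of the reverse graph. -/
def reverseMatrix {n : ℕ} (M : WMatrix n) : Timed (WMatrix n) :=
  tabulate₂ ⊤ fun x y => M.read (y, x)

theorem visitMatrix_val {n : ℕ} (W : WMatrix n) (L : Layer n) (x y : Fin n) :
    (visitMatrix W L).val.entry (x, y) = restrict W.curried L.isVisited.entry x y := by
  rw [visitMatrix, tabulate₂_val]
  simp only [read_bind_val, ite_val, read_val, step_val, restrict, Bool.or_eq_true]
  rfl

/-- The effect of `visit` on a layer. -/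
structure VisitSpec {n : ℕ} (W : WMatrix n) (h : ℕ) (v : Fin n) (L L' : Layer n) : Prop where
  center : L'.center = L.center
  isVisited : L'.isVisited.entry = Function.update L.isVisited.entry v true
  visited : L'.visited = v :: L.visited
  data : VisitData W.curried h L.isVisited.entry v (fun x => L'.pathFrom.entry (v, x))
    (fun x => L'.pathTo.entry (v, x)) (fun s t => L'.through.entry (s, v, t))
  pathFrom : ∀ v' x, v' ≠ v → L'.pathFrom.entry (v', x) = L.pathFrom.entry (v', x)
  pathTo : ∀ v' x, v' ≠ v → L'.pathTo.entry (v', x) = L.pathTo.entry (v', x)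
  through : ∀ s v' t, v' ≠ v → L'.through.entry (s, v', t) = L.through.entry (s, v', t)
  congestion_eq : ∀ u, L'.isVisited.entry u = true → L'.congestion.entry u = L.congestion.entry u
  congestion_ge : ∀ u, L'.isVisited.entry u = false → L.congestion.entry u +
    hitCount (fun x => L'.pathFrom.entry (v, x)) (fun x => L'.pathTo.entry (v, x)) u ≤
      L'.congestion.entry u
  congestion_sum : ∑ u, L'.congestion.entry u ≤ ∑ u, L.congestion.entry u + 2 * (n * (h + 1))

/-- For each endpoint the two stored paths have at most `h + 1` nodes each, whence the total
increase 2n(h+1) of the counters. The dominant cost is that of the two runs of Bellman-Ford with `h`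
iterations of O(n²). -/
theorem visit_spec {n : ℕ} (W : WMatrix n) (h : ℕ) (v : Fin n) (L : Layer n)
    (hv : L.isVisited.entry v = false) :
    VisitSpec W h v L (visit W h v L).val ∧ (visit W h v L).cost ≤ 80 * ((h + 1) * (n * n)) := by
  set M := (visitMatrix W L).val with hM
  set Mrev := (reverseMatrix M).val with hMrev
  set labFrom := (bellmanFord h M v).val with hF
  set labTo := (bellmanFord h Mrev v).val with hT
  set S' : Arr (Fin n) Bool := ⟨Function.update L.isVisited.entry v true⟩ with hS'
  set cl := countLoop S' labFrom labTo (L.congestion, ⟨fun _ => none⟩) with hcl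
  set pf := forEach (nodes n) L.pathFrom fun x a => do
    let lf ← labFrom.read x
    a.write (v, x) lf.path with hpf
  set pt := forEach (nodes n) L.pathTo fun x a => do
    let lt ← labTo.read x
    a.write (v, x) lt.path with hpt
  set th := forEach (nodes n) L.through fun s a =>
    forEach (nodes n) a fun t a => do
      let ls ← labTo.read s
      let lt ← labFrom.read t
      let d ← step (ls.dist + lt.dist)
      a.write (s, v, t) d with hth
  have hval : (visit W h v L).val = ⟨L.center, S', v :: L.visited, cl.val.1, pf.val, pt.val,
    th.val, L.sorted⟩ := rfl
  have hcost : (visit W h v L).cost = (visitMatrix W L).cost + ((reverseMatrix M).cost +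
    ((bellmanFord h M v).cost + ((bellmanFord h Mrev v).cost + (1 + (1 + (Fintype.card (Fin n) +
    (cl.cost + (pf.cost + (pt.cost + (th.cost + 0)))))))))) := rfl
  have hlabF : BestLabels (fun x y => restrict W.curried L.isVisited.entry y x) v h
      labFrom.entry := by
    have := bellmanFord_spec h M v
    simpa only [hM, visitMatrix_val] using this
  have hMrev_val : ∀ x y, Mrev.entry (x, y) = restrict W.curried L.isVisited.entry y x := by
    intro x y
    rw [hMrev, reverseMatrix, tabulate₂_val, read_val, hM, visitMatrix_val]
  have hlabT : BestLabels (restrict W.curried L.isVisited.entry) v h labTo.entry := by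
    have := bellmanFord_spec h Mrev v
    simpa only [hMrev_val] using this
  have hpfv := forEach_write_val (l := nodes n) L.pathFrom (fun x => (v, x))
    (fun a b hab => (Prod.mk.inj hab).2) (fun x => pure (labFrom.entry x).path)
    (fun x a => do
      let lf ← labFrom.read x
      a.write (v, x) lf.path) (fun _ _ => rfl)
  have hptv := forEach_write_val (l := nodes n) L.pathTo (fun x => (v, x))
    (fun a b hab => (Prod.mk.inj hab).2) (fun x => pure (labTo.entry x).path)
    (fun x a => do
      let lt ← labTo.read x
      a.write (v, x) lt.path) (fun _ _ => rfl)
  have hthv := forEach_forEach_write_val L.through (fun s t => (s, v, t))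
    (by simp) (fun s t => pure ((labTo.entry s).dist + (labFrom.entry t).dist))
    (fun s t a => do
      let ls ← labTo.read s
      let lt ← labFrom.read t
      let d ← step (ls.dist + lt.dist)
      a.write (s, v, t) d) (fun _ _ _ => rfl)
  rw [← hpf] at hpfv
  rw [← hpt] at hptv
  rw [← hth] at hthv
  have hpf' : ∀ x, pf.val.entry (v, x) = (labFrom.entry x).path :=
    fun x => hpfv.1 x (mem_nodes x)
  have hpt' : ∀ x, pt.val.entry (v, x) = (labTo.entry x).path :=
    fun x => hptv.1 x (mem_nodes x)
  obtain ⟨hc1, hc2, hc3⟩ := countLoop_spec S' labFrom labTo L.congestion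
  rw [← hcl] at hc1 hc2 hc3
  constructor
  · rw [hval]
    refine ⟨rfl, rfl, rfl, ⟨hv, labFrom.entry, labTo.entry, hlabF, hlabT, hpf', hpt',
      fun s t => hthv.1 s t⟩, ?_, ?_, ?_, hc1, ?_, ?_⟩
    · intro v' x hne
      exact hpfv.2 _ fun y _ h => hne (Prod.mk.inj h).1.symm
    · intro v' x hne
      exact hptv.2 _ fun y _ h => hne (Prod.mk.inj h).1.symm
    · intro s v' t hne
      exact hthv.2 _ fun y z h => hne (Prod.mk.inj (Prod.mk.inj h).2).1.symm
    · intro u hu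
      simp only [hpf', hpt']
      exact hc2 u hu
    · have : ∑ x, ((labTo.entry x).path.length + (labFrom.entry x).path.length) ≤
          ∑ _x : Fin n, (2 * (h + 1)) := Finset.sum_le_sum fun x _ => by
        have := hlabF.length_path x
        have := hlabT.length_path x
        omega
      simp only [Finset.sum_const, Finset.card_univ, Fintype.card_fin, smul_eq_mul] at this
      refine hc3.trans (Nat.add_le_add_left (this.trans (le_of_eq (by ring))) _)
  · rw [hcost]
    have k1 : (visitMatrix W L).cost ≤ n * n * (3 + 4) := by
      refine tabulate₂_cost_le _ _ 3 fun x y => ?_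
      simp only [bind_cost, read_cost, ite_cost, step_cost]
      split_ifs <;> simp
    have k2 : (reverseMatrix M).cost ≤ n * n * (1 + 4) :=
      tabulate₂_cost_le _ _ 1 fun x y => le_rfl
    have k3 := bellmanFord_cost_le h M v
    have k4 := bellmanFord_cost_le h Mrev v
    have k5 : cl.cost ≤ n * (14 * (h + 1) + 2 + 1) := by
      have := forEach_cost_le (l := nodes n)
        (init := ((L.congestion, ⟨fun _ => none⟩) :
          Arr (Fin n) ℕ × Arr (Fin n) (Option (Fin n))))
        (body := fun x c => do
          let lf ← labFrom.read x
          let lt ← labTo.read x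
          let c ← countPath S' x lt.path c
          countPath S' x lf.path c) (14 * (h + 1) + 2) (by
          intro x _ c
          simp only [bind_cost, read_cost, read_val]
          have h1 := countPath_cost_le S' x (labTo.entry x).path c
          have h2 := countPath_cost_le S' x (labFrom.entry x).path
            (countPath S' x (labTo.entry x).path c).val
          have h3 := hlabF.length_path x
          have h4 := hlabT.length_path x
          omega)
      rw [length_nodes] at this
      exact this
    have k6 : pf.cost ≤ n * (2 + 1) := by
      have := forEach_cost_le (l := nodes n) (init := L.pathFrom) (body := fun x a => do
        let lf ← labFrom.read x
        a.write (v, x) lf.path) 2 (by simp)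
      rw [length_nodes] at this
      exact this
    have k7 : pt.cost ≤ n * (2 + 1) := by
      have := forEach_cost_le (l := nodes n) (init := L.pathTo) (body := fun x a => do
        let lt ← labTo.read x
        a.write (v, x) lt.path) 2 (by simp)
      rw [length_nodes] at this
      exact this
    have k8 : th.cost ≤ n * (n * (4 + 1) + 1) :=
      forEach_forEach_cost_le L.through (fun s t a => do
        let ls ← labTo.read s
        let lt ← labFrom.read t
        let d ← step (ls.dist + lt.dist)
        a.write (s, v, t) d) 4 (fun _ _ _ => by simp)
    rw [Fintype.card_fin]
    have hn : 1 ≤ n := Fin.pos v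
    have e1 : n ≤ n * n := Nat.le_mul_of_pos_left n hn
    have e2 : n * n ≤ (h + 1) * (n * n) := Nat.le_mul_of_pos_left _ (Nat.succ_pos h)
    have e3 : n * (h + 1) ≤ (h + 1) * (n * n) := by
      rw [mul_comm]; exact Nat.mul_le_mul_left _ e1
    nlinarith

/-! ### The greedy loop of the preprocessing -/

theorem argmaxCongestion_spec {n : ℕ} (congestion : Arr (Fin n) ℕ) (eligible : Arr (Fin n) Bool) :
    ((argmaxCongestion congestion eligible).val = none → ∀ v, eligible.entry v = false) ∧
    (∀ v, (argmaxCongestion congestion eligible).val = some v → eligible.entry v = true ∧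
      ∀ u, eligible.entry u = true → congestion.entry u ≤ congestion.entry v) ∧
    (argmaxCongestion congestion eligible).cost ≤ 4 * n + 1 := by
  set body : Fin n → Option (Fin n × ℕ) → Timed (Option (Fin n × ℕ)) := fun v best => do
    let e ← eligible.read v
    let k ← congestion.read v
    step (match best with
      | none => if e then some (v, k) else none
      | some b => if e && decide (b.2 < k) then some (v, k) else some b) with hbody
  have hv : (argmaxCongestion congestion eligible).val =
      (forEach (nodes n) none body).val.map Prod.fst := rfl
  have hc : (argmaxCongestion congestion eligible).cost =
      (forEach (nodes n) none body).cost + 1 := rfl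
  have key := forEach_val_spec (l := nodes n) (init := none) (body := body)
    (fun pre best => (best = none → ∀ v ∈ pre, eligible.entry v = false) ∧
      ∀ b, best = some b → eligible.entry b.1 = true ∧ b.2 = congestion.entry b.1 ∧
        ∀ u ∈ pre, eligible.entry u = true → congestion.entry u ≤ b.2)
    (by simp) (by
      intro pre v post best _ ⟨h1, h2⟩
      simp only [hbody, read_bind_val, step_val]
      cases best with
      | none =>
        simp only
        split_ifs with he
        · refine ⟨by simp, ?_⟩
          rintro b hb
          obtain rfl := Option.some.inj hb
          refine ⟨he, rfl, fun u hu hue => ?_⟩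
          rcases List.mem_append.1 hu with hu | hu
          · simp [h1 rfl u hu] at hue
          · rw [List.mem_singleton.1 hu]
        · refine ⟨fun _ u hu => ?_, by simp⟩
          rcases List.mem_append.1 hu with hu | hu
          · exact h1 rfl u hu
          · rw [List.mem_singleton.1 hu]; simpa using he
      | some b =>
        simp only [Bool.and_eq_true, decide_eq_true_eq]
        obtain ⟨h3, h4, h5⟩ := h2 b rfl
        split_ifs with he
        · refine ⟨by simp, ?_⟩
          rintro b' hb
          obtain rfl := Option.some.inj hb
          refine ⟨he.1, rfl, fun u hu hue => ?_⟩
          rcases List.mem_append.1 hu with hu | hu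
          · exact (h5 u hu hue).trans he.2.le
          · rw [List.mem_singleton.1 hu]
        · refine ⟨by simp, ?_⟩
          rintro b' hb
          obtain rfl := Option.some.inj hb
          refine ⟨h3, h4, fun u hu hue => ?_⟩
          rcases List.mem_append.1 hu with hu | hu
          · exact h5 u hu hue
          · rw [List.mem_singleton.1 hu] at hue ⊢
            exact not_lt.1 fun h => he ⟨hue, h⟩)
  obtain ⟨h1, h2⟩ := key
  rw [hv, hc]
  refine ⟨fun h v => h1 (by simpa using h) v (mem_nodes v), fun v h => ?_, ?_⟩
  · obtain ⟨b, hb, rfl⟩ := Option.map_eq_some_iff.1 h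
    obtain ⟨h3, h4, h5⟩ := h2 b hb
    exact ⟨h3, fun u hu => h4 ▸ h5 u (mem_nodes u) hu⟩
  · have := forEach_cost_le (l := nodes n) (init := none) (body := body) 3 (by simp [hbody])
    rw [length_nodes] at this
    omega

/-- The structural invariant of a layer. -/
structure LayerInv {n : ℕ} (W : WMatrix n) (h : ℕ) (center : Fin n → Bool) (L : Layer n) :
    Prop where
  center_eq : L.center.entry = center
  nodup : L.visited.Nodup
  isVisited_eq : L.isVisited.entry = fun u => decide (u ∈ L.visited)
  data : ∀ l₁ v l₂, L.visited = l₁ ++ v :: l₂ → VisitData W.curried h (fun u => decide (u ∈ l₂)) v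
    (fun x => L.pathFrom.entry (v, x)) (fun x => L.pathTo.entry (v, x))
    (fun s t => L.through.entry (s, v, t))
  hits_le : ∀ u, (L.visited.map fun v => hitCount (fun x => L.pathFrom.entry (v, x))
    (fun x => L.pathTo.entry (v, x)) u).sum ≤
      L.congestion.entry u + if L.isVisited.entry u then n else 0

/-- Hits on unvisited nodes are recorded by their counters. The visit of `u` itself is not counted
for `u` and accounts for the additional `n`; afterwards `u` is isolated and receives no hits. The
list of visited nodes has the newest one first, so the part behind a node is exactly what had been
removed when that node was visited. -/
theorem LayerInv.visit {n : ℕ} {W : WMatrix n} {h : ℕ} {center : Fin n → Bool} {L L' : Layer n}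
    {v : Fin n} (hL : LayerInv W h center L) (hV : VisitSpec W h v L L') :
    LayerInv W h center L' := by
  have hv : v ∉ L.visited := by
    have := hV.data.1
    rw [hL.isVisited_eq] at this
    simpa using this
  have hsame : ∀ w ∈ L.visited, w ≠ v := fun w hw h => hv (h ▸ hw)
  refine ⟨by rw [hV.center, hL.center_eq], ?_, ?_, ?_, ?_⟩
  · rw [hV.visited]; exact List.nodup_cons.2 ⟨hv, hL.nodup⟩
  · rw [hV.isVisited, hV.visited, hL.isVisited_eq]
    funext u
    by_cases huv : u = v
    · subst huv; simp
    · simp [huv]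
  · intro l₁ w l₂ hl
    rw [hV.visited] at hl
    cases l₁ with
    | nil =>
      simp only [List.nil_append, List.cons.injEq] at hl
      obtain ⟨rfl, rfl⟩ := hl
      have := hV.data
      rwa [hL.isVisited_eq] at this
    | cons a l₁ =>
      simp only [List.cons_append, List.cons.injEq] at hl
      obtain ⟨rfl, hl⟩ := hl
      have hw : w ≠ v := hsame w (by rw [hl]; simp)
      have := hL.data l₁ w l₂ hl
      simpa only [hV.pathFrom _ _ hw, hV.pathTo _ _ hw, hV.through _ _ _ hw] using this
  · intro u
    rw [hV.visited, List.map_cons, List.sum_cons]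
    have hold : (L.visited.map fun v => hitCount (fun x => L'.pathFrom.entry (v, x))
        (fun x => L'.pathTo.entry (v, x)) u) =
        L.visited.map fun v => hitCount (fun x => L.pathFrom.entry (v, x))
        (fun x => L.pathTo.entry (v, x)) u := by
      refine List.map_congr_left fun w hw => ?_
      simp only [hV.pathFrom _ _ (hsame w hw), hV.pathTo _ _ (hsame w hw)]
    rw [hold]
    have h1 := hL.hits_le u
    by_cases hu : L'.isVisited.entry u = true
    · rw [hu, hV.congestion_eq u hu]
      by_cases huv : u = v
      · subst huv
        rw [hV.data.1] at h1
        have := hitCount_le (fun x => L'.pathFrom.entry (u, x))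
          (fun x => L'.pathTo.entry (u, x)) u
        simp only [if_true, Bool.false_eq_true, if_false] at h1 ⊢
        omega
      · have hu' : L.isVisited.entry u = true := by
          rwa [hV.isVisited, Function.update_of_ne huv] at hu
        -- A node visited earlier lies on no path of the present visit.
        have hz : hitCount (fun x => L'.pathFrom.entry (v, x))
            (fun x => L'.pathTo.entry (v, x)) u = 0 := by
          rw [hitCount, Finset.card_eq_zero, Finset.filter_eq_empty_iff]
          intro x _ hx
          rcases hx with hx | hx
          · exact hV.data.notMem_pt hu' x hx
          · exact hV.data.notMem_pf hu' x hx
        rw [hu'] at h1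
        rw [hz, zero_add]
        exact h1
    · have hu0 : L'.isVisited.entry u = false := by simpa using hu
      have huv : u ≠ v := by
        rintro rfl
        rw [hV.isVisited] at hu0
        simp at hu0
      have hu' : L.isVisited.entry u = false := by
        rwa [hV.isVisited, Function.update_of_ne huv] at hu0
      have h2 := hV.congestion_ge u hu0
      rw [hu'] at h1
      simp only [Bool.false_eq_true, if_false, add_zero] at h1
      omega

/-! ### The balancing argument for the congestion counters -/

/-- A bound for the sum of the counters over any set of unvisited nodes of a class `K`. -/
def CongBound {n : ℕ} (T : ℝ) (K : Fin n → Bool) (σ : ℝ) (L : Layer n) : Prop :=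
  ∀ A : Finset (Fin n), (∀ u ∈ A, K u = true ∧ L.isVisited.entry u = false) →
    ∑ u ∈ A, (L.congestion.entry u : ℝ) ≤
      A.card * (2 * T * ((harmonic n : ℝ) - (harmonic A.card : ℝ))) + σ * T

theorem VisitSpec.isVisited_of {n : ℕ} {W : WMatrix n} {h : ℕ} {L L' : Layer n} {v : Fin n}
    (hV : VisitSpec W h v L L') {u : Fin n} (hu : L'.isVisited.entry u = false) :
    u ≠ v ∧ L.isVisited.entry u = false := by
  rw [hV.isVisited] at hu
  have huv : u ≠ v := by rintro rfl; simp at hu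
  rw [Function.update_of_ne huv] at hu
  exact ⟨huv, hu⟩

theorem VisitSpec.congestion_le {n : ℕ} {W : WMatrix n} {h : ℕ} {L L' : Layer n} {v : Fin n}
    (hV : VisitSpec W h v L L') (u : Fin n) : L.congestion.entry u ≤ L'.congestion.entry u := by
  cases hu : L'.isVisited.entry u with
  | true => exact (hV.congestion_eq u hu).ge
  | false => exact (Nat.le_add_right _ _).trans (hV.congestion_ge u hu)

theorem VisitSpec.sum_le {n : ℕ} {W : WMatrix n} {h : ℕ} {L L' : Layer n} {v : Fin n}
    (hV : VisitSpec W h v L L') (A : Finset (Fin n)) :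
    ∑ u ∈ A, (L'.congestion.entry u : ℝ) ≤
      ∑ u ∈ A, (L.congestion.entry u : ℝ) + 2 * (n * (h + 1)) := by
  have h1 : ∑ u ∈ A, ((L'.congestion.entry u : ℝ) - L.congestion.entry u) ≤
      ∑ u, ((L'.congestion.entry u : ℝ) - L.congestion.entry u) :=
    Finset.sum_le_sum_of_subset_of_nonneg (Finset.subset_univ _) fun u _ _ =>
      sub_nonneg.2 (Nat.cast_le.2 (hV.congestion_le u))
  have h2 : (∑ u, (L'.congestion.entry u : ℝ)) ≤
      ∑ u, (L.congestion.entry u : ℝ) + 2 * (n * (h + 1)) := by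
    exact_mod_cast hV.congestion_sum
  rw [Finset.sum_sub_distrib, Finset.sum_sub_distrib] at h1
  linarith

/-- Whatever node is visited, all counters together grow by at most T = 2n(h+1), which costs one
unit of `σ`. -/
theorem CongBound.visit_other {n : ℕ} {W : WMatrix n} {h : ℕ} {L L' : Layer n} {v : Fin n}
    {K : Fin n → Bool} {σ : ℝ} (hL : CongBound (2 * (n * (h + 1))) K σ L)
    (hV : VisitSpec W h v L L') : CongBound (2 * (n * (h + 1))) K (σ + 1) L' := by
  intro A hA
  have h1 := hL A fun u hu => ⟨(hA u hu).1, (hV.isVisited_of (hA u hu).2).2⟩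
  have h2 := hV.sum_le A
  linarith

/-- Before the visit, apply the bound to A ∪ {v}. The harmonic difference for a + 1 nodes absorbs
the slack 2T exactly, and as `v` has the largest counter, dropping it leaves at most the fraction
a/(a+1) of the sum. Thus the slack is reset to zero, and the visit itself brings it to one. The
value 2 allowed for `σ` corresponds to the two visits of a round. -/
theorem CongBound.visit_max {n : ℕ} {W : WMatrix n} {h : ℕ} {L L' : Layer n} {v : Fin n}
    {K : Fin n → Bool} {σ : ℝ} (hL : CongBound (2 * (n * (h + 1))) K σ L) (hσ : σ ≤ 2)
    (hV : VisitSpec W h v L L') (hKv : K v = true)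
    (hmax : ∀ u, K u = true → L.isVisited.entry u = false →
      L.congestion.entry u ≤ L.congestion.entry v) :
    CongBound (2 * (n * (h + 1))) K 1 L' := by
  intro A hA
  set T : ℝ := 2 * (n * (h + 1)) with hT
  have hT0 : 0 ≤ T := by positivity
  have hvA : v ∉ A := fun hv => (hV.isVisited_of (hA v hv).2).1 rfl
  have hA' : ∀ u ∈ A, K u = true ∧ L.isVisited.entry u = false := fun u hu =>
    ⟨(hA u hu).1, (hV.isVisited_of (hA u hu).2).2⟩
  have h2 := hV.sum_le A
  rw [← hT] at h2
  have h1 := hL (insert v A) (by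
    intro u hu
    rcases Finset.mem_insert.1 hu with rfl | hu
    · exact ⟨hKv, hV.data.1⟩
    · exact hA' u hu)
  rw [Finset.sum_insert hvA, Finset.card_insert_of_notMem hvA, harmonic_succ] at h1
  set a := A.card with ha
  have h3 : ∑ u ∈ A, (L.congestion.entry u : ℝ) ≤ a * L.congestion.entry v := by
    have := Finset.sum_le_card_nsmul A (fun u => (L.congestion.entry u : ℝ))
      (L.congestion.entry v : ℝ) fun u hu => Nat.cast_le.2 (hmax u (hA' u hu).1 (hA' u hu).2)
    simpa [nsmul_eq_mul] using this
  set sA := ∑ u ∈ A, (L.congestion.entry u : ℝ)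
  set H : ℝ := (harmonic n : ℝ)
  push_cast at h1
  set Ha : ℝ := (harmonic a : ℝ)
  have ha0 : (0 : ℝ) ≤ a := Nat.cast_nonneg a
  have ha1 : (0 : ℝ) < a + 1 := by linarith
  -- Since (a+1)·H_{a+1} = (a+1)·H_a + 1, the main term loses precisely 2T.
  have h4 : ((a : ℝ) + 1) * (2 * T * (H - (Ha + ((a : ℝ) + 1)⁻¹))) =
      (a + 1) * (2 * T * (H - Ha)) - 2 * T := by
    field_simp
    ring
  rw [h4] at h1
  have h5 : σ * T ≤ 2 * T := mul_le_mul_of_nonneg_right hσ hT0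
  -- By maximality of `v` the sum over A is at most a times its counter; adding a times the sum
  -- gives (a+1)·sA ≤ a·(c(v) + sA).
  have h6 : (a + 1) * sA ≤ (a + 1) * (a * (2 * T * (H - Ha))) := by
    have h7 : (L.congestion.entry v : ℝ) + sA ≤ (a + 1) * (2 * T * (H - Ha)) := by linarith
    have := mul_le_mul_of_nonneg_left h7 ha0
    linarith
  have h8 := le_of_mul_le_mul_left h6 ha1
  linarith

theorem CongBound.mono {n : ℕ} {T : ℝ} {K : Fin n → Bool} {σ τ : ℝ} {L : Layer n} (hT : 0 ≤ T)
    (hL : CongBound T K σ L) (h : σ ≤ τ) : CongBound T K τ L := fun A hA =>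
  (hL A hA).trans (add_le_add le_rfl (mul_le_mul_of_nonneg_right h hT))

/-- For a single node the bound reads 2T(H_n − 1) + 2T. -/
theorem CongBound.entry_le {n : ℕ} {T : ℝ} {K : Fin n → Bool} {σ : ℝ} {L : Layer n} (hT : 0 ≤ T)
    (hL : CongBound T K σ L) (hσ : σ ≤ 2) {u : Fin n} (hK : K u = true)
    (hu : L.isVisited.entry u = false) :
    (L.congestion.entry u : ℝ) ≤ 2 * T * (harmonic n : ℝ) := by
  have := hL {u} (by simpa using ⟨hK, hu⟩)
  simp only [Finset.sum_singleton, Finset.card_singleton] at this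
  have h1 : σ * T ≤ 2 * T := mul_le_mul_of_nonneg_right hσ hT
  have h2 : (harmonic 1 : ℝ) = 1 := by simp [harmonic]
  rw [h2] at this
  push_cast at this
  linarith

/-- The number of unvisited centers. -/
def unvisitedCenters {n : ℕ} (center : Fin n → Bool) (L : Layer n) : Finset (Fin n) :=
  {u | center u = true ∧ L.isVisited.entry u = false}

/-- The invariant of the while loop. -/
structure LoopInv {n : ℕ} (W : WMatrix n) (h : ℕ) (center : Fin n → Bool) (L : Layer n) :
    Prop where
  layer : LayerInv W h center L
  center_bound : CongBound (2 * (n * (h + 1))) center 2 L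
  other_bound : CongBound (2 * (n * (h + 1))) (fun u => !center u) 1 L
  visited_bound : ∀ u, L.isVisited.entry u = true →
    (L.congestion.entry u : ℝ) ≤ 2 * (2 * (n * (h + 1))) * (harmonic n : ℝ)
  length_le : L.visited.length + 2 * (unvisitedCenters center L).card ≤
    2 * (Finset.univ.filter fun u => center u = true).card

theorem visited_bound_visit {n : ℕ} {W : WMatrix n} {h : ℕ} {L L' : Layer n} {v : Fin n} {B : ℝ}
    (hb : ∀ u, L.isVisited.entry u = true → (L.congestion.entry u : ℝ) ≤ B)
    (hv : (L.congestion.entry v : ℝ) ≤ B) (hV : VisitSpec W h v L L') (u : Fin n)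
    (hu : L'.isVisited.entry u = true) : (L'.congestion.entry u : ℝ) ≤ B := by
  rw [hV.congestion_eq u hu]
  by_cases huv : u = v
  · rw [huv]; exact hv
  · rw [hV.isVisited, Function.update_of_ne huv] at hu
    exact hb u hu

theorem unvisitedCenters_visit {n : ℕ} {W : WMatrix n} {h : ℕ} {L L' : Layer n} {v : Fin n}
    (center : Fin n → Bool) (hV : VisitSpec W h v L L') :
    unvisitedCenters center L' = (unvisitedCenters center L).erase v := by
  ext u
  simp only [unvisitedCenters, Finset.mem_filter, Finset.mem_univ, true_and, Finset.mem_erase,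
    hV.isVisited]
  by_cases huv : u = v
  · subst huv; simp
  · simp [huv]

/-- The eligible nodes. -/
def eligibleNodes {n : ℕ} (isCenter : Bool) (L : Layer n) : Timed (Arr (Fin n) Bool) :=
  tabulate false fun v => do
    let c ← L.center.read v
    let r ← L.isVisited.read v
    step ((if isCenter then c else !c) && !r)

theorem eligibleNodes_val {n : ℕ} (isCenter : Bool) (L : Layer n) (v : Fin n) :
    (eligibleNodes isCenter L).val.entry v = true ↔
      (if isCenter then L.center.entry v else !L.center.entry v) = true ∧
        L.isVisited.entry v = false := by
  rw [eligibleNodes, tabulate_val]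
  simp

theorem eligibleNodes_cost_le {n : ℕ} (isCenter : Bool) (L : Layer n) :
    (eligibleNodes isCenter L).cost ≤ 6 * n := by
  refine (tabulate_cost_le _ _).trans ?_
  simp only [read_bind_cost, step_cost, Finset.sum_const, Finset.card_univ, Fintype.card_fin,
    smul_eq_mul]
  omega

theorem visitLoop_succ {n : ℕ} (W : WMatrix n) (h rounds : ℕ) (L : Layer n) :
    visitLoop W h (rounds + 1) L = (do
      let eligible ← eligibleNodes true L
      let v ← argmaxCongestion L.congestion eligible
      match v with
      | none => pure L
      | some v => do
        let L ← visit W h v L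
        let eligible ← eligibleNodes false L
        let v ← argmaxCongestion L.congestion eligible
        let L ← match v with
          | none => pure L
          | some v => visit W h v L
        visitLoop W h rounds L) := by
  rfl

/-- Between rounds the slack is 2 for centers and 1 for the others: the visit of a center resets the
first to 1 and raises the second to 2, and the visit of a non-center does the reverse. Each round
removes one unvisited center and visits at most two nodes, which preserves `length_le`. The factor
182 is twice 80 for the visits, plus 22 for the two searches for a maximum. -/
theorem visitLoop_spec {n : ℕ} (W : WMatrix n) (h : ℕ) (center : Fin n → Bool) (rounds : ℕ) :
    ∀ L : Layer n, LoopInv W h center L → (unvisitedCenters center L).card ≤ rounds →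
      LoopInv W h center (visitLoop W h rounds L).val ∧
      unvisitedCenters center (visitLoop W h rounds L).val = ∅ ∧
      (visitLoop W h rounds L).cost ≤
        (unvisitedCenters center L).card * (182 * ((h + 1) * (n * n))) + (11 * n + 1) := by
  induction rounds with
  | zero =>
    intro L hL hr
    exact ⟨hL, Finset.card_eq_zero.1 (Nat.le_zero.1 hr), Nat.zero_le _⟩
  | succ rounds ih =>
    intro L hL hr
    have hT : (0 : ℝ) ≤ 2 * (n * (h + 1)) := by positivity
    obtain ⟨hnone, hsome, hac⟩ := argmaxCongestion_spec L.congestion (eligibleNodes true L).val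
    have hec := eligibleNodes_cost_le true L
    cases hx : (argmaxCongestion L.congestion (eligibleNodes true L).val).val with
    | none =>
      have h1 : (visitLoop W h (rounds + 1) L).val = L := by
        rw [visitLoop_succ]
        simp only [bind_val, hx]
        rfl
      have h2 : (visitLoop W h (rounds + 1) L).cost = (eligibleNodes true L).cost +
          ((argmaxCongestion L.congestion (eligibleNodes true L).val).cost + 0) := by
        rw [visitLoop_succ]
        simp only [bind_cost, hx]
        rfl
      rw [h1, h2]
      refine ⟨hL, ?_, by omega⟩
      rw [unvisitedCenters, Finset.filter_eq_empty_iff]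
      intro u _ hu
      have := hnone hx u
      rw [Bool.eq_false_iff, ne_eq, eligibleNodes_val] at this
      exact this (by simpa [hL.layer.center_eq] using hu)
    | some v =>
      obtain ⟨hev, hmax⟩ := hsome v hx
      rw [eligibleNodes_val] at hev
      simp only [if_true, hL.layer.center_eq] at hev
      obtain ⟨hV, hVc⟩ := visit_spec W h v L hev.2
      set L1 := (visit W h v L).val with hL1
      have hlay1 := hL.layer.visit hV
      have hcb1 : CongBound (2 * (n * (h + 1))) center 1 L1 :=
        hL.center_bound.visit_max le_rfl hV hev.1 fun u hKu hu => hmax u (by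
          rw [eligibleNodes_val, hL.layer.center_eq]
          exact ⟨hKu, hu⟩)
      have hob1 : CongBound (2 * (n * (h + 1))) (fun u => !center u) 2 L1 := by
        have := hL.other_bound.visit_other hV
        norm_num at this
        exact this
      have hvb1 := visited_bound_visit hL.visited_bound
        (hL.center_bound.entry_le hT le_rfl hev.1 hev.2) hV
      have hun1 := unvisitedCenters_visit center hV
      have hvmem : v ∈ unvisitedCenters center L := by
        simp [unvisitedCenters, hev.1, hev.2]
      have hcard1 : (unvisitedCenters center L1).card + 1 = (unvisitedCenters center L).card := by
        rw [hun1, Finset.card_erase_add_one hvmem]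
      have hlen1 : L1.visited.length = L.visited.length + 1 := by rw [hV.visited]; rfl
      obtain ⟨hnone', hsome', hac'⟩ :=
        argmaxCongestion_spec L1.congestion (eligibleNodes false L1).val
      have hec' := eligibleNodes_cost_le false L1
      have hll := hL.length_le
      have hn : 1 ≤ n := Fin.pos v
      have hnn : n ≤ (h + 1) * (n * n) := by
        calc n ≤ n * n := Nat.le_mul_of_pos_left n hn
          _ ≤ (h + 1) * (n * n) := Nat.le_mul_of_pos_left _ (Nat.succ_pos h)
      cases hx' : (argmaxCongestion L1.congestion (eligibleNodes false L1).val).val with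
      | none =>
        have h1 : (visitLoop W h (rounds + 1) L).val = (visitLoop W h rounds L1).val := by
          rw [visitLoop_succ]
          simp only [bind_val, hx, ← hL1, hx']
          rfl
        have h2 : (visitLoop W h (rounds + 1) L).cost = (eligibleNodes true L).cost +
            ((argmaxCongestion L.congestion (eligibleNodes true L).val).cost +
            ((visit W h v L).cost + ((eligibleNodes false L1).cost +
            ((argmaxCongestion L1.congestion (eligibleNodes false L1).val).cost + (0 +
            (visitLoop W h rounds L1).cost))))) := by
          rw [visitLoop_succ]
          simp only [bind_cost, hx, ← hL1, hx']
          rfl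
        have hinv1 : LoopInv W h center L1 := by
          refine ⟨hlay1, hcb1.mono hT (by norm_num), ?_, hvb1, by omega⟩
          intro A hA
          -- No non-center is left to visit, so the bound for this class concerns only the empty
          -- set.
          have : A = ∅ := by
            rw [Finset.eq_empty_iff_forall_notMem]
            intro u hu
            have := hnone' hx' u
            rw [Bool.eq_false_iff, ne_eq, eligibleNodes_val, hlay1.center_eq] at this
            exact this (by simpa using hA u hu)
          subst this
          simpa using hT
        obtain ⟨i1, i2, i3⟩ := ih L1 hinv1 (by omega)
        rw [h1, h2]
        refine ⟨i1, i2, ?_⟩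
        rw [← hcard1, add_mul]
        omega
      | some w =>
        obtain ⟨hew, hmaxw⟩ := hsome' w hx'
        rw [eligibleNodes_val, hlay1.center_eq] at hew
        simp only [Bool.false_eq_true, if_false] at hew
        obtain ⟨hV2, hVc2⟩ := visit_spec W h w L1 hew.2
        set L2 := (visit W h w L1).val with hL2
        have h1 : (visitLoop W h (rounds + 1) L).val = (visitLoop W h rounds L2).val := by
          rw [visitLoop_succ]
          simp only [bind_val, hx, ← hL1, hx']
          rfl
        have h2 : (visitLoop W h (rounds + 1) L).cost = (eligibleNodes true L).cost +
            ((argmaxCongestion L.congestion (eligibleNodes true L).val).cost +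
            ((visit W h v L).cost + ((eligibleNodes false L1).cost +
            ((argmaxCongestion L1.congestion (eligibleNodes false L1).val).cost +
            ((visit W h w L1).cost + (visitLoop W h rounds L2).cost))))) := by
          rw [visitLoop_succ]
          simp only [bind_cost, hx, ← hL1, hx']
          rfl
        have hun2 := unvisitedCenters_visit center hV2
        have hcard2 : (unvisitedCenters center L2).card = (unvisitedCenters center L1).card := by
          rw [hun2, Finset.erase_eq_of_notMem]
          simp only [unvisitedCenters, Finset.mem_filter, not_and]
          intro _ h
          simp [h] at hew
        have hlen2 : L2.visited.length = L1.visited.length + 1 := by rw [hV2.visited]; rfl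
        have hinv2 : LoopInv W h center L2 := by
          refine ⟨hlay1.visit hV2, ?_, ?_, ?_, by omega⟩
          · have := hcb1.visit_other hV2
            norm_num at this
            exact this
          · exact hob1.visit_max le_rfl hV2 hew.1 fun u hKu hu => hmaxw u (by
              rw [eligibleNodes_val, hlay1.center_eq]
              exact ⟨hKu, hu⟩)
          · exact visited_bound_visit hvb1 (hob1.entry_le hT le_rfl hew.1 hew.2) hV2
        obtain ⟨i1, i2, i3⟩ := ih L2 hinv2 (by omega)
        rw [h1, h2]
        refine ⟨i1, i2, ?_⟩
        rw [← hcard1, add_mul, ← hcard2]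
        omega

/-! ### Merge sort -/

theorem split_spec {α : Type} : ∀ l : List α,
    ((split l).val.1 ++ (split l).val.2).Perm l ∧
      2 * (split l).val.1.length ≤ l.length + 1 ∧ 2 * (split l).val.2.length ≤ l.length ∧
      (split l).cost ≤ l.length + 1
  | [] => by simp [split]
  | [a] => by simp [split]
  | a :: b :: l => by
    obtain ⟨h1, h2, h3, h4⟩ := split_spec l
    have hv : (split (a :: b :: l)).val = (a :: (split l).val.1, b :: (split l).val.2) := by
      simp [split]
    have hc : (split (a :: b :: l)).cost = (split l).cost + 1 := by simp [split]
    rw [hv, hc]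
    refine ⟨?_, by simp; omega, by simp; omega, by simp; omega⟩
    simp only [List.cons_append]
    exact (List.perm_middle.trans (h1.cons b)).cons a

theorem merge_spec {α : Type} : ∀ k l : List (ℝ≥0∞ × α),
    (merge k l).val.Perm (k ++ l) ∧
      (k.Pairwise (fun a b => a.1 ≤ b.1) → l.Pairwise (fun a b => a.1 ≤ b.1) →
        (merge k l).val.Pairwise (fun a b => a.1 ≤ b.1)) ∧
      (merge k l).cost ≤ 2 * (k.length + l.length) + 1
  | [], l => by
    rw [merge]
    exact ⟨by simp, fun _ h => h, by simp⟩
  | a :: k, [] => by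
    rw [merge]
    exact ⟨by simp, fun h _ => h, by simp⟩
  | a :: k, b :: l => by
    by_cases hab : a.1 ≤ b.1
    · obtain ⟨h1, h2, h3⟩ := merge_spec k (b :: l)
      have hv : (merge (a :: k) (b :: l)).val = a :: (merge k (b :: l)).val := by
        rw [merge]
        simp [hab]
      have hc : (merge (a :: k) (b :: l)).cost = 1 + ((merge k (b :: l)).cost + 1) := by
        rw [merge]
        simp [hab]
      rw [hv, hc]
      refine ⟨h1.cons a, fun hk hl => ?_, by simp at h3 ⊢; omega⟩
      rw [List.pairwise_cons] at hk ⊢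
      refine ⟨fun e he => ?_, h2 hk.2 hl⟩
      rcases List.mem_append.1 (h1.mem_iff.1 he) with he | he
      · exact hk.1 e he
      · rcases List.mem_cons.1 he with rfl | he
        · exact hab
        · exact hab.trans ((List.pairwise_cons.1 hl).1 e he)
    · obtain ⟨h1, h2, h3⟩ := merge_spec (a :: k) l
      have hv : (merge (a :: k) (b :: l)).val = b :: (merge (a :: k) l).val := by
        rw [merge]
        simp [hab]
      have hc : (merge (a :: k) (b :: l)).cost = 1 + ((merge (a :: k) l).cost + 1) := by
        rw [merge]
        simp [hab]
      rw [hv, hc]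
      refine ⟨(h1.cons b).trans List.perm_middle.symm, fun hk hl => ?_, by simp at h3 ⊢; omega⟩
      rw [List.pairwise_cons] at hl
      rw [List.pairwise_cons]
      refine ⟨fun e he => ?_, h2 hk hl.2⟩
      have hba := (not_le.1 hab).le
      rcases List.mem_append.1 (h1.mem_iff.1 he) with he | he
      · rcases List.mem_cons.1 he with rfl | he
        · exact hba
        · exact hba.trans ((List.pairwise_cons.1 hk).1 e he)
      · exact hl.1 e he
termination_by k l => k.length + l.length

theorem mergeSort_cons_cons {α : Type} (fuel : ℕ) (a b : ℝ≥0∞ × α) (l : List (ℝ≥0∞ × α)) :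
    mergeSort (fuel + 1) (a :: b :: l) =
      ⟨(merge (mergeSort fuel (split (a :: b :: l)).val.1).val
        (mergeSort fuel (split (a :: b :: l)).val.2).val).val,
      (split (a :: b :: l)).cost + ((mergeSort fuel (split (a :: b :: l)).val.1).cost +
        ((mergeSort fuel (split (a :: b :: l)).val.2).cost +
        (merge (mergeSort fuel (split (a :: b :: l)).val.1).val
          (mergeSort fuel (split (a :: b :: l)).val.2).val).cost))⟩ := rfl

theorem mergeSort_perm {α : Type} (fuel : ℕ) :
    ∀ l : List (ℝ≥0∞ × α), (mergeSort fuel l).val.Perm l := by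
  induction fuel with
  | zero => intro l; exact List.Perm.refl l
  | succ fuel ih =>
    intro l
    match l with
    | [] => exact List.Perm.refl _
    | [a] => exact List.Perm.refl _
    | a :: b :: l =>
      rw [mergeSort_cons_cons]
      exact (merge_spec _ _).1.trans (((ih _).append (ih _)).trans (split_spec _).1)

theorem mergeSort_sorted {α : Type} (fuel : ℕ) :
    ∀ l : List (ℝ≥0∞ × α), l.length ≤ fuel →
      (mergeSort fuel l).val.Pairwise (fun a b => a.1 ≤ b.1) := by
  induction fuel with
  | zero =>
    intro l hl
    rw [List.eq_nil_of_length_eq_zero (Nat.le_zero.1 hl)]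
    exact List.Pairwise.nil
  | succ fuel ih =>
    intro l hl
    match l with
    | [] => exact List.Pairwise.nil
    | [a] => exact List.pairwise_singleton _ _
    | a :: b :: l =>
      rw [mergeSort_cons_cons]
      obtain ⟨-, h2, h3, -⟩ := split_spec (a :: b :: l)
      simp only [List.length_cons] at hl h2 h3
      exact (merge_spec _ _).2.1 (ih _ (by omega)) (ih _ (by omega))

/-- With m elements, m ≥ 2, one level costs m + 1 for splitting, 2m + 1 for merging and 2 for the
additive constants of the halves, at most 5m + 1 in all; there are at most `k` levels. -/
theorem mergeSort_cost_le {α : Type} (fuel : ℕ) :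
    ∀ (l : List (ℝ≥0∞ × α)) (k : ℕ), l.length ≤ 2 ^ k →
      (mergeSort fuel l).cost ≤ 5 * (k * l.length) + 1 := by
  induction fuel with
  | zero => intro l k _; exact Nat.le_add_left 1 _
  | succ fuel ih =>
    intro l k hl
    match l with
    | [] => exact Nat.le_add_left 1 _
    | [a] => exact Nat.le_add_left 1 _
    | a :: b :: l =>
      rw [mergeSort_cons_cons]
      obtain ⟨h1, h2, h3, h4⟩ := split_spec (a :: b :: l)
      set p := (split (a :: b :: l)).val
      set m := (a :: b :: l).length with hm
      have hm2 : 2 ≤ m := by simp [hm]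
      cases k with
      | zero => simp only [pow_zero] at hl; omega
      | succ k =>
        rw [pow_succ] at hl
        have e1 := ih p.1 k (by omega)
        have e2 := ih p.2 k (by omega)
        have e3 := (merge_spec (mergeSort fuel p.1).val (mergeSort fuel p.2).val).2.2
        rw [(mergeSort_perm fuel p.1).length_eq, (mergeSort_perm fuel p.2).length_eq] at e3
        have e4 : p.1.length + p.2.length = m := by
          rw [← List.length_append, h1.length_eq]
        have e5 : k * p.1.length + k * p.2.length = k * m := by rw [← mul_add, e4]
        have e6 : (k + 1) * m = k * m + m := by ring
        show _ + (_ + (_ + _)) ≤ _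
        omega

/-! ### The preprocessing of one layer -/

/-- What is known about a layer after the preprocessing. -/
structure LayerReady {n : ℕ} (W : WMatrix n) (h : ℕ) (center : Fin n → Bool) (L : Layer n) :
    Prop where
  loop : LoopInv W h center L
  center_visited : ∀ u, center u = true → u ∈ L.visited
  sorted_perm : ∀ s t, (L.sorted.entry (s, t)).Perm
    (L.visited.map fun v => (L.through.entry (s, v, t), v))
  sorted : ∀ s t, (L.sorted.entry (s, t)).Pairwise (fun a b => a.1 ≤ b.1)

theorem harmonic_mono : Monotone harmonic := by
  refine monotone_nat_of_le_succ fun n => ?_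
  rw [harmonic_succ]
  have : (0 : ℚ) ≤ ((n : ℚ) + 1)⁻¹ := by positivity
  push_cast
  linarith

/-- All counters vanish, and the right-hand side is non-negative because a set of nodes has at most
`n` elements and harmonic numbers increase. -/
theorem loopInv_init {n : ℕ} (W : WMatrix n) (h : ℕ) (L : Layer n) (hvis : L.visited = [])
    (hiv : ∀ u, L.isVisited.entry u = false) (hcong : ∀ u, L.congestion.entry u = 0) :
    LoopInv W h L.center.entry L := by
  have hT : (0 : ℝ) ≤ 2 * (n * (h + 1)) := by positivity
  have hbound : ∀ (K : Fin n → Bool) (σ : ℝ), 0 ≤ σ →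
      CongBound (2 * (n * (h + 1))) K σ L := by
    intro K σ hσ A _
    have h1 : A.card ≤ n := (Finset.card_le_univ A).trans (by simp)
    have h2 : (harmonic A.card : ℝ) ≤ (harmonic n : ℝ) := by exact_mod_cast harmonic_mono h1
    have h3 : ∑ u ∈ A, (L.congestion.entry u : ℝ) = 0 := by simp [hcong]
    rw [h3]
    have h4 : 0 ≤ (harmonic n : ℝ) - (harmonic A.card : ℝ) := sub_nonneg.2 h2
    positivity
  refine ⟨⟨rfl, by simp [hvis], ?_, by simp [hvis], by simp [hvis]⟩, hbound _ _ (by norm_num),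
    hbound _ _ (by norm_num), fun u hu => by simp [hiv] at hu, ?_⟩
  · funext u
    simp [hiv, hvis]
  · simp [hvis, unvisitedCenters, hiv]

/-- The layer in which the preprocessing starts. -/
def emptyLayer (n : ℕ) (center : Fin n → Bool) : Layer n :=
  ⟨⟨center⟩, ⟨fun _ => false⟩, [], ⟨fun _ => 0⟩, ⟨fun _ => []⟩, ⟨fun _ => []⟩, ⟨fun _ => ⊤⟩,
    ⟨fun _ => []⟩⟩

theorem newLayer_cost (n : ℕ) :
    (newLayer n).cost = 3 * n + 3 * (n * n) + n * n * n := by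
  have : (newLayer n).cost = Fintype.card (Fin n) + (Fintype.card (Fin n) + (Fintype.card (Fin n) +
    (Fintype.card (Fin n × Fin n) + (Fintype.card (Fin n × Fin n) +
      (Fintype.card (Fin n × Fin n × Fin n) + (Fintype.card (Fin n × Fin n) + 0)))))) := rfl
  rw [this]
  simp only [Fintype.card_prod, Fintype.card_fin]
  ring

/-- The unsorted list of the values `δ (s, v, t)`. -/
def valueList {n : ℕ} (L : Layer n) (s t : Fin n) : Timed (List (ℝ≥0∞ × Fin n)) :=
  forEach L.visited [] fun v l => do
    let d ← L.through.read (s, v, t)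
    step ((d, v) :: l)

theorem valueList_val {n : ℕ} (L : Layer n) (s t : Fin n) :
    (valueList L s t).val.Perm (L.visited.map fun v => (L.through.entry (s, v, t), v)) := by
  refine forEach_val_spec (l := L.visited) (init := []) (body := fun v l => do
    let d ← L.through.read (s, v, t)
    step ((d, v) :: l)) (fun pre l =>
      l.Perm (pre.map fun v => (L.through.entry (s, v, t), v))) (by simp) ?_
  intro pre v post l _ hl
  simp only [read_bind_val, step_val, List.map_append, List.map_cons, List.map_nil]
  exact (hl.cons _).trans (List.perm_append_singleton _ _).symm

theorem valueList_cost_le {n : ℕ} (L : Layer n) (s t : Fin n) :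
    (valueList L s t).cost ≤ L.visited.length * 3 :=
  forEach_cost_le (l := L.visited) 2 (by simp)

/-- The loop that sorts the values for all pairs of nodes. -/
def sortLoop {n : ℕ} (L : Layer n) : Timed (Arr (Fin n × Fin n) (List (ℝ≥0∞ × Fin n))) :=
  forEach (nodes n) L.sorted fun s a =>
    forEach (nodes n) a fun t a => do
      let l ← valueList L s t
      let l ← mergeSort n l
      a.write (s, t) l

theorem unvisitedCenters_card_le {n : ℕ} (center : Fin n → Bool) (L : Layer n) :
    (unvisitedCenters center L).card ≤ (Finset.univ.filter fun u => center u = true).card :=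
  Finset.card_le_card fun u hu => by
    simp only [unvisitedCenters, Finset.mem_filter, Finset.mem_univ, true_and] at hu ⊢
    exact hu.1

theorem LoopInv.visited_length_le {n : ℕ} {W : WMatrix n} {h : ℕ} {center : Fin n → Bool}
    {L : Layer n} (hL : LoopInv W h center L) :
    L.visited.length ≤ 2 * (Finset.univ.filter fun u => center u = true).card := by
  have := hL.length_le
  omega

theorem LoopInv.visited_length_le_n {n : ℕ} {W : WMatrix n} {h : ℕ} {center : Fin n → Bool}
    {L : Layer n} (hL : LoopInv W h center L) : L.visited.length ≤ n := by
  have := hL.layer.nodup.length_le_card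
  simpa using this

/-- All costs except 30n³ + 2 are proportional to the number of centers, as at most twice as many
nodes are visited. This leaves the number of centers as the only random quantity in the time for
preprocessing. -/
theorem preprocessLayer_spec {n : ℕ} (W : WMatrix n) (coin : Fin n → Bool) (i : ℕ) :
    LayerReady W (2 ^ i) coin (preprocessLayer W coin i).val ∧
    (preprocessLayer W coin i).cost ≤
      (Finset.univ.filter fun u => coin u = true).card *
        (182 * ((2 ^ i + 1) * (n * n)) + n * n * (10 * topLayer n + 6)) +
        30 * (n * n * n) + 2 := by
  set center := (forEach (nodes n) (⟨fun _ => false⟩ : Arr (Fin n) Bool) fun v a => do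
        let b ← step (coin v)
        a.write v b) with hcenter
  have hcv : center.val.entry = coin := by
    funext v
    exact (forEach_write_val (l := nodes n) ⟨fun _ => false⟩ id Function.injective_id
      (fun v => step (coin v)) (fun v a => do
        let b ← step (coin v)
        a.write v b) (fun _ _ => rfl)).1 v (mem_nodes v)
  have hcc : center.cost ≤ n * (2 + 1) := by
    have := forEach_cost_le (l := nodes n) (init := (⟨fun _ => false⟩ : Arr (Fin n) Bool))
      (body := fun v a => do
        let b ← step (coin v)
        a.write v b) 2 (by simp)
    rw [length_nodes] at this
    exact this
  set L0 : Layer n := emptyLayer n center.val.entry with hL0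
  set loop := visitLoop W (2 ^ i) n L0 with hloop
  have hval : (preprocessLayer W coin i).val = { loop.val with sorted := (sortLoop loop.val).val } :=
    rfl
  have hcost : (preprocessLayer W coin i).cost = (newLayer n).cost + (center.cost + (1 +
      (loop.cost + ((sortLoop loop.val).cost + 0)))) := rfl
  have hinit : LoopInv W (2 ^ i) coin L0 := by
    have := loopInv_init W (2 ^ i) L0 rfl (fun _ => rfl) (fun _ => rfl)
    rwa [show L0.center.entry = coin from hcv] at this
  have hun := unvisitedCenters_card_le coin L0
  obtain ⟨l1, l2, l3⟩ := visitLoop_spec W (2 ^ i) coin n L0 hinit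
    (hun.trans ((Finset.card_le_univ _).trans (by simp)))
  rw [← hloop] at l1 l2 l3
  have hsorted : ∀ s t, (sortLoop loop.val).val.entry (s, t) =
      (mergeSort n (valueList loop.val s t).val).val :=
    (forEach_forEach_write_val loop.val.sorted (fun s t => (s, t)) (by simp)
      (fun s t => mergeSort n (valueList loop.val s t).val) (fun s t a => do
        let l ← valueList loop.val s t
        let l ← mergeSort n l
        a.write (s, t) l) (fun _ _ _ => rfl)).1
  have hlen := l1.visited_length_le
  have hlenn := l1.visited_length_le_n
  set C := (Finset.univ.filter fun u => coin u = true).card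
  constructor
  · rw [hval]
    refine ⟨⟨⟨l1.layer.center_eq, l1.layer.nodup, l1.layer.isVisited_eq, l1.layer.data,
      l1.layer.hits_le⟩, l1.center_bound, l1.other_bound, l1.visited_bound, l1.length_le⟩, ?_, ?_, ?_⟩
    · intro u hu
      have : u ∉ unvisitedCenters coin loop.val := by simp [l2]
      simp only [unvisitedCenters, Finset.mem_filter, Finset.mem_univ, true_and, hu,
        l1.layer.isVisited_eq] at this
      simpa using this
    · intro s t
      show ((sortLoop loop.val).val.entry (s, t)).Perm _
      rw [hsorted]
      exact (mergeSort_perm _ _).trans (valueList_val _ _ _)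
    · intro s t
      show ((sortLoop loop.val).val.entry (s, t)).Pairwise _
      rw [hsorted]
      refine mergeSort_sorted _ _ ?_
      rw [(valueList_val _ _ _).length_eq, List.length_map]
      exact hlenn
  · rw [hcost, newLayer_cost]
    have hbody : ∀ s t a, (do
        let l ← valueList loop.val s t
        let l ← mergeSort n l
        (a : Arr (Fin n × Fin n) (List (ℝ≥0∞ × Fin n))).write (s, t) l).cost ≤
          C * (10 * topLayer n + 6) + 2 := by
      intro s t a
      simp only [bind_cost, write_cost]
      have h1 := valueList_cost_le loop.val s t
      have hl : (valueList loop.val s t).val.length = loop.val.visited.length := by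
        rw [(valueList_val _ _ _).length_eq, List.length_map]
      -- A list has at most one entry per node, so ⌈log₂ n⌉ levels of recursion suffice.
      have h2 := mergeSort_cost_le n (valueList loop.val s t).val (topLayer n)
        (by rw [hl]; exact hlenn.trans (Nat.le_pow_clog (by norm_num) n))
      rw [hl] at h2
      have h3 : topLayer n * loop.val.visited.length ≤ topLayer n * (2 * C) :=
        Nat.mul_le_mul_left _ hlen
      nlinarith
    have hsort : (sortLoop loop.val).cost ≤ n * (n * (C * (10 * topLayer n + 6) + 2 + 1) + 1) :=
      forEach_forEach_cost_le loop.val.sorted (fun s t a => do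
        let l ← valueList loop.val s t
        let l ← mergeSort n l
        a.write (s, t) l) _ hbody
    have hl3 : loop.cost ≤ C * (182 * ((2 ^ i + 1) * (n * n))) + (11 * n + 1) :=
      l3.trans (Nat.add_le_add_right (Nat.mul_le_mul_right _ hun) _)
    have hn3 : n ≤ n * n * n := by
      rcases Nat.eq_zero_or_pos n with h | h
      · simp [h]
      · exact Nat.le_mul_of_pos_left n (Nat.mul_pos h h)
    have hn2 : n * n ≤ n * n * n := by
      rcases Nat.eq_zero_or_pos n with h | h
      · simp [h]
      · exact Nat.le_mul_of_pos_right _ h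
    nlinarith

/-! ### The repair of a layer -/

theorem lowerTo_entry {ι : Type} [DecidableEq ι] (a : Arr ι ℝ≥0∞) (e : ι) (d : ℝ≥0∞) (i : ι) :
    (lowerTo a e d).val.entry i = if i = e then min (a.entry e) d else a.entry i := by
  simp only [lowerTo, read_bind_val, step_bind_val, ite_val, write_val, pure_val]
  by_cases h : d < a.entry e
  · rw [if_pos (by simpa using h), min_eq_right h.le]
    simp only [Function.update_apply]
  · rw [if_neg (by simpa using h), min_eq_left (not_lt.1 h)]
    split_ifs with hi
    · rw [hi]
    · rfl

theorem lowerTo_cost_le {ι : Type} [DecidableEq ι] (a : Arr ι ℝ≥0∞) (e : ι) (d : ℝ≥0∞) :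
    (lowerTo a e d).cost ≤ 3 := by
  simp only [lowerTo, read_bind_cost, step_bind_cost, ite_cost, write_cost, pure_cost]
  split_ifs <;> omega

theorem lowerTo_le {ι : Type} [DecidableEq ι] (a : Arr ι ℝ≥0∞) (e : ι) (d : ℝ≥0∞) (i : ι) :
    (lowerTo a e d).val.entry i ≤ a.entry i := by
  rw [lowerTo_entry]
  split_ifs with h
  · rw [h]; exact min_le_left _ _
  · exact le_rfl

theorem lowerTo_self_le {ι : Type} [DecidableEq ι] (a : Arr ι ℝ≥0∞) (e : ι) (d : ℝ≥0∞) :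
    (lowerTo a e d).val.entry e ≤ d := by
  rw [lowerTo_entry, if_pos rfl]
  exact min_le_right _ _

theorem le_lowerTo {ι : Type} [DecidableEq ι] (a : Arr ι ℝ≥0∞) (e : ι) (d : ℝ≥0∞) (i : ι)
    {b : ℝ≥0∞} (h1 : b ≤ a.entry i) (h2 : i = e → b ≤ d) : b ≤ (lowerTo a e d).val.entry i := by
  rw [lowerTo_entry]
  split_ifs with h
  · exact le_min (h ▸ h1) (h2 h)
  · exact h1

/-- The loop that records the recomputed values for one visited node. -/
def changedLoop {n : ℕ} (U : Arr (Fin n) Bool) (distFrom distTo : Arr (Fin n) ℝ≥0∞)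
    (m : WMatrix n) : Timed (WMatrix n) :=
  forEach (nodes n) m fun x m => do
    let a ← U.read x
    if a then
      forEach (nodes n) m fun y m => do
        let dx ← distTo.read x
        let dy ← distFrom.read y
        let d ← step (dx + dy)
        let m ← lowerTo m (x, y) d
        let dy ← distTo.read y
        let dx ← distFrom.read x
        let d ← step (dy + dx)
        lowerTo m (y, x) d
    else pure m

/-- The inner loop of `changedLoop`. -/
def changedRow {n : ℕ} (distFrom distTo : Arr (Fin n) ℝ≥0∞) (x : Fin n) (m : WMatrix n) :
    Timed (WMatrix n) :=
  forEach (nodes n) m fun y m => do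
    let dx ← distTo.read x
    let dy ← distFrom.read y
    let d ← step (dx + dy)
    let m ← lowerTo m (x, y) d
    let dy ← distTo.read y
    let dx ← distFrom.read x
    let d ← step (dy + dx)
    lowerTo m (y, x) d

/-- The second and the third clause bound the new entries from above and from below; the pair serves
as a description of a minimum that is easily carried through nested loops. -/
theorem changedRow_spec {n : ℕ} (distFrom distTo : Arr (Fin n) ℝ≥0∞) (x : Fin n)
    (m : WMatrix n) :
    (∀ s t, (changedRow distFrom distTo x m).val.entry (s, t) ≤ m.entry (s, t)) ∧
    (∀ y, (changedRow distFrom distTo x m).val.entry (x, y) ≤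
        distTo.entry x + distFrom.entry y ∧
      (changedRow distFrom distTo x m).val.entry (y, x) ≤ distTo.entry y + distFrom.entry x) ∧
    (∀ s t d, d ≤ m.entry (s, t) → (s = x ∨ t = x → d ≤ distTo.entry s + distFrom.entry t) →
      d ≤ (changedRow distFrom distTo x m).val.entry (s, t)) ∧
    (changedRow distFrom distTo x m).cost ≤ n * 13 := by
  have key := forEach_val_spec (l := nodes n) (init := m) (body := fun y m => do
    let dx ← distTo.read x
    let dy ← distFrom.read y
    let d ← step (dx + dy)
    let m ← lowerTo m (x, y) d
    let dy ← distTo.read y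
    let dx ← distFrom.read x
    let d ← step (dy + dx)
    lowerTo m (y, x) d)
    (fun pre m' => (∀ s t, m'.entry (s, t) ≤ m.entry (s, t)) ∧
      (∀ y ∈ pre, m'.entry (x, y) ≤ distTo.entry x + distFrom.entry y ∧
        m'.entry (y, x) ≤ distTo.entry y + distFrom.entry x) ∧
      (∀ s t d, d ≤ m.entry (s, t) → (s = x ∨ t = x → d ≤ distTo.entry s + distFrom.entry t) →
        d ≤ m'.entry (s, t)))
    ⟨fun _ _ => le_rfl, by simp, fun _ _ _ h _ => h⟩ (by
      intro pre y post m' _ ⟨h1, h2, h3⟩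
      simp only [bind_val, read_val, step_val]
      have hle : ∀ i, (lowerTo (lowerTo m' (x, y) (distTo.entry x + distFrom.entry y)).val (y, x)
          (distTo.entry y + distFrom.entry x)).val.entry i ≤ m'.entry i := fun i =>
        (lowerTo_le _ _ _ i).trans (lowerTo_le _ _ _ i)
      refine ⟨fun s t => (hle _).trans (h1 s t), ?_, ?_⟩
      · intro z hz
        rcases List.mem_append.1 hz with hz | hz
        · exact ⟨(hle _).trans (h2 z hz).1, (hle _).trans (h2 z hz).2⟩
        · rw [List.mem_singleton.1 hz]
          exact ⟨(lowerTo_le _ _ _ _).trans (lowerTo_self_le _ _ _), lowerTo_self_le _ _ _⟩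
      · intro s t d hd hst
        refine le_lowerTo _ _ _ _ (le_lowerTo _ _ _ _ (h3 s t d hd hst) ?_) ?_
        · intro h
          obtain ⟨rfl, rfl⟩ := Prod.mk.inj h
          exact hst (Or.inl rfl)
        · intro h
          obtain ⟨rfl, rfl⟩ := Prod.mk.inj h
          exact hst (Or.inr rfl))
  refine ⟨key.1, fun y => key.2.1 y (mem_nodes y), key.2.2, ?_⟩
  have := forEach_cost_le (l := nodes n) (init := m) (body := fun y m => do
    let dx ← distTo.read x
    let dy ← distFrom.read y
    let d ← step (dx + dy)
    let m ← lowerTo m (x, y) d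
    let dy ← distTo.read y
    let dx ← distFrom.read x
    let d ← step (dy + dx)
    lowerTo m (y, x) d) 12 (by
      intro y _ m
      simp only [bind_cost, read_cost, read_val, step_cost, step_val]
      have h1 := lowerTo_cost_le m (x, y) (distTo.entry x + distFrom.entry y)
      have h2 := lowerTo_cost_le (lowerTo m (x, y) (distTo.entry x + distFrom.entry y)).val (y, x)
        (distTo.entry y + distFrom.entry x)
      omega)
  rw [length_nodes] at this
  exact this

theorem changedLoop_spec {n : ℕ} (U : Arr (Fin n) Bool) (distFrom distTo : Arr (Fin n) ℝ≥0∞)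
    (m : WMatrix n) :
    (∀ s t, (changedLoop U distFrom distTo m).val.entry (s, t) ≤ m.entry (s, t)) ∧
    (∀ s t, U.entry s = true ∨ U.entry t = true →
      (changedLoop U distFrom distTo m).val.entry (s, t) ≤ distTo.entry s + distFrom.entry t) ∧
    (∀ s t d, d ≤ m.entry (s, t) →
      (U.entry s = true ∨ U.entry t = true → d ≤ distTo.entry s + distFrom.entry t) →
      d ≤ (changedLoop U distFrom distTo m).val.entry (s, t)) ∧
    (changedLoop U distFrom distTo m).cost ≤ ∑ x, (2 + if U.entry x then n * 13 else 0) := by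
  set body : Fin n → WMatrix n → Timed (WMatrix n) := fun x m => do
    let a ← U.read x
    if a then changedRow distFrom distTo x m else pure m with hbody
  have heq : changedLoop U distFrom distTo m = forEach (nodes n) m body := rfl
  rw [heq]
  have key := forEach_val_spec (l := nodes n) (init := m) (body := body)
    (fun pre m' => (∀ s t, m'.entry (s, t) ≤ m.entry (s, t)) ∧
      (∀ x ∈ pre, U.entry x = true → ∀ y,
        m'.entry (x, y) ≤ distTo.entry x + distFrom.entry y ∧
        m'.entry (y, x) ≤ distTo.entry y + distFrom.entry x) ∧
      (∀ s t d, d ≤ m.entry (s, t) →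
        (U.entry s = true ∨ U.entry t = true → d ≤ distTo.entry s + distFrom.entry t) →
        d ≤ m'.entry (s, t)))
    ⟨fun _ _ => le_rfl, by simp, fun _ _ _ h _ => h⟩ (by
      intro pre x post m' _ ⟨h1, h2, h3⟩
      cases hU : U.entry x with
      | false =>
        simp only [hbody, read_bind_val, hU, Bool.false_eq_true, if_false, pure_val]
        refine ⟨h1, ?_, h3⟩
        intro z hz hUz
        rcases List.mem_append.1 hz with hz | hz
        · exact h2 z hz hUz
        · rw [List.mem_singleton.1 hz, hU] at hUz
          exact absurd hUz (by simp)
      | true =>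
        simp only [hbody, read_bind_val, hU, if_true]
        obtain ⟨r1, r2, r3, -⟩ := changedRow_spec distFrom distTo x m'
        refine ⟨fun s t => (r1 s t).trans (h1 s t), ?_, ?_⟩
        · intro z hz hUz y
          rcases List.mem_append.1 hz with hz | hz
          · exact ⟨(r1 _ _).trans (h2 z hz hUz y).1, (r1 _ _).trans (h2 z hz hUz y).2⟩
          · rw [List.mem_singleton.1 hz]
            exact r2 y
        · intro s t d hd hst
          refine r3 s t d (h3 s t d hd hst) fun h => hst ?_
          rcases h with rfl | rfl
          · exact Or.inl hU
          · exact Or.inr hU)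
  refine ⟨key.1, fun s t hst => ?_, key.2.2, ?_⟩
  · rcases hst with h | h
    · exact (key.2.1 s (mem_nodes s) h t).1
    · exact (key.2.1 t (mem_nodes t) h s).2
  · have := forEach_cost_le_sum (l := nodes n) (init := m) (body := body)
      (fun x => 1 + if U.entry x then n * 13 else 0) (fun _ => True) trivial
      (fun _ _ _ _ => trivial) (by
        intro x _ m' _
        simp only [hbody, read_bind_cost, ite_cost, pure_cost]
        have := (changedRow_spec distFrom distTo x m').2.2.2
        split_ifs <;> omega)
    rw [sum_map_nodes] at this
    refine this.trans (Finset.sum_le_sum fun x _ => by omega)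

theorem firstUnchanged_cons {n : ℕ} (U : Arr (Fin n) (Arr (Fin n) Bool)) (s t : Fin n)
    (e : ℝ≥0∞ × Fin n) (l : List (ℝ≥0∞ × Fin n)) :
    (firstUnchanged U s t (e :: l)).val =
      (if (U.entry e.2).entry s = true ∨ (U.entry e.2).entry t = true
        then (firstUnchanged U s t l).val else e.1) ∧
    (firstUnchanged U s t (e :: l)).cost ≤ 4 +
      if (U.entry e.2).entry s = true ∨ (U.entry e.2).entry t = true
        then (firstUnchanged U s t l).cost else 1 := by
  simp only [firstUnchanged, read_bind_val, read_bind_cost, step_bind_val, step_bind_cost, ite_val,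
    ite_cost, step_val, step_cost, Bool.or_eq_true]
  refine ⟨trivial, ?_⟩
  omega

/-- Sortedness makes the first unchanged entry the smallest one. Every skipped entry belongs to a
visited node for which `s` or `t` is affected, so the 4 operations of skipping are charged to that
affected node; the 5 pay for the entry at which the search stops. -/
theorem firstUnchanged_spec {n : ℕ} (U : Arr (Fin n) (Arr (Fin n) Bool)) (s t : Fin n)
    (l : List (ℝ≥0∞ × Fin n)) :
    (l.Pairwise (fun a b => a.1 ≤ b.1) → ∀ e ∈ l, (U.entry e.2).entry s = false →
      (U.entry e.2).entry t = false → (firstUnchanged U s t l).val ≤ e.1) ∧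
    (∀ d, (∀ e ∈ l, (U.entry e.2).entry s = false → (U.entry e.2).entry t = false → d ≤ e.1) →
      d ≤ (firstUnchanged U s t l).val) ∧
    (firstUnchanged U s t l).cost ≤ 5 + (l.map fun e =>
      (if (U.entry e.2).entry s then 4 else 0) + if (U.entry e.2).entry t then 4 else 0).sum := by
  induction l with
  | nil => simp [firstUnchanged]
  | cons e l ih =>
    obtain ⟨h1, h2, h3⟩ := ih
    obtain ⟨hv, hc⟩ := firstUnchanged_cons U s t e l
    rw [hv, List.map_cons, List.sum_cons]
    by_cases hch : (U.entry e.2).entry s = true ∨ (U.entry e.2).entry t = true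
    · rw [if_pos hch] at hc ⊢
      refine ⟨fun hs e' he' hs' ht' => ?_, fun d hd => ?_, ?_⟩
      · rcases List.mem_cons.1 he' with rfl | he'
        · rcases hch with h | h
          · simp [h] at hs'
          · simp [h] at ht'
        · exact h1 (List.pairwise_cons.1 hs).2 e' he' hs' ht'
      · exact h2 d fun e' he' => hd e' (List.mem_cons_of_mem _ he')
      · rcases hch with h | h
        · rw [if_pos h]; omega
        · rw [if_pos h]; omega
    · rw [if_neg hch] at hc ⊢
      obtain ⟨hc1, hc2⟩ := not_or.1 hch
      refine ⟨fun hs e' he' _ _ => ?_, fun d hd => ?_, by omega⟩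
      · rcases List.mem_cons.1 he' with rfl | he'
        · exact le_rfl
        · exact (List.pairwise_cons.1 hs).1 e' he'
      · exact hd e (by simp) (by simpa using hc1) (by simpa using hc2)

/-- The distances from and to `v` in the sketch graph. -/
def sketchDist {n : ℕ} (W : WMatrix n) (L : Layer n) (D : Arr (Fin n) Bool) (v : Fin n) :
    Arr (Fin n) ℝ≥0∞ × Arr (Fin n) ℝ≥0∞ :=
  let H := (sketchGraph W L D v (affectedNodes L D v).val).val
  ((dijkstra H.out v).val, (dijkstra H.inc v).val)

/-- The part of `repairLayer` for one visited node. -/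
def repairVisit {n : ℕ} (W : WMatrix n) (L : Layer n) (D : Arr (Fin n) Bool) (v : Fin n)
    (r : Arr (Fin n) (Arr (Fin n) Bool) × WMatrix n) :
    Timed (Arr (Fin n) (Arr (Fin n) Bool) × WMatrix n) := do
  let U ← affectedNodes L D v
  let H ← sketchGraph W L D v U
  let distFrom ← dijkstra H.out v
  let distTo ← dijkstra H.inc v
  let changed ← changedLoop U distFrom distTo r.2
  let affected ← r.1.write v U
  pure (affected, changed)

/-- The last part of `repairLayer`. -/
def repairCombine {n : ℕ} (L : Layer n) (r : Arr (Fin n) (Arr (Fin n) Bool) × WMatrix n) :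
    Timed (WMatrix n) :=
  tabulate₂ ⊤ fun s t => do
    let d ← r.2.read (s, t)
    let l ← L.sorted.read (s, t)
    let d' ← firstUnchanged r.1 s t l
    step (min d d')

/-- The loop of `repairLayer` over the visited nodes. -/
def repairLoop {n : ℕ} (W : WMatrix n) (L : Layer n) (D : Arr (Fin n) Bool) :
    Timed (Arr (Fin n) (Arr (Fin n) Bool) × WMatrix n) :=
  forEach L.visited ((⟨fun _ => ⟨fun _ => false⟩⟩, ⟨fun _ => ⊤⟩) :
    Arr (Fin n) (Arr (Fin n) Bool) × WMatrix n) fun v r => repairVisit W L D v r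

theorem repairLayer_val {n : ℕ} (W : WMatrix n) (L : Layer n) (D : Arr (Fin n) Bool) :
    (repairLayer W L D).val = (repairCombine L (repairLoop W L D).val).val := rfl

theorem repairLayer_cost {n : ℕ} (W : WMatrix n) (L : Layer n) (D : Arr (Fin n) Bool) :
    (repairLayer W L D).cost = Fintype.card (Fin n) + (Fintype.card (Fin n) +
      (Fintype.card (Fin n × Fin n) + ((repairLoop W L D).cost +
        (repairCombine L (repairLoop W L D).val).cost))) := rfl

/-- The number of affected nodes of a visited node. -/
def affectedCard {n : ℕ} (L : Layer n) (D : Arr (Fin n) Bool) (v : Fin n) : ℕ :=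
  (Finset.univ.filter fun x => (affectedNodes L D v).val.entry x = true).card

theorem sum_ite_affected {n : ℕ} (L : Layer n) (D : Arr (Fin n) Bool) (v : Fin n) (a : ℕ) :
    ∑ x, (if (affectedNodes L D v).val.entry x then a else 0) = affectedCard L D v * a := by
  rw [← Finset.sum_filter, Finset.sum_const, smul_eq_mul, affectedCard]

theorem repairVisit_cost_le {n : ℕ} (W : WMatrix n) (L : Layer n) (D : Arr (Fin n) Bool)
    (v : Fin n) (h : ℕ) (hpf : ∀ x, (L.pathFrom.entry (v, x)).length ≤ h + 1)
    (hpt : ∀ x, (L.pathTo.entry (v, x)).length ≤ h + 1)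
    (r : Arr (Fin n) (Arr (Fin n) Bool) × WMatrix n) :
    (repairVisit W L D v r).cost ≤
      12 * (n * (h + 1)) + 110 * (n * blockSize n) + 70 * (n * affectedCard L D v) := by
  set U := (affectedNodes L D v).val with hU
  set H := (sketchGraph W L D v U).val with hH
  have hc : (repairVisit W L D v r).cost = (affectedNodes L D v).cost +
      ((sketchGraph W L D v U).cost + ((dijkstra H.out v).cost + ((dijkstra H.inc v).cost +
      ((changedLoop U (dijkstra H.out v).val (dijkstra H.inc v).val r.2).cost + (1 + 0))))) := rfl
  rw [hc]
  have h1 := affectedNodes_cost_le L D v h hpf hpt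
  obtain ⟨h2, -, h3⟩ := sketchGraph_spec W L D v U
  rw [← hH] at h2
  have h4 := (dijkstra_spec H.out v).2.2
  have h5 := (dijkstra_spec H.inc v).2.2
  have h6 := (changedLoop_spec U (dijkstra H.out v).val (dijkstra H.inc v).val r.2).2.2.2
  have e1 : ∑ y, (20 + if U.entry y then 17 * n else 0) =
      n * 20 + affectedCard L D v * (17 * n) := by
    rw [Finset.sum_add_distrib, sum_ite_affected]; simp
  have e2 : ∑ y, (2 + if U.entry y then n * 13 else 0) =
      n * 2 + affectedCard L D v * (n * 13) := by
    rw [Finset.sum_add_distrib, sum_ite_affected]; simp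
  have e3 : ∑ y, (if U.entry y then 2 * n else 2) ≤ n * 2 + affectedCard L D v * (2 * n) := by
    have : ∑ y, (if U.entry y then 2 * n else 2) ≤
        ∑ y, (2 + if U.entry y then 2 * n else 0) :=
      Finset.sum_le_sum fun y _ => by split_ifs <;> omega
    rw [Finset.sum_add_distrib, sum_ite_affected] at this
    simpa using this
  rw [e1] at h3
  rw [e2] at h6
  have h7 := h2.out_card.trans e3
  have h8 := h2.inc_card.trans e3
  have hn : 1 ≤ n := Fin.pos v
  have hB : n ≤ n * blockSize n := Nat.le_mul_of_pos_right n (Nat.succ_pos _)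
  have e4 : affectedCard L D v * (2 * n) = 2 * (n * affectedCard L D v) := by ring
  have e5 : affectedCard L D v * (17 * n) = 17 * (n * affectedCard L D v) := by ring
  have e6 : affectedCard L D v * (n * 13) = 13 * (n * affectedCard L D v) := by ring
  rw [e4] at h7 h8
  rw [e5] at h3
  rw [e6] at h6
  omega

/-- The value of a visited node for a pair of nodes after the deletion. -/
def repairedThrough {n : ℕ} (W : WMatrix n) (L : Layer n) (D : Arr (Fin n) Bool) (s v t : Fin n) :
    ℝ≥0∞ :=
  if (affectedNodes L D v).val.entry s = true ∨ (affectedNodes L D v).val.entry t = true then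
    (sketchDist W L D v).2.entry s + (sketchDist W L D v).1.entry t
  else L.through.entry (s, v, t)

/-- The matrix holds the minimum of the recomputed values only, phrased as an upper and a lower
bound; the unchanged values come from the sorted lists. -/
theorem repairLoop_spec {n : ℕ} (W : WMatrix n) (L : Layer n) (D : Arr (Fin n) Bool) :
    (∀ v ∈ L.visited, (repairLoop W L D).val.1.entry v = (affectedNodes L D v).val) ∧
    (∀ s t, ∀ v ∈ L.visited, ((affectedNodes L D v).val.entry s = true ∨
      (affectedNodes L D v).val.entry t = true) →
      (repairLoop W L D).val.2.entry (s, t) ≤ repairedThrough W L D s v t) ∧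
    (∀ s t d, (∀ v ∈ L.visited, ((affectedNodes L D v).val.entry s = true ∨
      (affectedNodes L D v).val.entry t = true) → d ≤ repairedThrough W L D s v t) →
      d ≤ (repairLoop W L D).val.2.entry (s, t)) := by
  refine forEach_val_spec (l := L.visited) (init := ((⟨fun _ => ⟨fun _ => false⟩⟩, ⟨fun _ => ⊤⟩) :
    Arr (Fin n) (Arr (Fin n) Bool) × WMatrix n)) (body := fun v r => repairVisit W L D v r)
    (fun pre r => (∀ v ∈ pre, r.1.entry v = (affectedNodes L D v).val) ∧
    (∀ s t, ∀ v ∈ pre, ((affectedNodes L D v).val.entry s = true ∨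
      (affectedNodes L D v).val.entry t = true) →
      r.2.entry (s, t) ≤ repairedThrough W L D s v t) ∧
    (∀ s t d, (∀ v ∈ pre, ((affectedNodes L D v).val.entry s = true ∨
      (affectedNodes L D v).val.entry t = true) → d ≤ repairedThrough W L D s v t) →
      d ≤ r.2.entry (s, t))) (by simp) ?_
  intro pre v post r _ ⟨h1, h2, h3⟩
  set U := (affectedNodes L D v).val with hU
  have hv : (repairVisit W L D v r).val = (⟨Function.update r.1.entry v U⟩,
    (changedLoop U (sketchDist W L D v).1 (sketchDist W L D v).2 r.2).val) := rfl
  obtain ⟨c1, c2, c3, -⟩ := changedLoop_spec U (sketchDist W L D v).1 (sketchDist W L D v).2 r.2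
  rw [hv]
  refine ⟨?_, ?_, ?_⟩
  · intro w hw
    by_cases hwv : w = v
    · subst hwv; simp [hU]
    · simp only [Function.update_of_ne hwv]
      exact h1 w (by simpa [hwv] using hw)
  · intro s t w hw hst
    rcases List.mem_append.1 hw with hw | hw
    · exact (c1 s t).trans (h2 s t w hw hst)
    · rw [List.mem_singleton.1 hw] at hst ⊢
      rw [repairedThrough, if_pos hst]
      exact c2 s t hst
  · intro s t d hd
    refine c3 s t d (h3 s t d fun w hw => hd w (List.mem_append_left _ hw)) fun hst => ?_
    have := hd v (by simp) hst
    rwa [repairedThrough, if_pos hst] at this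

theorem repairCombine_entry {n : ℕ} (L : Layer n)
    (r : Arr (Fin n) (Arr (Fin n) Bool) × WMatrix n) (s t : Fin n) :
    (repairCombine L r).val.entry (s, t) =
      min (r.2.entry (s, t)) (firstUnchanged r.1 s t (L.sorted.entry (s, t))).val := by
  rw [repairCombine, tabulate₂_val]
  rfl

theorem LayerReady.repair_le {n : ℕ} {W : WMatrix n} {h : ℕ} {center : Fin n → Bool} {L : Layer n}
    (hL : LayerReady W h center L) (D : Arr (Fin n) Bool) (s t : Fin n) {v : Fin n}
    (hv : v ∈ L.visited) :
    (repairLayer W L D).val.entry (s, t) ≤ repairedThrough W L D s v t := by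
  obtain ⟨h1, h2, h3⟩ := repairLoop_spec W L D
  rw [repairLayer_val, repairCombine_entry]
  by_cases hst : (affectedNodes L D v).val.entry s = true ∨ (affectedNodes L D v).val.entry t = true
  · exact (min_le_left _ _).trans (h2 s t v hv hst)
  · refine (min_le_right _ _).trans ?_
    obtain ⟨hs, ht⟩ := not_or.1 hst
    rw [repairedThrough, if_neg hst]
    refine (firstUnchanged_spec _ s t _).1 (hL.sorted s t) (L.through.entry (s, v, t), v) ?_ ?_ ?_
    · exact (hL.sorted_perm s t).mem_iff.2 (List.mem_map.2 ⟨v, hv, rfl⟩)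
    · rw [h1 v hv]; simpa using hs
    · rw [h1 v hv]; simpa using ht

theorem LayerReady.le_repair {n : ℕ} {W : WMatrix n} {h : ℕ} {center : Fin n → Bool} {L : Layer n}
    (hL : LayerReady W h center L) (D : Arr (Fin n) Bool) (s t : Fin n) {d : ℝ≥0∞}
    (hd : ∀ v ∈ L.visited, d ≤ repairedThrough W L D s v t) :
    d ≤ (repairLayer W L D).val.entry (s, t) := by
  obtain ⟨h1, h2, h3⟩ := repairLoop_spec W L D
  rw [repairLayer_val, repairCombine_entry]
  refine le_min (h3 s t d fun v hv _ => hd v hv) ?_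
  refine (firstUnchanged_spec _ s t _).2.1 d fun e he hs ht => ?_
  obtain ⟨v, hv, rfl⟩ := List.mem_map.1 ((hL.sorted_perm s t).mem_iff.1 he)
  rw [h1 v hv] at hs ht
  have := hd v hv
  rwa [repairedThrough, if_neg (by simp [hs, ht])] at this

/-- A recomputed value is bounded below because the distances of G∖D are potentials for the lists of
the sketch graph, an unchanged one because its paths avoid `D`. -/
theorem LayerReady.mdist_le_repair {n : ℕ} {W : WMatrix n} {h : ℕ} {center : Fin n → Bool}
    {L : Layer n} (hL : LayerReady W h center L) (D : Arr (Fin n) Bool) (s t : Fin n) :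
    mdist (restrict W.curried D.entry) s t ≤ (repairLayer W L D).val.entry (s, t) := by
  refine hL.le_repair D s t fun v hv => ?_
  obtain ⟨l₁, l₂, hl⟩ := List.append_of_mem hv
  have hV := hL.loop.layer.data l₁ v l₂ hl
  have hA := affectedNodes_spec L D v
  rw [repairedThrough]
  split_ifs with hst
  · obtain ⟨h2, -, -⟩ := sketchGraph_spec W L D v (affectedNodes L D v).val
    exact (mdist_triangle _ s v t).trans (add_le_add
      ((dijkstra_spec _ v).2.1 _ (isPotential_mdist_inc h2 v) s)
      ((dijkstra_spec _ v).2.1 _ (isPotential_mdist_out h2 v) t))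
  · obtain ⟨hs, ht⟩ := not_or.1 hst
    exact hV.mdist_le_through hA (by simpa using hs) (by simpa using ht)

/-- Applied to the visited nodes, listed with the newest first, this selects the node of a given
path that was visited earliest. -/
theorem exists_last_split {α : Type} {P : α → Prop} (l : List α) (h : ∃ u ∈ l, P u) :
    ∃ l₁ v l₂, l = l₁ ++ v :: l₂ ∧ P v ∧ ∀ u ∈ l₂, ¬ P u := by
  induction l with
  | nil => simp at h
  | cons a l ih =>
    by_cases hl : ∃ u ∈ l, P u
    · obtain ⟨l₁, v, l₂, rfl, h1, h2⟩ := ih hl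
      exact ⟨a :: l₁, v, l₂, rfl, h1, h2⟩
    · obtain ⟨u, hu, hPu⟩ := h
      rcases List.mem_cons.1 hu with rfl | hu
      · exact ⟨[], u, l, rfl, hPu, fun w hw hPw => hl ⟨w, hw, hPw⟩⟩
      · exact absurd ⟨u, hu, hPu⟩ hl

/-- Let `v` be the node of `p` visited first; there is one, because `p` contains a center and all
centers were visited. At the time of that visit no node of `p` had been removed, so `p` is a path
through `v` in the graph of the visit, and it bounds both the stored value and the distances in the
sketch graph. -/
theorem LayerReady.repair_le_listLen {n : ℕ} {W : WMatrix n} {h : ℕ} {center : Fin n → Bool}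
    {L : Layer n} (hL : LayerReady W h center L) (D : Arr (Fin n) Bool) {s t : Fin n}
    {p : List (Fin n)} (hp : FromTo p s t) (hl : p.length ≤ h + 1)
    (hD : ∀ u ∈ p, D.entry u = false) (hc : ∃ u ∈ p, center u = true) :
    (repairLayer W L D).val.entry (s, t) ≤ listLen W.curried p := by
  obtain ⟨c, hcp, hc⟩ := hc
  obtain ⟨l₁, v, l₂, hsplit, hvp, hfree⟩ := exists_last_split (P := fun u => u ∈ p) L.visited
    ⟨c, hL.center_visited c hc, hcp⟩
  have hv : v ∈ L.visited := by rw [hsplit]; simp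
  have hV := hL.loop.layer.data l₁ v l₂ hsplit
  have hA := affectedNodes_spec L D v
  refine (hL.repair_le D s t hv).trans ?_
  obtain ⟨p₁, p₂, rfl⟩ := List.append_of_mem hvp
  have hS : ∀ u ∈ p₁ ++ v :: p₂, decide (u ∈ l₂) = false := fun u hu => by
    simpa using fun h => hfree u h hu
  rw [repairedThrough]
  split_ifs with hst
  · obtain ⟨-, h2, -⟩ := sketchGraph_spec W L D v (affectedNodes L D v).val
    exact hV.sketch_le hA h2 (dijkstra_spec _ v).1 (dijkstra_spec _ v).1 hp hl hS hD
  · exact hV.through_le hp hl hS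

/-- The total number of affected nodes of a layer. -/
def affectedTotal {n : ℕ} (L : Layer n) (D : Arr (Fin n) Bool) : ℕ :=
  (L.visited.map fun v => affectedCard L D v).sum

theorem sum_map_add_mul (l : List ℕ) (a b : ℕ) :
    (l.map fun x => a + b * x).sum = l.length * a + b * l.sum := by
  induction l with
  | nil => simp
  | cons x l ih => simp [ih]; ring

theorem repairLoop_cost_le {n : ℕ} {W : WMatrix n} {h : ℕ} {center : Fin n → Bool} {L : Layer n}
    (hL : LayerInv W h center L) (D : Arr (Fin n) Bool) :
    (repairLoop W L D).cost ≤ L.visited.length *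
      (12 * (n * (h + 1)) + 110 * (n * blockSize n) + 1) + 70 * n * affectedTotal L D := by
  have := forEach_cost_le_sum (l := L.visited) (init := ((⟨fun _ => ⟨fun _ => false⟩⟩, ⟨fun _ => ⊤⟩) :
    Arr (Fin n) (Arr (Fin n) Bool) × WMatrix n)) (body := fun v r => repairVisit W L D v r)
    (fun v => 12 * (n * (h + 1)) + 110 * (n * blockSize n) + 70 * (n * affectedCard L D v))
    (fun _ => True) trivial (fun _ _ _ _ => trivial) (by
      intro v hv r _
      obtain ⟨l₁, l₂, hl⟩ := List.append_of_mem hv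
      have hV := hL.data l₁ v l₂ hl
      exact repairVisit_cost_le W L D v h hV.length_pf hV.length_pt r)
  refine this.trans (le_of_eq ?_)
  have e : (L.visited.map fun v => 12 * (n * (h + 1)) + 110 * (n * blockSize n) +
      70 * (n * affectedCard L D v) + 1) = ((L.visited.map fun v => affectedCard L D v).map
      fun x => (12 * (n * (h + 1)) + 110 * (n * blockSize n) + 1) + 70 * n * x) := by
    rw [List.map_map]
    refine List.map_congr_left fun v _ => ?_
    simp only [Function.comp]
    ring
  rw [e, sum_map_add_mul, List.length_map, affectedTotal]

theorem sum_list_sum_comm {α ι : Type} [Fintype ι] (l : List α) (f : α → ι → ℕ) :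
    ∑ i, (l.map fun a => f a i).sum = (l.map fun a => ∑ i, f a i).sum := by
  induction l with
  | nil => simp
  | cons a l ih => simp [Finset.sum_add_distrib, ih]

/-- Double counting: an affected node of `v` is charged 4 for each pair in which it is the first
node and 4 for each pair in which it is the second, hence 8n altogether. -/
theorem LayerReady.repairCombine_cost_le {n : ℕ} {W : WMatrix n} {h : ℕ} {center : Fin n → Bool}
    {L : Layer n} (hL : LayerReady W h center L) (D : Arr (Fin n) Bool) :
    (repairCombine L (repairLoop W L D).val).cost ≤
      12 * (n * n) + 8 * n * affectedTotal L D := by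
  have hU := (repairLoop_spec W L D).1
  set r := (repairLoop W L D).val with hr
  have h1 := tabulate₂_cost_le_sum (⊤ : ℝ≥0∞) (fun s t => do
    let d ← r.2.read (s, t)
    let l ← L.sorted.read (s, t)
    let d' ← firstUnchanged r.1 s t l
    step (min d d'))
  have hbody : ∀ s t, ((do
    let d ← r.2.read (s, t)
    let l ← L.sorted.read (s, t)
    let d' ← firstUnchanged r.1 s t l
    step (min d d')) : Timed ℝ≥0∞).cost + 2 ≤ 10 + (L.visited.map fun v =>
      (if (affectedNodes L D v).val.entry s then 4 else 0) +
        if (affectedNodes L D v).val.entry t then 4 else 0).sum := by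
    intro s t
    have h2 := (firstUnchanged_spec r.1 s t (L.sorted.entry (s, t))).2.2
    have h3 : ((L.sorted.entry (s, t)).map fun e =>
        (if (r.1.entry e.2).entry s then 4 else 0) +
          if (r.1.entry e.2).entry t then 4 else 0).sum = (L.visited.map fun v =>
        (if (affectedNodes L D v).val.entry s then 4 else 0) +
          if (affectedNodes L D v).val.entry t then 4 else 0).sum := by
      rw [((hL.sorted_perm s t).map _).sum_eq, List.map_map]
      congr 1
      refine List.map_congr_left fun v hv => ?_
      simp only [Function.comp, hU v hv]
    rw [h3] at h2
    simp only [bind_cost, read_cost, read_val, step_cost]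
    omega
  have h4 : ∀ s ∈ (Finset.univ : Finset (Fin n)), ((∑ t, (((do
    let d ← r.2.read (s, t)
    let l ← L.sorted.read (s, t)
    let d' ← firstUnchanged r.1 s t l
    step (min d d')) : Timed ℝ≥0∞).cost + 2)) + 1) ≤ 10 * n + 1 + (L.visited.map fun v =>
      n * (if (affectedNodes L D v).val.entry s then 4 else 0) + affectedCard L D v * 4).sum := by
    intro s _
    have e : ∑ t, (10 + (L.visited.map fun v =>
        (if (affectedNodes L D v).val.entry s then 4 else 0) +
          if (affectedNodes L D v).val.entry t then 4 else 0).sum) = 10 * n +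
        (L.visited.map fun v => n * (if (affectedNodes L D v).val.entry s then 4 else 0) +
          affectedCard L D v * 4).sum := by
      rw [Finset.sum_add_distrib, sum_list_sum_comm]
      simp only [Finset.sum_add_distrib, sum_ite_affected, Finset.sum_const, Finset.card_univ,
        Fintype.card_fin, smul_eq_mul]
      ring
    have := (Finset.sum_le_sum fun t (_ : t ∈ Finset.univ) => hbody s t).trans_eq e
    omega
  have h5 := h1.trans (Nat.add_le_add_left (Finset.sum_le_sum h4) _)
  rw [Finset.sum_add_distrib, sum_list_sum_comm] at h5
  simp only [Finset.sum_add_distrib, ← Finset.mul_sum, sum_ite_affected, Finset.sum_const,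
    Finset.card_univ, Fintype.card_fin, smul_eq_mul] at h5
  have h6 : (L.visited.map fun v => n * (affectedCard L D v * 4) + affectedCard L D v * (n * 4)) =
      ((L.visited.map fun v => affectedCard L D v).map fun x => 0 + 8 * n * x) := by
    rw [List.map_map]
    refine List.map_congr_left fun v _ => ?_
    simp only [Function.comp]
    ring
  rw [h6, sum_map_add_mul] at h5
  rw [affectedTotal]
  refine h5.trans ?_
  have : n ≤ n * n := Nat.le_mul_self n
  nlinarith

theorem LayerReady.repairLayer_cost_le {n : ℕ} {W : WMatrix n} {h : ℕ} {center : Fin n → Bool}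
    {L : Layer n} (hL : LayerReady W h center L) (D : Arr (Fin n) Bool) :
    (repairLayer W L D).cost ≤ 15 * (n * n) + L.visited.length *
      (12 * (n * (h + 1)) + 110 * (n * blockSize n) + 1) + 78 * n * affectedTotal L D := by
  rw [repairLayer_cost]
  have h1 := hL.repairCombine_cost_le D
  have h2 := repairLoop_cost_le hL.loop.layer D
  simp only [Fintype.card_prod, Fintype.card_fin]
  have : n ≤ n * n := Nat.le_mul_self n
  nlinarith

/-- The affected nodes are counted by the congestion of the deleted nodes. -/
theorem affectedCard_le {n : ℕ} (L : Layer n) (D : Finset (Fin n)) (v : Fin n) :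
    affectedCard L (nodeSet D) v ≤ ∑ u ∈ D, hitCount (fun x => L.pathFrom.entry (v, x))
      (fun x => L.pathTo.entry (v, x)) u := by
  rw [affectedCard]
  refine le_trans (Finset.card_le_card fun x hx => ?_) (Finset.card_biUnion_le)
  rw [Finset.mem_filter] at hx
  have := (affectedNodes_spec L (nodeSet D) v x).1 hx.2
  simp only [Finset.mem_biUnion, Finset.mem_filter, Finset.mem_univ, true_and]
  simp only [nodeSet, decide_eq_true_eq] at this
  rcases this with ⟨u, h1, h2⟩ | ⟨u, h1, h2⟩
  · exact ⟨u, h2, Or.inl h1⟩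
  · exact ⟨u, h2, Or.inr h1⟩

theorem list_sum_finset_sum_comm {α ι : Type} (l : List α) (s : Finset ι) (f : α → ι → ℕ) :
    (l.map fun a => ∑ i ∈ s, f a i).sum = ∑ i ∈ s, (l.map fun a => f a i).sum := by
  induction l with
  | nil => simp
  | cons a l ih => simp [Finset.sum_add_distrib, ih]

/-- Every affected node is an endpoint of a stored path hit by some deleted node `u`. Summed over
all visits, the hits of `u` are at most its final counter plus `n`, and each counter is at most
2T·H_n with T = 2n(h+1), whether `u` was visited or not. -/
theorem LayerReady.affectedTotal_le {n : ℕ} {W : WMatrix n} {h : ℕ} {center : Fin n → Bool}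
    {L : Layer n} (hL : LayerReady W h center L) (D : Finset (Fin n)) :
    (affectedTotal L (nodeSet D) : ℝ) ≤
      D.card * (4 * (n * (h + 1)) * (harmonic n : ℝ) + n) := by
  have h1 : affectedTotal L (nodeSet D) ≤ ∑ u ∈ D, (L.congestion.entry u + n) := by
    rw [affectedTotal]
    refine (List.sum_le_sum fun v _ => affectedCard_le L D v).trans ?_
    rw [list_sum_finset_sum_comm]
    refine Finset.sum_le_sum fun u _ => (hL.loop.layer.hits_le u).trans ?_
    split_ifs <;> omega
  have hT : (0 : ℝ) ≤ 2 * (n * (h + 1)) := by positivity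
  have h2 : ∀ u, (L.congestion.entry u : ℝ) ≤ 4 * (n * (h + 1)) * (harmonic n : ℝ) := by
    intro u
    have : (L.congestion.entry u : ℝ) ≤ 2 * (2 * (n * (h + 1))) * (harmonic n : ℝ) := by
      cases hu : L.isVisited.entry u with
      | true => exact hL.loop.visited_bound u hu
      | false =>
        cases hc : center u with
        | true => exact hL.loop.center_bound.entry_le hT le_rfl hc hu
        | false => exact hL.loop.other_bound.entry_le hT (by norm_num) (by simp [hc]) hu
    linarith
  calc (affectedTotal L (nodeSet D) : ℝ) ≤ ((∑ u ∈ D, (L.congestion.entry u + n) : ℕ) : ℝ) :=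
        Nat.cast_le.2 h1
    _ = ∑ u ∈ D, ((L.congestion.entry u : ℝ) + n) := by push_cast; rfl
    _ ≤ ∑ _u ∈ D, (4 * (n * (h + 1)) * (harmonic n : ℝ) + n) :=
        Finset.sum_le_sum fun u _ => add_le_add (h2 u) le_rfl
    _ = D.card * (4 * (n * (h + 1)) * (harmonic n : ℝ) + n) := by
        rw [Finset.sum_const, nsmul_eq_mul]

/-! ### Distances through the centers -/

/-- The adjacency lists of the graph without the deleted nodes. -/
def remainingGraph {n : ℕ} (W : WMatrix n) (D : Arr (Fin n) Bool) : AdjLists n :=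
  (allEdges W D ⟨⟨fun _ => []⟩, ⟨fun _ => []⟩⟩).val

/-- Lower all entries to the distances through `v`. -/
def lowerAll {n : ℕ} (distFrom distTo : Arr (Fin n) ℝ≥0∞) (m : WMatrix n) : Timed (WMatrix n) :=
  forEach (nodes n) m fun s m =>
    forEach (nodes n) m fun t m => do
      let ds ← distTo.read s
      let dt ← distFrom.read t
      let d ← step (ds + dt)
      lowerTo m (s, t) d

theorem lowerAll_val {n : ℕ} (distFrom distTo : Arr (Fin n) ℝ≥0∞) (m : WMatrix n) (s t : Fin n) :
    (lowerAll distFrom distTo m).val.entry (s, t) =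
      min (m.entry (s, t)) (distTo.entry s + distFrom.entry t) := by
  have key := forEach_val_spec (l := nodes n) (init := m) (body := fun s m =>
    forEach (nodes n) m fun t m => do
      let ds ← distTo.read s
      let dt ← distFrom.read t
      let d ← step (ds + dt)
      lowerTo m (s, t) d) (fun pre m' => ∀ s t, m'.entry (s, t) = if s ∈ pre then
        min (m.entry (s, t)) (distTo.entry s + distFrom.entry t) else m.entry (s, t))
    (by simp) (by
      intro pre s post m' hl hm'
      have hs : s ∉ pre := by
        have := nodup_nodes n
        rw [hl, List.nodup_append] at this
        exact fun h => this.2.2 s h s (by simp) rfl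
      have inner := forEach_val_spec (l := nodes n) (init := m') (body := fun t m => do
        let ds ← distTo.read s
        let dt ← distFrom.read t
        let d ← step (ds + dt)
        lowerTo m (s, t) d) (fun pre' m'' => ∀ a t, m''.entry (a, t) = if a = s ∧ t ∈ pre' then
          min (m'.entry (a, t)) (distTo.entry a + distFrom.entry t) else m'.entry (a, t))
        (by simp) (by
          intro pre' t post' m'' hl' hm'' a b
          have ht : t ∉ pre' := by
            have := nodup_nodes n
            rw [hl', List.nodup_append] at this
            exact fun h => this.2.2 t h t (by simp) rfl
          simp only [bind_val, read_val, step_val, lowerTo_entry, Prod.mk.injEq, hm'',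
            List.mem_append, List.mem_singleton]
          by_cases ha : a = s
          · subst ha
            by_cases hb : b = t
            · subst hb
              simp [ht]
            · simp [hb]
          · simp [ha])
      intro a t
      rw [inner a t, hm' a t]
      by_cases ha : a = s
      · subst ha
        simp [hs]
      · simp [ha])
  have := key s t
  rwa [if_pos (mem_nodes s)] at this

theorem lowerAll_cost_le {n : ℕ} (distFrom distTo : Arr (Fin n) ℝ≥0∞) (m : WMatrix n) :
    (lowerAll distFrom distTo m).cost ≤ n * (n * (6 + 1) + 1) :=
  forEach_forEach_cost_le m (fun s t m => do
      let ds ← distTo.read s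
      let dt ← distFrom.read t
      let d ← step (ds + dt)
      lowerTo m (s, t) d) 6 fun s t m => by
    simp only [bind_cost, read_cost, read_val, step_cost, step_val]
    have := lowerTo_cost_le m (s, t) (distTo.entry s + distFrom.entry t)
    omega

/-- The loop of `throughCenters` over the centers. -/
def centerLoop {n : ℕ} (L : Layer n) (A : AdjLists n) : Timed (WMatrix n) :=
  forEach (nodes n) ⟨fun _ => ⊤⟩ fun v m => do
    let c ← L.center.read v
    if c then do
      let distFrom ← dijkstra A.out v
      let distTo ← dijkstra A.inc v
      lowerAll distFrom distTo m
    else pure m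

theorem throughCenters_val {n : ℕ} (W : WMatrix n) (L : Layer n) (D : Arr (Fin n) Bool) :
    (throughCenters W L D).val = (centerLoop L (remainingGraph W D)).val := rfl

theorem throughCenters_cost {n : ℕ} (W : WMatrix n) (L : Layer n) (D : Arr (Fin n) Bool) :
    (throughCenters W L D).cost = Fintype.card (Fin n) + (Fintype.card (Fin n) + 0) +
      ((allEdges W D ⟨⟨fun _ => []⟩, ⟨fun _ => []⟩⟩).cost + (Fintype.card (Fin n × Fin n) +
        (centerLoop L (remainingGraph W D)).cost)) := rfl

theorem throughCenters_spec {n : ℕ} (W : WMatrix n) (L : Layer n) (D : Arr (Fin n) Bool) :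
    (∀ s t d, (∀ v, L.center.entry v = true →
        d ≤ (dijkstra (remainingGraph W D).inc v).val.entry s +
          (dijkstra (remainingGraph W D).out v).val.entry t) →
      d ≤ (throughCenters W L D).val.entry (s, t)) ∧
    (∀ s t v, L.center.entry v = true → (throughCenters W L D).val.entry (s, t) ≤
      (dijkstra (remainingGraph W D).inc v).val.entry s +
          (dijkstra (remainingGraph W D).out v).val.entry t) := by
  rw [throughCenters_val]
  set A := remainingGraph W D
  have key := forEach_val_spec (l := nodes n) (init := (⟨fun _ => ⊤⟩ : WMatrix n))
    (body := fun v m => do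
      let c ← L.center.read v
      if c then do
        let distFrom ← dijkstra A.out v
        let distTo ← dijkstra A.inc v
        lowerAll distFrom distTo m
      else pure m) (fun pre m => (∀ s t d, (∀ v ∈ pre, L.center.entry v = true →
        d ≤ (dijkstra A.inc v).val.entry s + (dijkstra A.out v).val.entry t) →
        d ≤ m.entry (s, t)) ∧
      ∀ s t, ∀ v ∈ pre, L.center.entry v = true → m.entry (s, t) ≤
        (dijkstra A.inc v).val.entry s + (dijkstra A.out v).val.entry t) (by simp) (by
      intro pre v post m _ ⟨h1, h2⟩
      rw [read_bind_val]
      by_cases hc : L.center.entry v = true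
      · rw [if_pos hc]
        simp only [bind_val]
        refine ⟨fun s t d hd => ?_, fun s t w hw hcw => ?_⟩
        · rw [lowerAll_val]
          exact le_min (h1 s t d fun w hw => hd w (List.mem_append_left _ hw))
            (hd v (by simp) hc)
        · rw [lowerAll_val]
          rcases List.mem_append.1 hw with hw | hw
          · exact (min_le_left _ _).trans (h2 s t w hw hcw)
          · rw [List.mem_singleton.1 hw]
            exact min_le_right _ _
      · rw [if_neg hc, pure_val]
        refine ⟨fun s t d hd => h1 s t d fun w hw => hd w (List.mem_append_left _ hw),
          fun s t w hw hcw => ?_⟩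
        rcases List.mem_append.1 hw with hw | hw
        · exact h2 s t w hw hcw
        · rw [List.mem_singleton.1 hw] at hcw
          exact absurd hcw hc)
  exact ⟨fun s t d hd => key.1 s t d fun v _ => hd v,
    fun s t v hv => key.2 s t v (mem_nodes v) hv⟩

theorem mdist_le_throughCenters {n : ℕ} (W : WMatrix n) (L : Layer n) (D : Arr (Fin n) Bool)
    (s t : Fin n) :
    mdist (restrict W.curried D.entry) s t ≤ (throughCenters W L D).val.entry (s, t) := by
  refine (throughCenters_spec W L D).1 s t _ fun v _ => ?_
  have h2 := (allEdges_spec W D _ (AdjLists.empty_within _)).1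
  exact (mdist_triangle _ s v t).trans (add_le_add
    ((dijkstra_spec _ v).2.1 _ (isPotential_mdist_inc h2 v) s)
    ((dijkstra_spec _ v).2.1 _ (isPotential_mdist_out h2 v) t))

/-- Here the path may have any number of edges: all edges of G∖D are in the lists, and Dijkstra's
output is a potential along both halves of the path. -/
theorem throughCenters_le_listLen {n : ℕ} (W : WMatrix n) (L : Layer n) (D : Arr (Fin n) Bool)
    {s t : Fin n} {p : List (Fin n)} (hp : FromTo p s t)
    (hc : ∃ u ∈ p, L.center.entry u = true) :
    (throughCenters W L D).val.entry (s, t) ≤ listLen (restrict W.curried D.entry) p := by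
  obtain ⟨v, hvp, hv⟩ := hc
  obtain ⟨p₁, p₂, rfl⟩ := List.append_of_mem hvp
  refine ((throughCenters_spec W L D).2 s t v hv).trans ?_
  obtain ⟨-, h2⟩ := allEdges_spec W D _ (AdjLists.empty_within _)
  obtain ⟨h3, h4⟩ := hp.split
  have hout := (dijkstra_spec (remainingGraph W D).out v).1
  have hinc := (dijkstra_spec (remainingGraph W D).inc v).1
  rw [listLen_append]
  refine add_le_add ?_ ?_
  · exact le_listLen_of_edges hinc.source (fun x y => hinc.inc_le (h2 x y)) _ s h3
  · rw [← List.reverse_reverse (v :: p₂), listLen_reverse]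
    refine le_listLen_of_edges hout.source (fun x y => ?_) _ t h4.reverse
    rw [add_comm]
    exact hout.out_le (h2 y x)

theorem throughCenters_cost_le {n : ℕ} (W : WMatrix n) (L : Layer n) (D : Arr (Fin n) Bool) :
    (throughCenters W L D).cost ≤ 15 * (n * n) +
      (Finset.univ.filter fun u => L.center.entry u = true).card *
        (42 * (n * blockSize n) + 26 * (n * n)) := by
  rw [throughCenters_cost]
  set A := remainingGraph W D with hA
  have hW : A.Within (restrict W.curried D.entry) (n * n) :=
    (allEdges_spec W D _ (AdjLists.empty_within _)).1
  have h1 := allEdges_cost_le W D ⟨⟨fun _ => []⟩, ⟨fun _ => []⟩⟩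
  have h2 := forEach_cost_le_sum (l := nodes n) (init := (⟨fun _ => ⊤⟩ : WMatrix n))
    (body := fun v m => do
      let c ← L.center.read v
      if c then do
        let distFrom ← dijkstra A.out v
        let distTo ← dijkstra A.inc v
        lowerAll distFrom distTo m
      else pure m) (fun v => 1 + if L.center.entry v = true then
        42 * (n * blockSize n) + 26 * (n * n) else 0) (fun _ => True) trivial
      (fun _ _ _ _ => trivial) (by
      intro v _ m _
      have e1 := (dijkstra_spec A.out v).2.2
      have e2 := (dijkstra_spec A.inc v).2.2
      have e3 := lowerAll_cost_le (dijkstra A.out v).val (dijkstra A.inc v).val m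
      have e4 := hW.out_card
      have e5 := hW.inc_card
      have : n ≤ n * n := Nat.le_mul_self n
      rw [read_bind_cost]
      by_cases hc : L.center.entry v = true
      · rw [if_pos hc, if_pos hc]
        simp only [bind_cost]
        nlinarith
      · rw [if_neg hc, if_neg hc]
        exact le_of_eq (add_comm _ _))
  rw [sum_map_nodes, Finset.sum_add_distrib, Finset.sum_add_distrib, ← Finset.sum_filter,
    Finset.sum_const] at h2
  simp only [Finset.sum_const, Finset.card_univ, Fintype.card_fin, smul_eq_mul, mul_one] at h2
  have h3 : (centerLoop L A).cost ≤ n +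
      (Finset.univ.filter fun u => L.center.entry u = true).card *
        (42 * (n * blockSize n) + 26 * (n * n)) + n := h2
  simp only [Fintype.card_prod, Fintype.card_fin]
  have : n ≤ n * n := Nat.le_mul_self n
  nlinarith

/-! ### The preprocessing algorithm -/

/-- `Fin.ofNat` reduces modulo the number of cells, so the index bounds are needed for different
layers to have different cells. -/
theorem layer_inj {n i j : ℕ} (hi : i ≤ topLayer n) (hj : j ≤ topLayer n)
    (h : layer n i = layer n j) : i = j := by
  have := congrArg Fin.val h
  simp only [layer, Fin.ofNat] at this
  rwa [Nat.mod_eq_of_lt (by omega), Nat.mod_eq_of_lt (by omega)] at this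

theorem sum_map_range' (m : ℕ) (f : ℕ → ℕ) :
    ((List.range' 1 m).map f).sum = ∑ i ∈ Finset.range m, f (i + 1) := by
  induction m with
  | zero => simp
  | succ m ih => rw [List.range'_1_concat, List.map_append, List.sum_append, ih,
      Finset.sum_range_succ]; simp [add_comm]

/-- A loop over layers `1, …, m` that writes the cell of each layer. -/
theorem forEach_layers_val {n : ℕ} {β : Type} {m : ℕ} (hm : m ≤ topLayer n)
    (a : Arr (LayerIndex n) β) (f : ℕ → β)
    (body : ℕ → Arr (LayerIndex n) β → Timed (Arr (LayerIndex n) β))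
    (hbody : ∀ i a, (body i a).val = ⟨Function.update a.entry (layer n i) (f i)⟩)
    {i : ℕ} (hi : i ≤ topLayer n) :
    (forEach (List.range' 1 m) a body).val.entry (layer n i) =
      if 1 ≤ i ∧ i ≤ m then f i else a.entry (layer n i) := by
  have key := forEach_val_spec (l := List.range' 1 m) (init := a) (body := body)
    (fun pre b => b.entry (layer n i) = if i ∈ pre then f i else a.entry (layer n i)) (by simp) (by
      intro pre j post b hl hb
      have hj : j ≤ topLayer n := by
        have : j ∈ List.range' 1 m := by rw [hl]; simp
        simp only [List.mem_range'_1] at this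
        omega
      rw [hbody]
      by_cases hij : i = j
      · subst hij
        simp
      · dsimp only
        rw [Function.update_of_ne (fun h => hij (layer_inj hi hj h)), hb]
        simp [hij])
  rw [key]
  congr 1
  simp only [List.mem_range'_1, eq_iff_iff]
  omega

theorem preprocess_entry {n : ℕ} (W : WMatrix n) (coins : Coins n) {i : ℕ} (hi : i ≤ topLayer n) :
    (preprocess W coins).val.entry (layer n i) = if 1 ≤ i ∧ i ≤ topLayer n then
      (preprocessLayer W (fun v => coins (layer n i, v)) i).val
        else emptyLayer n fun _ => false :=
  forEach_layers_val le_rfl (⟨fun _ => (newLayer n).val⟩ : Data n)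
    (fun i => (preprocessLayer W (fun v => coins (layer n i, v)) i).val)
    (fun i data => do
      let L ← preprocessLayer W (fun v => coins (layer n i, v)) i
      data.write (layer n i) L) (fun _ _ => rfl) hi

theorem preprocess_ready {n : ℕ} (W : WMatrix n) (coins : Coins n) {i : ℕ} (h1 : 1 ≤ i)
    (hi : i ≤ topLayer n) : LayerReady W (2 ^ i) (fun v => coins (layer n i, v))
      ((preprocess W coins).val.entry (layer n i)) := by
  rw [preprocess_entry W coins hi, if_pos ⟨h1, hi⟩]
  exact (preprocessLayer_spec W _ i).1

/-- Layer 0 is addressed by the deletion only if h = 1, that is, if all nodes are deleted; without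
centers it causes no run of Dijkstra's algorithm. -/
theorem preprocess_center_zero {n : ℕ} (W : WMatrix n) (coins : Coins n) (u : Fin n) :
    ((preprocess W coins).val.entry (layer n 0)).center.entry u = false := by
  rw [preprocess_entry W coins (Nat.zero_le _), if_neg (by omega)]
  rfl

/-- The number of centers of layer `i`. -/
def centerCount {n : ℕ} (coins : Coins n) (i : ℕ) : ℕ :=
  (Finset.univ.filter fun u => coins (layer n i, u) = true).card

theorem preprocess_cost_le {n : ℕ} (W : WMatrix n) (coins : Coins n) :
    (preprocess W coins).cost ≤ 3 * n + 3 * (n * n) + n * n * n + (topLayer n + 1) +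
      ∑ i ∈ Finset.range (topLayer n), (centerCount coins (i + 1) *
        (182 * ((2 ^ (i + 1) + 1) * (n * n)) + n * n * (10 * topLayer n + 6)) +
        30 * (n * n * n) + 4) := by
  have h := forEach_cost_le_sum (l := List.range' 1 (topLayer n))
    (init := (⟨fun _ => (newLayer n).val⟩ : Data n)) (body := fun i data => do
      let L ← preprocessLayer W (fun v => coins (layer n i, v)) i
      data.write (layer n i) L) (fun i => centerCount coins i *
        (182 * ((2 ^ i + 1) * (n * n)) + n * n * (10 * topLayer n + 6)) +
        30 * (n * n * n) + 3) (fun _ => True) trivial (fun _ _ _ _ => trivial) (by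
      intro i _ data _
      have := (preprocessLayer_spec W (fun v => coins (layer n i, v)) i).2
      simp only [bind_cost, write_cost]
      rw [centerCount]
      omega)
  rw [sum_map_range'] at h
  have e : (preprocess W coins).cost = (newLayer n).cost + (Fintype.card (LayerIndex n) +
    (forEach (List.range' 1 (topLayer n)) (⟨fun _ => (newLayer n).val⟩ : Data n) fun i data => do
      let L ← preprocessLayer W (fun v => coins (layer n i, v)) i
      data.write (layer n i) L).cost) := rfl
  rw [e, newLayer_cost, Fintype.card_fin, add_assoc (_ + _) (topLayer n + 1) _]
  exact Nat.add_le_add_left (Nat.add_le_add_left h _) _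

/-! ### The deletion algorithm -/

/-- The number of deleted nodes. -/
def batchSize {n : ℕ} (D : Arr (Fin n) Bool) : Timed ℕ :=
  forEach (nodes n) (0 : ℕ) fun v k => do
    let b ← D.read v
    step (if b then k + 1 else k)

theorem batchSize_val {n : ℕ} (D : Finset (Fin n)) : (batchSize (nodeSet D)).val = D.card := by
  have key := forEach_val_spec (l := nodes n) (init := 0) (body := fun v k => do
    let b ← (nodeSet D).read v
    step (if b then k + 1 else k)) (fun pre k => k = (pre.filter fun v => v ∈ D).length)
    (by simp) (by
      intro pre v post k _ hk
      rw [read_bind_val, step_val]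
      by_cases hv : v ∈ D <;> simp [nodeSet, hv, hk])
  have h2 : ((nodes n).filter fun v => v ∈ D).toFinset = D := by
    ext v
    simp
  rw [batchSize, key, ← List.toFinset_card_of_nodup ((nodup_nodes n).filter _), h2]

theorem batchSize_cost {n : ℕ} (D : Arr (Fin n) Bool) : (batchSize D).cost ≤ n * 3 := by
  have := forEach_cost_le (l := nodes n) (init := 0) (body := fun v k => do
    let b ← D.read v
    step (if b then k + 1 else k)) 2 (by intros; simp)
  rwa [length_nodes] at this

/-- Repair of the layers `1, …, lo`. -/
def repairAll {n : ℕ} (W : WMatrix n) (data : Data n) (D : Arr (Fin n) Bool) (lo : ℕ) :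
    Timed (Arr (LayerIndex n) (WMatrix n)) :=
  forEach (List.range' 1 lo) ⟨fun _ => ⟨fun _ => ⊤⟩⟩ fun i δ => do
    let L ← data.read (layer n i)
    let m ← repairLayer W L D
    δ.write (layer n i) m

/-- The minimum over the layers `1, …, hi`. -/
def layerMin {n : ℕ} (δ : Arr (LayerIndex n) (WMatrix n)) (hi : ℕ) : Timed (WMatrix n) :=
  tabulate₂ ⊤ fun s t =>
    forEach (List.range' 1 hi) ⊤ fun i d => do
      let m ← δ.read (layer n i)
      let e ← m.read (s, t)
      step (min d e)

theorem layerMin_spec {n : ℕ} (δ : Arr (LayerIndex n) (WMatrix n)) (hi : ℕ) (s t : Fin n) :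
    (∀ d, (∀ i, 1 ≤ i → i ≤ hi → d ≤ (δ.entry (layer n i)).entry (s, t)) →
      d ≤ (layerMin δ hi).val.entry (s, t)) ∧
    ∀ i, 1 ≤ i → i ≤ hi → (layerMin δ hi).val.entry (s, t) ≤
      (δ.entry (layer n i)).entry (s, t) := by
  rw [layerMin, tabulate₂_val]
  have key := forEach_val_spec (l := List.range' 1 hi) (init := (⊤ : ℝ≥0∞))
    (body := fun i d => do
      let m ← δ.read (layer n i)
      let e ← m.read (s, t)
      step (min d e)) (fun pre a => (∀ d, (∀ i ∈ pre, d ≤ (δ.entry (layer n i)).entry (s, t)) →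
      d ≤ a) ∧ ∀ i ∈ pre, a ≤ (δ.entry (layer n i)).entry (s, t)) (by simp) (by
      intro pre i post a _ ⟨h1, h2⟩
      simp only [bind_val, read_val, step_val]
      refine ⟨fun d hd => le_min (h1 d fun j hj => hd j (List.mem_append_left _ hj))
        (hd i (by simp)), fun j hj => ?_⟩
      rcases List.mem_append.1 hj with hj | hj
      · exact (min_le_left _ _).trans (h2 j hj)
      · rw [List.mem_singleton.1 hj]
        exact min_le_right _ _)
  refine ⟨fun d hd => key.1 d fun i hi => ?_, fun i h1 h2 => key.2 i ?_⟩
  · rw [List.mem_range'_1] at hi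
    exact hd i hi.1 (by omega)
  · rw [List.mem_range'_1]
    omega

theorem layerMin_cost_le {n : ℕ} (δ : Arr (LayerIndex n) (WMatrix n)) (hi : ℕ) :
    (layerMin δ hi).cost ≤ n * n * (4 * hi + 4) := by
  refine tabulate₂_cost_le _ _ (4 * hi) fun s t => ?_
  have := forEach_cost_le (l := List.range' 1 hi) (init := (⊤ : ℝ≥0∞))
    (body := fun i d => do
      let m ← δ.read (layer n i)
      let e ← m.read (s, t)
      step (min d e)) 3 (by intros; simp)
  rw [List.length_range'] at this
  omega

/-- The index of the last repaired layer, if `k` nodes are deleted. -/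
def lastRepaired (n k : ℕ) : ℕ := ⌊Real.logb 2 √((n : ℝ) / (k : ℝ))⌋₊

/-- The index of the layer whose centers are used for all longer paths, if `k` nodes are
deleted. -/
def centerLayer (n k : ℕ) : ℕ := ⌈Real.logb 2 √((n : ℝ) / (k : ℝ))⌉₊

theorem batchDeletion_eq {n : ℕ} (W : WMatrix n) (data : Data n) (D : Finset (Fin n)) :
    (batchDeletion W data (nodeSet D)).val =
      (layerMin ⟨Function.update (repairAll W data (nodeSet D) (lastRepaired n D.card)).val.entry
        (layer n (centerLayer n D.card))
        (throughCenters W (data.entry (layer n (centerLayer n D.card))) (nodeSet D)).val⟩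
        (centerLayer n D.card)).val ∧
    (batchDeletion W data (nodeSet D)).cost = (batchSize (nodeSet D)).cost + (1 + (1 + (1 +
      (Fintype.card (Fin n × Fin n) + (Fintype.card (LayerIndex n) +
        ((repairAll W data (nodeSet D) (lastRepaired n D.card)).cost + (1 +
          ((throughCenters W (data.entry (layer n (centerLayer n D.card))) (nodeSet D)).cost + (1 +
      (layerMin ⟨Function.update (repairAll W data (nodeSet D) (lastRepaired n D.card)).val.entry
        (layer n (centerLayer n D.card))
        (throughCenters W (data.entry (layer n (centerLayer n D.card))) (nodeSet D)).val⟩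
        (centerLayer n D.card)).cost))))))))) := by
  rw [← batchSize_val D]
  exact ⟨rfl, rfl⟩

theorem repairAll_cost_le {n : ℕ} (W : WMatrix n) (coins : Coins n) (D : Arr (Fin n) Bool) {lo : ℕ}
    (hlo : lo ≤ topLayer n) :
    (repairAll W (preprocess W coins).val D lo).cost ≤ ∑ i ∈ Finset.range lo,
      (3 + (15 * (n * n) +
        ((preprocess W coins).val.entry (layer n (i + 1))).visited.length *
          (12 * (n * (2 ^ (i + 1) + 1)) + 110 * (n * blockSize n) + 1) +
        78 * n * affectedTotal ((preprocess W coins).val.entry (layer n (i + 1))) D)) := by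
  have h := forEach_cost_le_sum (l := List.range' 1 lo)
    (init := (⟨fun _ => ⟨fun _ => ⊤⟩⟩ : Arr (LayerIndex n) (WMatrix n))) (body := fun i δ => do
      let L ← (preprocess W coins).val.read (layer n i)
      let m ← repairLayer W L D
      δ.write (layer n i) m) (fun i => 2 + (15 * (n * n) +
        ((preprocess W coins).val.entry (layer n i)).visited.length *
          (12 * (n * (2 ^ i + 1)) + 110 * (n * blockSize n) + 1) +
        78 * n * affectedTotal ((preprocess W coins).val.entry (layer n i)) D))
      (fun _ => True) trivial (fun _ _ _ _ => trivial) (by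
      intro i hi δ _
      rw [List.mem_range'_1] at hi
      have := (preprocess_ready W coins hi.1 (by omega)).repairLayer_cost_le D
      simp only [bind_cost, read_cost, read_val, write_cost]
      omega)
  rw [sum_map_range'] at h
  refine h.trans (le_of_eq (Finset.sum_congr rfl fun i _ => ?_))
  ring

/-! ### Distances in a graph and in its adjacency matrix -/

/-- The edge lengths of `G ∖ D`. -/
abbrev WDigraph.lengths {n : ℕ} (G : WDigraph n) (D : Finset (Fin n)) : Fin n → Fin n → ℝ≥0∞ :=
  restrict G.matrix.curried (nodeSet D).entry

theorem WDigraph.lengths_of_edge {n : ℕ} {G : WDigraph n} {D : Finset (Fin n)} {u v : Fin n}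
    (h : G.edge u v) (hu : u ∉ D) (hv : v ∉ D) : G.lengths D u v = G.weight u v := by
  rw [WDigraph.lengths, restrict_of_not (by simp [nodeSet, hu]) (by simp [nodeSet, hv])]
  simp [Arr.curried, WDigraph.matrix, h]

theorem WDigraph.edge_of_lengths {n : ℕ} {G : WDigraph n} {D : Finset (Fin n)} {u v : Fin n}
    (h : G.lengths D u v ≠ ⊤) : G.edge u v ∧ u ∉ D ∧ v ∉ D := by
  simp only [WDigraph.lengths, restrict, nodeSet, decide_eq_true_eq, Arr.curried,
    WDigraph.matrix] at h
  split_ifs at h with h1 h2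
  · exact absurd rfl h
  · exact ⟨h2, not_or.1 h1⟩
  · exact absurd rfl h

theorem WDigraph.IsPath.listLen_eq {n : ℕ} {G : WDigraph n} {D : Finset (Fin n)} {s t : Fin n}
    {p : List (Fin n)} (hp : G.IsPath D s t p) :
    listLen (G.lengths D) p = (G.pathLength p : ℝ≥0∞) := by
  obtain ⟨-, -, he, ha⟩ := hp
  induction p with
  | nil => rfl
  | cons u p ih =>
    cases p with
    | nil => rfl
    | cons v p =>
      rw [List.isChain_cons_cons] at he
      simp only [listLen, WDigraph.pathLength]
      rw [ih he.2 fun x hx => ha x (List.mem_cons_of_mem _ hx),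
        WDigraph.lengths_of_edge he.1 (ha u (by simp)) (ha v (by simp))]
      push_cast
      rfl

/-- A finite length forces every consecutive pair to be an edge between undeleted nodes. The list
with the single node `s` has length 0 in any case, so s ∉ D has to be assumed. -/
theorem WDigraph.isPath_of_listLen {n : ℕ} {G : WDigraph n} {D : Finset (Fin n)} {s t : Fin n}
    {p : List (Fin n)} (hp : FromTo p s t) (hs : s ∉ D) (h : listLen (G.lengths D) p ≠ ⊤) :
    G.IsPath D s t p := by
  refine ⟨hp.1, hp.2, ?_, ?_⟩
  · clear hp
    induction p with
    | nil => exact List.isChain_nil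
    | cons u p ih =>
      cases p with
      | nil => exact List.isChain_singleton _
      | cons v p =>
        simp only [listLen, ne_eq, ENNReal.add_eq_top, not_or] at h
        exact List.isChain_cons_cons.2 ⟨(WDigraph.edge_of_lengths h.1).1, ih h.2⟩
  · intro v hv hvD
    have hnot : ∀ x, G.lengths D v x = ⊤ ∧ G.lengths D x v = ⊤ := fun x => by
      constructor <;> by_contra hx
      · exact (WDigraph.edge_of_lengths hx).2.1 hvD
      · exact (WDigraph.edge_of_lengths hx).2.2 hvD
    refine notMem_of_listLen_ne_top p h v (fun x => (hnot x).1) (fun x => (hnot x).2) ?_ hv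
    rintro rfl
    exact hs ((fromTo_singleton.1 hp).1 ▸ hvD)

theorem WDigraph.dist_eq_mdist {n : ℕ} (G : WDigraph n) (D : Finset (Fin n)) {s : Fin n}
    (t : Fin n) (hs : s ∉ D) : G.dist D s t = mdist (G.lengths D) s t := by
  refine le_antisymm (le_mdist fun p hp => ?_) (le_iInf₂ fun p hp => ?_)
  · by_cases h : listLen (G.lengths D) p = ⊤
    · rw [h]; exact le_top
    · have hp' := WDigraph.isPath_of_listLen hp hs h
      rw [hp'.listLen_eq]
      exact iInf₂_le p hp'
  · rw [← hp.listLen_eq]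
    exact mdist_le ⟨hp.head, hp.last⟩

/-! ### Simple shortest paths -/

theorem exists_nodup_listLen_le {n : ℕ} (N : Fin n → Fin n → ℝ≥0∞) {s t : Fin n}
    {p : List (Fin n)} (hp : FromTo p s t) :
    ∃ q, FromTo q s t ∧ q.Nodup ∧ listLen N q ≤ listLen N p := by
  induction hk : p.length using Nat.strong_induction_on generalizing p with
  | _ k ih =>
    by_cases hnd : p.Nodup
    · exact ⟨p, hp, hnd, le_rfl⟩
    · obtain ⟨u, hu⟩ : ∃ u, List.Duplicate u p := by
        simpa [List.nodup_iff_forall_not_duplicate] using hnd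
      obtain ⟨a, b, rfl⟩ := List.append_of_mem hu.mem
      have hub : u ∈ a ∨ u ∈ b := by
        have := List.duplicate_iff_two_le_count.1 hu
        by_contra hcon
        rw [not_or] at hcon
        simp [List.count_append, List.count_eq_zero_of_not_mem hcon.1,
          List.count_eq_zero_of_not_mem hcon.2] at this
      obtain ⟨x, y, z, hxyz⟩ : ∃ x y z, a ++ u :: b = x ++ u :: (y ++ u :: z) := by
        rcases hub with h | h
        · obtain ⟨x, y, rfl⟩ := List.append_of_mem h
          exact ⟨x, y, b, by simp⟩
        · obtain ⟨y, z, rfl⟩ := List.append_of_mem h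
          exact ⟨a, y, z, rfl⟩
      rw [hxyz] at hp hk ⊢
      have h1 := hp.split
      have h2 : FromTo (u :: z) u t := by
        have := (FromTo.split (p := x ++ u :: y) (by simpa using hp)).2
        exact this
      -- Cut out the closed walk between two occurrences of `u`; the list gets shorter, its length
      -- does not grow.
      obtain ⟨q, hq, hqn, hle⟩ := ih (x ++ u :: z).length (by rw [← hk]; simp)
        (h1.1.append h2) rfl
      refine ⟨q, hq, hqn, hle.trans ?_⟩
      rw [listLen_append x, listLen_append x (y ++ u :: z)]
      refine add_le_add le_rfl ?_
      have := listLen_append (N := N) (u :: y) z u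
      simp only [List.cons_append] at this
      rw [this]
      exact le_add_self

/-- Distances are attained by simple paths. -/
theorem exists_nodup_listLen_eq {n : ℕ} (N : Fin n → Fin n → ℝ≥0∞) (s t : Fin n) :
    ∃ p, FromTo p s t ∧ p.Nodup ∧ listLen N p = mdist N s t := by
  have hfin : {p : List (Fin n) | p.Nodup ∧ FromTo p s t}.Finite :=
    (List.finite_length_le (Fin n) n).subset fun p hp => by
      simpa using hp.1.length_le_card
  have hne : {p : List (Fin n) | p.Nodup ∧ FromTo p s t}.Nonempty := by
    -- The list [s, t] is always admissible, possibly with infinite length, so a minimiser exists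
    -- even for unreachable pairs.
    obtain ⟨q, h1, h2, -⟩ := exists_nodup_listLen_le N ((FromTo.singleton t).cons s)
    exact ⟨q, h2, h1⟩
  obtain ⟨p, hp, hmin⟩ := Set.exists_min_image _ (listLen N) hfin hne
  refine ⟨p, hp.2, hp.1, le_antisymm (le_mdist fun q hq => ?_) (mdist_le hp.2)⟩
  obtain ⟨r, h1, h2, h3⟩ := exists_nodup_listLen_le N hq
  exact (hmin r ⟨h2, h1⟩).trans h3

/-! ### Correctness for good coin flips -/

/-- Hence every layer below the one handled through centers has been repaired. -/
theorem centerLayer_le_succ (n k : ℕ) : centerLayer n k ≤ lastRepaired n k + 1 :=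
  Nat.ceil_le_floor_add_one _

theorem lastRepaired_le (n k : ℕ) : lastRepaired n k ≤ centerLayer n k :=
  Nat.floor_le_ceil _

theorem sqrt_div_le_sqrt (n : ℕ) {k : ℕ} (hk : 1 ≤ k) : √((n : ℝ) / (k : ℝ)) ≤ √n := by
  have : (1 : ℝ) ≤ k := by exact_mod_cast hk
  exact Real.sqrt_le_sqrt (div_le_self (Nat.cast_nonneg n) this)

theorem one_le_sqrt_div {n k : ℕ} (hk : 1 ≤ k) (hkn : k ≤ n) : 1 ≤ √((n : ℝ) / (k : ℝ)) := by
  have h1 : (1 : ℝ) ≤ k := by exact_mod_cast hk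
  have h2 : (k : ℝ) ≤ n := by exact_mod_cast hkn
  rw [Real.one_le_sqrt, le_div_iff₀ (by linarith)]
  linarith

theorem centerLayer_le_topLayer {n k : ℕ} (hk : 1 ≤ k) (hkn : k ≤ n) :
    centerLayer n k ≤ topLayer n := by
  rw [topLayer, ← Real.natCeil_logb_natCast]
  refine Nat.ceil_le_ceil ?_
  have h1 := one_le_sqrt_div hk hkn
  have hn : (1 : ℝ) ≤ n := by exact_mod_cast hk.trans hkn
  refine Real.logb_le_logb_of_le (by norm_num) (by linarith) ((sqrt_div_le_sqrt n hk).trans ?_)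
  rw [Real.sqrt_le_left (by linarith)]
  nlinarith

theorem centerLayer_pos {n k : ℕ} (hk : 1 ≤ k) (hkn : k < n) : 1 ≤ centerLayer n k := by
  have h1 : (1 : ℝ) ≤ k := by exact_mod_cast hk
  have h2 : (k : ℝ) < n := by exact_mod_cast hkn
  refine Nat.ceil_pos.2 (Real.logb_pos (by norm_num) ?_)
  rw [Real.lt_sqrt (by norm_num), lt_div_iff₀ (by linarith)]
  linarith

/-- The layer that takes care of the paths with `ℓ` nodes. -/
def pathLayer (hi ℓ : ℕ) : ℕ := min hi (max 1 (Nat.clog 2 ℓ))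

theorem pathLayer_pos {hi : ℕ} (h : 1 ≤ hi) (ℓ : ℕ) : 1 ≤ pathLayer hi ℓ :=
  le_min h (le_max_left _ _)

theorem pathLayer_le (hi ℓ : ℕ) : pathLayer hi ℓ ≤ hi := min_le_left _ _

/-- Below the cap the layer is large enough for the whole path to have at most h_i edges. -/
theorem le_two_pow_pathLayer {hi ℓ : ℕ} (h : pathLayer hi ℓ ≠ hi) : ℓ ≤ 2 ^ pathLayer hi ℓ := by
  have e : pathLayer hi ℓ = max 1 (Nat.clog 2 ℓ) := by
    rw [pathLayer] at h ⊢
    omega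
  rw [e]
  exact (Nat.le_pow_clog (by norm_num) ℓ).trans
    (Nat.pow_le_pow_right (by norm_num) (le_max_right _ _))

/-- The layer is also small enough for the path to have at least h_i/2 nodes, which makes a center
on it likely. The maximum with 1 in `pathLayer` matters for ℓ = 1, where 2 ≤ 2ℓ still holds. -/
theorem two_pow_pathLayer_le {hi ℓ : ℕ} (h : 1 ≤ ℓ) : 2 ^ pathLayer hi ℓ ≤ 2 * ℓ := by
  refine (Nat.pow_le_pow_right (by norm_num) (min_le_right hi _)).trans ?_
  rcases Nat.lt_or_ge 1 ℓ with hl | hl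
  · have h1 : 0 < Nat.clog 2 ℓ := Nat.clog_pos (by norm_num) hl
    have h2 := Nat.pow_pred_clog_lt_self (b := 2) (by norm_num) hl
    rw [max_eq_right h1]
    obtain ⟨m, hm⟩ := Nat.exists_eq_succ_of_ne_zero h1.ne'
    rw [hm, Nat.pred_succ] at h2
    rw [hm, Nat.pow_succ]
    omega
  · obtain rfl : ℓ = 1 := by omega
    simp

theorem repairAll_entry {n : ℕ} (W : WMatrix n) (data : Data n) (D : Arr (Fin n) Bool) {lo i : ℕ}
    (hlo : lo ≤ topLayer n) (h1 : 1 ≤ i) (hi : i ≤ lo) :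
    (repairAll W data D lo).val.entry (layer n i) =
      (repairLayer W (data.entry (layer n i)) D).val := by
  have := forEach_layers_val hlo (⟨fun _ => ⟨fun _ => ⊤⟩⟩ : Arr (LayerIndex n) (WMatrix n))
    (fun i => (repairLayer W (data.entry (layer n i)) D).val) (fun i δ => do
    let L ← data.read (layer n i)
    let m ← repairLayer W L D
    δ.write (layer n i) m) (fun _ _ => rfl) (hi.trans hlo)
  rw [if_pos ⟨h1, hi⟩] at this
  exact this

/-- If a shortest path contains a center of its layer, the computed distance is correct. -/
theorem batchDeletion_val_eq {n : ℕ} (G : WDigraph n) (coins : Coins n) {D : Finset (Fin n)}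
    (hD : D.Nonempty) {s t : Fin n} (hs : s ∉ D) {p : List (Fin n)} (hp : FromTo p s t)
    (hlen : listLen (G.lengths D) p = mdist (G.lengths D) s t)
    (hc : ∃ u ∈ p, coins (layer n (pathLayer (centerLayer n D.card) p.length), u) = true) :
    (batchDeletion G.matrix (preprocess G.matrix coins).val (nodeSet D)).val.entry (s, t) =
      G.dist D s t := by
  have hk : 1 ≤ D.card := hD.card_pos
  have hkn : D.card < n := by
    have := Finset.card_lt_univ_of_notMem hs
    simpa using this
  have htop := centerLayer_le_topLayer hk hkn.le
  have hpos := centerLayer_pos hk hkn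
  have hlo := lastRepaired_le n D.card
  have hlo' := centerLayer_le_succ n D.card
  set lo := lastRepaired n D.card
  set hi := centerLayer n D.card
  set data := (preprocess G.matrix coins).val with hdata
  rw [(batchDeletion_eq G.matrix data D).1, G.dist_eq_mdist D t hs]
  set δ : Arr (LayerIndex n) (WMatrix n) :=
    ⟨Function.update (repairAll G.matrix data (nodeSet D) lo).val.entry (layer n hi)
      (throughCenters G.matrix (data.entry (layer n hi)) (nodeSet D)).val⟩ with hδ
  have hδhi : δ.entry (layer n hi) =
      (throughCenters G.matrix (data.entry (layer n hi)) (nodeSet D)).val := by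
    simp [hδ]
  -- If log h is an integer, the last repaired layer coincides with the layer of the centers and is
  -- overwritten; therefore i ≠ hi is required.
  have hδi : ∀ i, 1 ≤ i → i ≤ hi → i ≠ hi → δ.entry (layer n i) =
      (repairLayer G.matrix (data.entry (layer n i)) (nodeSet D)).val := by
    intro i h1 h2 h3
    rw [← repairAll_entry G.matrix data (nodeSet D) (hlo.trans htop) h1 (by omega), hδ]
    exact Function.update_of_ne (fun h => h3 (layer_inj (by omega) htop h)) _ _
  have hready : ∀ i, 1 ≤ i → i ≤ hi → LayerReady G.matrix (2 ^ i)
      (fun v => coins (layer n i, v)) (data.entry (layer n i)) := fun i h1 h2 =>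
    preprocess_ready G.matrix coins h1 (h2.trans htop)
  have hspec := layerMin_spec δ hi s t
  have hge : mdist (G.lengths D) s t ≤ (layerMin δ hi).val.entry (s, t) := by
    refine hspec.1 _ fun i h1 h2 => ?_
    by_cases h3 : i = hi
    · rw [h3, hδhi]
      exact mdist_le_throughCenters _ _ _ s t
    · rw [hδi i h1 h2 h3]
      exact (hready i h1 h2).mdist_le_repair _ s t
  refine le_antisymm ?_ hge
  -- For an infinite distance nothing is left to show; otherwise finite length shows that `p` avoids
  -- `D`.
  by_cases htop' : mdist (G.lengths D) s t = ⊤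
  · rw [htop']
    exact le_top
  have hfree : ∀ u ∈ p, u ∉ D :=
    (WDigraph.isPath_of_listLen hp hs (hlen ▸ htop')).avoids
  have h1 := pathLayer_pos hpos p.length
  have h2 := pathLayer_le hi p.length
  refine (hspec.2 _ h1 h2).trans (le_of_le_of_eq ?_ hlen)
  by_cases h3 : pathLayer hi p.length = hi
  · rw [h3] at hc ⊢
    rw [hδhi]
    refine throughCenters_le_listLen _ _ _ hp ?_
    rw [(hready hi hpos le_rfl).loop.layer.center_eq]
    exact hc
  · rw [hδi _ h1 h2 h3]
    have hD' : ∀ u ∈ p, (nodeSet D).entry u = false := fun u hu => by simp [nodeSet, hfree u hu]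
    rw [WDigraph.lengths, listLen_restrict_eq p hD']
    exact (hready _ h1 h2).repair_le_listLen _ hp
      ((le_two_pow_pathLayer h3).trans (Nat.le_succ _)) hD' hc

/-! ### The random choice of the centers -/

open MeasureTheory

instance (n : ℕ) (c : ℝ) : IsProbabilityMeasure (coinMeasure n c) := by
  unfold coinMeasure
  infer_instance

/-- The number `x`: a node becomes a center of layer `i` with probability `min (x / 2 ^ i, 1)`. -/
def sampleRate (n : ℕ) (c : ℝ) : ℝ := 1 + 3 * (c + 1) * Real.log n

theorem centerProb_eq (n : ℕ) (c : ℝ) (i : ℕ) :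
    (centerProb n c i : ℝ) = max 0 (min 1 (sampleRate n c / 2 ^ i)) :=
  Set.coe_projIcc _ _ _ _

theorem one_le_sampleRate {n : ℕ} {c : ℝ} (hn : 1 ≤ n) (hc : 1 ≤ c) : 1 ≤ sampleRate n c := by
  have : 0 ≤ Real.log n := Real.log_nonneg (by exact_mod_cast hn)
  have : 0 ≤ 3 * (c + 1) * Real.log n := by positivity
  rw [sampleRate]
  linarith

theorem layer_val {n i : ℕ} (hi : i ≤ topLayer n) : (layer n i : ℕ) = i := by
  simp only [layer, Fin.ofNat]
  exact Nat.mod_eq_of_lt (by omega)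

/-- Independence, applied to a product over all coins in which the coins outside of S in layer `i`
contribute the factor 1. Both tail bounds are instances of this formula: f = 0 on centers describes
a set without centers, f = 2 on centers gives the generating function of their number at 2. -/
theorem integral_prod_coins {n i : ℕ} (c : ℝ) (hi : i ≤ topLayer n) (f : Bool → ℝ)
    (S : Finset (Fin n)) :
    ∫ ω, ∏ u ∈ S, f (ω (layer n i, u)) ∂coinMeasure n c =
      ((centerProb n c i : ℝ) * f true + (1 - (centerProb n c i : ℝ)) * f false) ^ S.card := by
  have h1 : ∀ ω : Coins n, ∏ u ∈ S, f (ω (layer n i, u)) =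
      ∏ e, (if e ∈ ({layer n i} : Finset (LayerIndex n)) ×ˢ S then f else fun _ => 1) (ω e) := by
    intro ω
    have : ∀ e : LayerIndex n × Fin n,
        (if e ∈ ({layer n i} : Finset (LayerIndex n)) ×ˢ S then f else fun _ => 1) (ω e) =
        if e ∈ ({layer n i} : Finset (LayerIndex n)) ×ˢ S then f (ω e) else 1 := fun e => by
      split_ifs <;> rfl
    rw [Finset.prod_congr rfl fun e _ => this e, Finset.prod_ite_mem, Finset.univ_inter,
      Finset.prod_product]
    simp
  simp only [h1]
  rw [coinMeasure, integral_fintype_prod_eq_prod (f := fun e b =>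
    (if e ∈ ({layer n i} : Finset (LayerIndex n)) ×ˢ S then f else fun _ => 1) b)]
  have h2 : ∀ e : LayerIndex n × Fin n, ∫ b,
      (if e ∈ ({layer n i} : Finset (LayerIndex n)) ×ˢ S then f else fun _ => 1) b
        ∂ProbabilityTheory.bernoulliMeasure true false (centerProb n c e.1) =
      if e ∈ ({layer n i} : Finset (LayerIndex n)) ×ˢ S then
        (centerProb n c e.1 : ℝ) * f true + (1 - (centerProb n c e.1 : ℝ)) * f false else 1 := by
    intro e
    rw [ProbabilityTheory.integral_bernoulliMeasure]
    split_ifs <;> simp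
  rw [Finset.prod_congr rfl fun e _ => h2 e, Finset.prod_ite_mem, Finset.univ_inter,
    Finset.prod_product]
  simp [layer_val hi]

theorem prob_prod_coins_ge {n i : ℕ} (c : ℝ) (hi : i ≤ topLayer n) {f : Bool → ℝ}
    (hf : ∀ b, 0 ≤ f b) (S : Finset (Fin n)) {a : ℝ} (ha : 0 < a) :
    (coinMeasure n c).real {ω | a ≤ ∏ u ∈ S, f (ω (layer n i, u))} ≤
      ((centerProb n c i : ℝ) * f true + (1 - (centerProb n c i : ℝ)) * f false) ^ S.card / a := by
  rw [le_div_iff₀ ha, mul_comm, ← integral_prod_coins c hi]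
  exact mul_meas_ge_le_integral_of_nonneg
    (ae_of_all _ fun ω => Finset.prod_nonneg fun u _ => hf _) Integrable.of_finite a

/-- The probability that a set of nodes contains no center of a layer. -/
theorem prob_no_center {n i : ℕ} {c : ℝ} (hn : 1 ≤ n) (hc : 1 ≤ c) (hi : i ≤ topLayer n)
    {S : Finset (Fin n)} (hS : 2 ^ i ≤ 2 * S.card) :
    (coinMeasure n c).real {ω | ∀ u ∈ S, ω (layer n i, u) = false} ≤
      Real.exp (-(sampleRate n c / 2)) := by
  have hx := one_le_sampleRate hn hc
  have h1 := prob_prod_coins_ge c hi (f := fun b => if b then 0 else 1)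
    (by intro b; cases b <;> simp) S one_pos
  refine le_trans (measureReal_mono fun ω hω => ?_) (h1.trans ?_)
  · simp only [Set.mem_ofPred_eq] at hω ⊢
    rw [Finset.prod_congr rfl fun u hu => by rw [hω u hu]]
    simp
  · simp only [if_true, mul_zero, zero_add, Bool.false_eq_true, if_false, mul_one, div_one]
    have hpos : (0 : ℝ) < 2 ^ i := by positivity
    have hS' : (2 : ℝ) ^ i ≤ 2 * S.card := by exact_mod_cast hS
    rw [centerProb_eq, max_eq_right (le_min zero_le_one (by positivity))]
    rcases le_total 1 (sampleRate n c / 2 ^ i) with h | h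
    -- If the probability is capped at 1, a set without centers would have to be empty, but 1 ≤ 2^i
    -- ≤ 2|S|.
    · rw [min_eq_left h, sub_self, zero_pow (by rintro h0; rw [h0] at hS'; simp at hS'; linarith)]
      positivity
    · rw [min_eq_right h]
      calc (1 - sampleRate n c / 2 ^ i) ^ S.card
          ≤ Real.exp (-(sampleRate n c / 2 ^ i)) ^ S.card :=
            pow_le_pow_left₀ (by linarith) (Real.one_sub_le_exp_neg _) _
        _ = Real.exp (-(sampleRate n c / 2 ^ i * S.card)) := by
            rw [← Real.exp_nat_mul]; congr 1; ring
        _ ≤ Real.exp (-(sampleRate n c / 2)) := by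
            rw [Real.exp_le_exp, neg_le_neg_iff, div_mul_eq_mul_div, div_le_div_iff₀ (by norm_num)
              hpos]
            nlinarith

theorem one_sub_le_of_compl {n : ℕ} {c ε : ℝ} {A : Set (Coins n)}
    (h : (coinMeasure n c).real Aᶜ ≤ ε) : 1 - ε ≤ (coinMeasure n c).real A := by
  rw [probReal_compl_eq_one_sub A.toFinite.measurableSet] at h
  linarith

theorem exp_neg_mul_log {n : ℕ} (hn : 1 ≤ n) (a : ℝ) :
    Real.exp (-(a * Real.log n)) = 1 / (n : ℝ) ^ a := by
  rw [Real.exp_neg, one_div, Real.rpow_def_of_pos (by exact_mod_cast hn), mul_comm]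

/-- Union bound over the n² pairs: n²·e^{-x/2} ≤ n^{2 − 3(c+1)/2}, and the exponent is at most −c
because c ≥ 1. -/
theorem prob_all_hit {n : ℕ} {c : ℝ} (hn : 1 ≤ n) (hc : 1 ≤ c) (i : Fin n → Fin n → ℕ)
    (S : Fin n → Fin n → Finset (Fin n)) (hi : ∀ s t, i s t ≤ topLayer n)
    (hS : ∀ s t, 2 ^ i s t ≤ 2 * (S s t).card) :
    1 - 1 / (n : ℝ) ^ c ≤ (coinMeasure n c).real
      {ω | ∀ s t, ∃ u ∈ S s t, ω (layer n (i s t), u) = true} := by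
  refine one_sub_le_of_compl ?_
  have hcover : {ω : Coins n | ∀ s t, ∃ u ∈ S s t, ω (layer n (i s t), u) = true}ᶜ ⊆
      ⋃ e : Fin n × Fin n, {ω | ∀ u ∈ S e.1 e.2, ω (layer n (i e.1 e.2), u) = false} := by
    intro ω hω
    simp only [Set.mem_compl_iff, Set.mem_ofPred_eq, not_forall, not_exists, not_and,
      Bool.not_eq_true] at hω
    obtain ⟨s, t, h⟩ := hω
    exact Set.mem_iUnion.2 ⟨(s, t), h⟩
  refine (measureReal_mono hcover).trans ((measureReal_iUnion_fintype_le _).trans ?_)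
  refine (Finset.sum_le_sum fun e _ => prob_no_center hn hc (hi e.1 e.2) (hS e.1 e.2)).trans ?_
  simp only [Finset.sum_const, Finset.card_univ, Fintype.card_prod, Fintype.card_fin,
    nsmul_eq_mul, Nat.cast_mul]
  have hn' : (0 : ℝ) < n := by exact_mod_cast hn
  have hlog : 0 ≤ Real.log n := Real.log_nonneg (by exact_mod_cast hn)
  have e : (n : ℝ) = Real.exp (Real.log n) := (Real.exp_log hn').symm
  rw [← exp_neg_mul_log hn]
  nth_rewrite 1 [e]
  nth_rewrite 2 [e]
  rw [← Real.exp_add, ← Real.exp_add, Real.exp_le_exp, sampleRate]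
  nlinarith

theorem two_pow_le_of_le_topLayer {n i : ℕ} (hn : 2 ≤ n) (hi : i ≤ topLayer n) :
    2 ^ i ≤ 2 * n := by
  refine (Nat.pow_le_pow_right (by norm_num) hi).trans ?_
  have h1 : 0 < Nat.clog 2 n := Nat.clog_pos (by norm_num) hn
  have h2 := Nat.pow_pred_clog_lt_self (b := 2) (by norm_num) hn
  obtain ⟨m, hm⟩ := Nat.exists_eq_succ_of_ne_zero h1.ne'
  rw [hm, Nat.pred_succ] at h2
  rw [topLayer, hm, Nat.pow_succ]
  omega

/-- With y = nx/2^i, Markov's inequality for 2 to the power of the number of centers gives (1+p)^n /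
2^{4y} ≤ e^{y − 4y ln 2}. Since 2^i ≤ 2n, also y ≥ x/2, and this exceeds 3(c+1)(ln n)/2. -/
theorem prob_many_centers {n i : ℕ} {c : ℝ} (hn : 2 ≤ n) (hc : 1 ≤ c) (hi : i ≤ topLayer n) :
    (coinMeasure n c).real {ω | 4 * (n * (sampleRate n c / 2 ^ i)) ≤ (centerCount ω i : ℝ)} ≤
      Real.exp (-((c + 1) * Real.log n)) := by
  have hx := one_le_sampleRate (by omega : 1 ≤ n) hc
  have hn' : (0 : ℝ) < n := by exact_mod_cast (by omega : 0 < n)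
  set y := n * (sampleRate n c / 2 ^ i) with hy
  have hy0 : 0 ≤ y := by positivity
  have h1 := prob_prod_coins_ge c hi (f := fun b => if b then 2 else 1)
    (by intro b; cases b <;> simp) Finset.univ (Real.exp_pos (4 * y * Real.log 2))
  refine le_trans (measureReal_mono fun ω hω => ?_) (h1.trans ?_)
  · simp only [Set.mem_ofPred_eq] at hω ⊢
    rw [Finset.prod_ite, Finset.prod_const, Finset.prod_const, one_pow, mul_one,
      ← Real.rpow_natCast, Real.rpow_def_of_pos (by norm_num), Real.exp_le_exp, mul_comm]
    exact mul_le_mul_of_nonneg_left hω (Real.log_nonneg (by norm_num))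
  · have hpos : (0 : ℝ) < 2 ^ i := by positivity
    have hp : (centerProb n c i : ℝ) ≤ sampleRate n c / 2 ^ i := by
      rw [centerProb_eq]
      exact max_le (by positivity) (min_le_right _ _)
    have hp0 : 0 ≤ (centerProb n c i : ℝ) := (centerProb n c i).2.1
    have h2 : ((centerProb n c i : ℝ) * 2 + (1 - (centerProb n c i : ℝ)) * 1) ^ n ≤ Real.exp y := by
      calc ((centerProb n c i : ℝ) * 2 + (1 - (centerProb n c i : ℝ)) * 1) ^ n
          ≤ Real.exp (sampleRate n c / 2 ^ i) ^ n := by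
            refine pow_le_pow_left₀ (by linarith) ?_ _
            have := Real.add_one_le_exp (sampleRate n c / 2 ^ i)
            linarith
        _ = Real.exp y := by rw [← Real.exp_nat_mul]
    have hlog2 : (0.69 : ℝ) < Real.log 2 := lt_trans (by norm_num) Real.log_two_gt_d9
    have hlog : 0 ≤ Real.log n := Real.log_nonneg (by exact_mod_cast (by omega : 1 ≤ n))
    have h2i : (2 : ℝ) ^ i ≤ 2 * n := by exact_mod_cast two_pow_le_of_le_topLayer hn hi
    have hyx : sampleRate n c / 2 ≤ y := by
      rw [hy, mul_div_assoc', div_le_div_iff₀ (by norm_num) hpos]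
      nlinarith
    simp only [if_true, Bool.false_eq_true, if_false, Finset.card_univ, Fintype.card_fin]
    rw [div_le_iff₀ (Real.exp_pos _), ← Real.exp_add]
    refine h2.trans (Real.exp_le_exp.2 ?_)
    rw [sampleRate] at hyx
    have h3 : 0 ≤ (c + 1) * Real.log n := by positivity
    nlinarith

/-- There are at most n layers, so the factor n of the union bound is paid by the exponent c + 1
instead of c. -/
theorem prob_few_centers {n : ℕ} {c : ℝ} (hn : 2 ≤ n) (hc : 1 ≤ c) :
    1 - 1 / (n : ℝ) ^ c ≤ (coinMeasure n c).real
      {ω | ∀ i, 1 ≤ i → i ≤ topLayer n →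
        (centerCount ω i : ℝ) ≤ 4 * (n * (sampleRate n c / 2 ^ i))} := by
  refine one_sub_le_of_compl ?_
  have hcover : {ω : Coins n | ∀ i, 1 ≤ i → i ≤ topLayer n →
        (centerCount ω i : ℝ) ≤ 4 * (n * (sampleRate n c / 2 ^ i))}ᶜ ⊆
      ⋃ i ∈ Finset.Icc 1 (topLayer n),
        {ω | 4 * (n * (sampleRate n c / 2 ^ i)) ≤ (centerCount ω i : ℝ)} := by
    intro ω hω
    simp only [Set.mem_compl_iff, Set.mem_ofPred_eq, not_forall, not_le] at hω
    obtain ⟨i, h1, h2, h⟩ := hω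
    exact Set.mem_biUnion (Finset.mem_Icc.2 ⟨h1, h2⟩) h.le
  refine (measureReal_mono hcover (measure_ne_top _ _)).trans ((measureReal_biUnion_finset_le _ _).trans ?_)
  refine (Finset.sum_le_sum fun i hi =>
    prob_many_centers hn hc (Finset.mem_Icc.1 hi).2).trans ?_
  have hn' : (0 : ℝ) < n := by exact_mod_cast (by omega : 0 < n)
  have htop : (topLayer n : ℝ) ≤ n := by
    exact_mod_cast Nat.clog_le_of_le_pow Nat.lt_two_pow_self.le
  rw [Finset.sum_const, Nat.card_Icc, Nat.add_sub_cancel, nsmul_eq_mul,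
    ← exp_neg_mul_log (by omega)]
  calc (topLayer n : ℝ) * Real.exp (-((c + 1) * Real.log n))
      ≤ n * Real.exp (-((c + 1) * Real.log n)) :=
        mul_le_mul_of_nonneg_right htop (Real.exp_pos _).le
    _ = Real.exp (Real.log n) * Real.exp (-((c + 1) * Real.log n)) := by rw [Real.exp_log hn']
    _ = Real.exp (-(c * Real.log n)) := by rw [← Real.exp_add]; congr 1; ring

/-- One simple shortest path per pair is chosen from `G` and `D` alone, before the coins are
considered; it is here that `D` must be fixed in advance. The path with its layer satisfies the
hypotheses of `prob_all_hit`, and a center on it makes the output for this pair correct. -/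
theorem prob_correct {n : ℕ} {c : ℝ} (hn : 1 ≤ n) (hc : 1 ≤ c) (G : WDigraph n)
    {D : Finset (Fin n)} (hD : D.Nonempty) :
    1 - 1 / (n : ℝ) ^ c ≤ (coinMeasure n c).real
      {ω | ∀ s t : Fin n, s ∉ D → t ∉ D →
        (batchDeletion G.matrix (preprocess G.matrix ω).val (nodeSet D)).val.entry (s, t) =
          G.dist D s t} := by
  choose p hp hnd hlen using exists_nodup_listLen_eq (G.lengths D)
  have hcard : ∀ s t, (p s t).toFinset.card = (p s t).length := fun s t =>
    List.toFinset_card_of_nodup (hnd s t)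
  have htop : centerLayer n D.card ≤ topLayer n :=
    centerLayer_le_topLayer hD.card_pos (by simpa using D.card_le_univ)
  refine (prob_all_hit hn hc (fun s t => pathLayer (centerLayer n D.card) (p s t).length)
    (fun s t => (p s t).toFinset) (fun s t => (pathLayer_le _ _).trans htop)
    (fun s t => ?_)).trans (measureReal_mono fun ω hω s t hs _ => ?_)
  · rw [hcard]
    exact two_pow_pathLayer_le (hp s t).length_pos
  · obtain ⟨u, h1, h2⟩ := hω s t
    exact batchDeletion_val_eq G ω hD hs (hp s t) (hlen s t) ⟨u, List.mem_toFinset.1 h1, h2⟩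

/-! ### Running times -/

/-- All layers have about as many centers as expected. -/
def FewCenters {n : ℕ} (c : ℝ) (ω : Coins n) : Prop :=
  ∀ i, 1 ≤ i → i ≤ topLayer n → (centerCount ω i : ℝ) ≤ 4 * (n * (sampleRate n c / 2 ^ i))

theorem le_log_of_two_le {n : ℕ} (hn : 2 ≤ n) : (0.69 : ℝ) ≤ Real.log n := by
  have h1 : (0.69 : ℝ) < Real.log 2 := lt_trans (by norm_num) Real.log_two_gt_d9
  have h2 : Real.log 2 ≤ Real.log n := Real.log_le_log (by norm_num) (by exact_mod_cast hn)
  linarith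

theorem sampleRate_le {n : ℕ} {c : ℝ} (hn : 2 ≤ n) (hc : 1 ≤ c) :
    sampleRate n c ≤ 8 * (c * Real.log n) := by
  have h := le_log_of_two_le hn
  rw [sampleRate]
  nlinarith

theorem topLayer_le {n : ℕ} (hn : 2 ≤ n) : (topLayer n : ℝ) ≤ 3 * Real.log n := by
  have h := le_log_of_two_le hn
  have h1 : (0.69 : ℝ) < Real.log 2 := lt_trans (by norm_num) Real.log_two_gt_d9
  have hn' : (1 : ℝ) ≤ n := by exact_mod_cast (by omega : 1 ≤ n)
  have h2 : (topLayer n : ℝ) < Real.logb 2 n + 1 := by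
    have := Nat.ceil_lt_add_one (Real.logb_nonneg (b := (2 : ℕ)) (by norm_num) hn')
    rwa [Real.natCeil_logb_natCast] at this
  have h3 : Real.logb 2 n ≤ 1.5 * Real.log n := by
    rw [Real.logb, div_le_iff₀ (by linarith)]
    nlinarith
  linarith

theorem sum_inv_two_pow_le (m : ℕ) : ∑ i ∈ Finset.range m, (1 : ℝ) / 2 ^ (i + 1) ≤ 1 := by
  suffices ∑ i ∈ Finset.range m, (1 : ℝ) / 2 ^ (i + 1) = 1 - 1 / 2 ^ m by
    rw [this]
    have : (0 : ℝ) < 1 / 2 ^ m := by positivity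
    linarith
  induction m with
  | zero => simp
  | succ m ih => rw [Finset.sum_range_succ, ih, pow_succ]; field_simp; ring

theorem sum_two_pow_le (m : ℕ) : ∑ i ∈ Finset.range m, (2 : ℝ) ^ (i + 1) ≤ 2 * 2 ^ m := by
  induction m with
  | zero => simp
  | succ m ih => rw [Finset.sum_range_succ, pow_succ]; linarith

/-- With m = h_i the number of centers is O(Nx/m). The factor m of Bellman-Ford cancels and leaves
N³x in each layer, whereas the cost of sorting keeps the factor 1/m and will be summed
geometrically. -/
theorem preprocessLayer_cost_real {N x C m T : ℝ} (hN : 1 ≤ N) (hx : 0 ≤ x) (hm : 1 ≤ m)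
    (hT : 0 ≤ T) (hC : C ≤ 4 * (N * (x / m))) :
    C * (182 * ((m + 1) * (N * N)) + N * N * (10 * T + 6)) + 30 * (N * N * N) + 4 ≤
      N ^ 3 * (1456 * x + 34) + 4 * N ^ 3 * x * (10 * T + 6) * (1 / m) := by
  have hm0 : 0 < m := by linarith
  have h1 : C * (182 * ((m + 1) * (N * N)) + N * N * (10 * T + 6)) ≤
      4 * (N * (x / m)) * (182 * ((2 * m) * (N * N)) + N * N * (10 * T + 6)) := by
    refine mul_le_mul hC ?_ (by positivity) (by positivity)
    have : (m + 1) * (N * N) ≤ 2 * m * (N * N) :=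
      mul_le_mul_of_nonneg_right (by linarith) (by positivity)
    linarith
  have h2 : 4 * (N * (x / m)) * (182 * ((2 * m) * (N * N)) + N * N * (10 * T + 6)) =
      1456 * (N ^ 3 * x) + 4 * N ^ 3 * x * (10 * T + 6) * (1 / m) := by
    field_simp
    ring
  have h3 : 1 ≤ N ^ 3 := one_le_pow₀ hN
  nlinarith

theorem preprocess_cost_real {n : ℕ} {c : ℝ} (hn : 2 ≤ n) (hc : 1 ≤ c) (W : WMatrix n)
    {ω : Coins n} (hω : FewCenters c ω) :
    ((preprocess W ω).cost : ℝ) ≤ 50000 * c * ((n : ℝ) ^ 3 * Real.log n ^ 2) := by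
  have hlog := le_log_of_two_le hn
  have hx1 := one_le_sampleRate (by omega : 1 ≤ n) hc
  have hx := sampleRate_le hn hc
  have hT := topLayer_le hn
  have hT1 : (1 : ℝ) ≤ topLayer n := by
    exact_mod_cast Nat.clog_pos (by norm_num : 1 < 2) hn
  have hTn : (topLayer n : ℝ) ≤ n := by
    exact_mod_cast Nat.clog_le_of_le_pow Nat.lt_two_pow_self.le
  have hN : (1 : ℝ) ≤ n := by exact_mod_cast (by omega : 1 ≤ n)
  have h := preprocess_cost_le W ω
  have h' : ((preprocess W ω).cost : ℝ) ≤ 3 * n + 3 * (n * n) + n * n * n + (topLayer n + 1) +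
      ∑ i ∈ Finset.range (topLayer n), ((centerCount ω (i + 1) : ℝ) *
        (182 * (((2 : ℝ) ^ (i + 1) + 1) * (n * n)) + n * n * (10 * topLayer n + 6)) +
        30 * (n * n * n) + 4) := by exact_mod_cast h
  set x := sampleRate n c with hxdef
  set N : ℝ := (n : ℝ) with hNdef
  set T : ℝ := (topLayer n : ℝ) with hTdef
  have hsum : ∑ i ∈ Finset.range (topLayer n), ((centerCount ω (i + 1) : ℝ) *
        (182 * (((2 : ℝ) ^ (i + 1) + 1) * (N * N)) + N * N * (10 * T + 6)) +
        30 * (N * N * N) + 4) ≤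
      T * (N ^ 3 * (1456 * x + 34)) + 4 * N ^ 3 * x * (10 * T + 6) := by
    calc _ ≤ ∑ i ∈ Finset.range (topLayer n), (N ^ 3 * (1456 * x + 34) +
          4 * N ^ 3 * x * (10 * T + 6) * (1 / (2 : ℝ) ^ (i + 1))) := by
          refine Finset.sum_le_sum fun i hi => preprocessLayer_cost_real hN (by linarith)
            (one_le_pow₀ (by norm_num)) (by linarith) (hω (i + 1) (by omega) ?_)
          have := Finset.mem_range.1 hi
          omega
      _ = T * (N ^ 3 * (1456 * x + 34)) + 4 * N ^ 3 * x * (10 * T + 6) *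
          ∑ i ∈ Finset.range (topLayer n), 1 / (2 : ℝ) ^ (i + 1) := by
          rw [Finset.sum_add_distrib, Finset.sum_const, Finset.card_range, nsmul_eq_mul,
            Finset.mul_sum]
      _ ≤ _ := by
          have h1 : 0 ≤ 4 * N ^ 3 * x * (10 * T + 6) := by positivity
          have := mul_le_mul_of_nonneg_left (sum_inv_two_pow_le (topLayer n)) h1
          linarith
  have hfirst : 3 * N + 3 * (N * N) + N * N * N + (T + 1) ≤ 9 * N ^ 3 := by
    have h1 : N ≤ N ^ 3 := le_self_pow₀ hN (by norm_num)
    have h2 : N * N ≤ N ^ 3 := by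
      rw [← sq]; exact pow_le_pow_right₀ hN (by norm_num)
    have h3 : 1 ≤ N ^ 3 := one_le_pow₀ hN
    nlinarith
  have hxT : x * T ≤ 24 * (c * Real.log n ^ 2) := by
    calc x * T ≤ 8 * (c * Real.log n) * (3 * Real.log n) :=
          mul_le_mul hx hT (by linarith) (by positivity)
      _ = _ := by ring
  have hTx : T ≤ x * T := le_mul_of_one_le_left (by linarith) hx1
  have hxx : x ≤ x * T := le_mul_of_one_le_right (by linarith) hT1
  -- All terms are compared with xT, using 1 ≤ x and 1 ≤ T; the coefficients add up to 1563.
  have hbr : 9 + T * (1456 * x + 34) + 4 * x * (10 * T + 6) ≤ 1600 * (x * T) := by nlinarith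
  calc ((preprocess W ω).cost : ℝ)
      ≤ 9 * N ^ 3 + (T * (N ^ 3 * (1456 * x + 34)) + 4 * N ^ 3 * x * (10 * T + 6)) := by linarith
    _ = N ^ 3 * (9 + T * (1456 * x + 34) + 4 * x * (10 * T + 6)) := by ring
    _ ≤ N ^ 3 * (1600 * (24 * (c * Real.log n ^ 2))) := by
        refine mul_le_mul_of_nonneg_left ?_ (by positivity)
        linarith
    _ = 38400 * (c * (N ^ 3 * Real.log n ^ 2)) := by ring
    _ ≤ 50000 * (c * (N ^ 3 * Real.log n ^ 2)) := by
        refine mul_le_mul_of_nonneg_right (by norm_num) (by positivity)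
    _ = _ := by ring

/-- The cost is split by its dependence on m = h_i: a constant part, the part of Dijkstra's
algorithm for all visited nodes, falling like 1/m, and the part of the affected nodes, growing like
m. -/
theorem repairLayer_cost_real {N x R m H k s b A : ℝ} (hN : 1 ≤ N) (hx : 0 ≤ x) (hm : 1 ≤ m)
    (hk : 0 ≤ k) (hH : 0 ≤ H) (hs : 1 ≤ s) (hb0 : 0 ≤ b) (hb : b ≤ 2 * s)
    (hR : R ≤ 8 * (N * (x / m)))
    (hA : A ≤ k * (4 * (N * (m + 1)) * H + N)) :
    3 + (15 * (N * N) + R * (12 * (N * (m + 1)) + 110 * (N * b) + 1) + 78 * N * A) ≤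
      N ^ 2 * (18 + 192 * x + 78 * k) + 1768 * N ^ 2 * s * x * (1 / m) +
        624 * N ^ 2 * k * H * m := by
  have hm0 : 0 < m := by linarith
  have h1 : R * (12 * (N * (m + 1)) + 110 * (N * b) + 1) ≤
      8 * (N * (x / m)) * (24 * (N * m) + 221 * (N * s)) := by
    refine mul_le_mul hR ?_ (by positivity) (by positivity)
    have e1 : N * (m + 1) ≤ N * (2 * m) := mul_le_mul_of_nonneg_left (by linarith) (by linarith)
    have e2 : N * b ≤ N * (2 * s) := mul_le_mul_of_nonneg_left hb (by linarith)
    have e3 : 1 ≤ N * s := one_le_mul_of_one_le_of_one_le hN hs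
    linarith
  have h2 : 8 * (N * (x / m)) * (24 * (N * m) + 221 * (N * s)) =
      192 * (N ^ 2 * x) + 1768 * N ^ 2 * s * x * (1 / m) := by
    field_simp
    ring
  have h3 : 78 * N * A ≤ 78 * N * (k * (4 * (N * (2 * m)) * H + N)) := by
    refine mul_le_mul_of_nonneg_left (hA.trans (mul_le_mul_of_nonneg_left ?_ hk)) (by linarith)
    have e1 : 4 * (N * (m + 1)) ≤ 4 * (N * (2 * m)) := by
      have : N * (m + 1) ≤ N * (2 * m) := mul_le_mul_of_nonneg_left (by linarith) (by linarith)
      linarith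
    have := mul_le_mul_of_nonneg_right e1 hH
    linarith
  have h4 : 1 ≤ N ^ 2 := one_le_pow₀ hN
  nlinarith

theorem two_pow_lastRepaired_le {n k : ℕ} (hk : 1 ≤ k) (hkn : k ≤ n) :
    (2 : ℝ) ^ lastRepaired n k ≤ √((n : ℝ) / (k : ℝ)) := by
  have h1 := one_le_sqrt_div hk hkn
  rw [← Real.rpow_natCast, ← Real.le_logb_iff_rpow_le (by norm_num) (by linarith)]
  exact Nat.floor_le (Real.logb_nonneg (by norm_num) h1)

theorem le_two_pow_centerLayer {n k : ℕ} (hk : 1 ≤ k) (hkn : k ≤ n) :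
    √((n : ℝ) / (k : ℝ)) ≤ (2 : ℝ) ^ centerLayer n k := by
  have h1 := one_le_sqrt_div hk hkn
  rw [← Real.rpow_natCast, ← Real.logb_le_iff_le_rpow (by norm_num) (by linarith)]
  exact Nat.le_ceil _

theorem blockSize_le {n : ℕ} (hn : 1 ≤ n) : (blockSize n : ℝ) ≤ 2 * √n := by
  have h1 : ((Nat.sqrt n : ℕ) : ℝ) ≤ √n := Real.nat_sqrt_le_real_sqrt
  have h2 : (1 : ℝ) ≤ √n := by
    rw [Real.one_le_sqrt]; exact_mod_cast hn
  rw [blockSize]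
  push_cast
  linarith

/-- The part falling like 1/h_i is dominated by the first layer and the growing part by the last
one, where h_i ≤ h = √(n/|D|); only the constant part is multiplied by the number of layers. -/
theorem repairAll_cost_real {n : ℕ} {c : ℝ} (hn : 2 ≤ n) (hc : 1 ≤ c) (W : WMatrix n)
    {ω : Coins n} (hω : FewCenters c ω) {D : Finset (Fin n)} (hD : D.Nonempty) :
    ((repairAll W (preprocess W ω).val (nodeSet D) (lastRepaired n D.card)).cost : ℝ) ≤
      lastRepaired n D.card * ((n : ℝ) ^ 2 * (18 + 192 * sampleRate n c + 78 * D.card)) +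
        1768 * (n : ℝ) ^ 2 * √n * sampleRate n c +
        1248 * (n : ℝ) ^ 2 * D.card * (harmonic n : ℝ) * √((n : ℝ) / (D.card : ℝ)) := by
  have hk : 1 ≤ D.card := hD.card_pos
  have hkn : D.card ≤ n := by simpa using D.card_le_univ
  have hlo : lastRepaired n D.card ≤ topLayer n :=
    (lastRepaired_le n D.card).trans (centerLayer_le_topLayer hk hkn)
  have hx1 := one_le_sampleRate (by omega : 1 ≤ n) hc
  have hN : (1 : ℝ) ≤ n := by exact_mod_cast (by omega : 1 ≤ n)
  have hs : (1 : ℝ) ≤ √n := Real.one_le_sqrt.2 hN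
  have hH : (0 : ℝ) ≤ (harmonic n : ℝ) := by
    have : (harmonic 0 : ℚ) ≤ harmonic n := harmonic_mono (Nat.zero_le n)
    exact_mod_cast this
  have h := repairAll_cost_le W ω (nodeSet D) hlo
  have h' : ((repairAll W (preprocess W ω).val (nodeSet D) (lastRepaired n D.card)).cost : ℝ) ≤
      ∑ i ∈ Finset.range (lastRepaired n D.card), (3 + (15 * ((n : ℝ) * n) +
        (((preprocess W ω).val.entry (layer n (i + 1))).visited.length : ℝ) *
          (12 * (n * ((2 : ℝ) ^ (i + 1) + 1)) + 110 * (n * (blockSize n : ℝ)) + 1) +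
        78 * n * (affectedTotal ((preprocess W ω).val.entry (layer n (i + 1))) (nodeSet D) : ℝ))) := by
    exact_mod_cast h
  refine h'.trans ?_
  have hterm : ∀ i ∈ Finset.range (lastRepaired n D.card), (3 + (15 * ((n : ℝ) * n) +
        (((preprocess W ω).val.entry (layer n (i + 1))).visited.length : ℝ) *
          (12 * (n * ((2 : ℝ) ^ (i + 1) + 1)) + 110 * (n * (blockSize n : ℝ)) + 1) +
        78 * n * (affectedTotal ((preprocess W ω).val.entry (layer n (i + 1)))
          (nodeSet D) : ℝ))) ≤
      (n : ℝ) ^ 2 * (18 + 192 * sampleRate n c + 78 * D.card) +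
        1768 * (n : ℝ) ^ 2 * √n * sampleRate n c * (1 / 2 ^ (i + 1)) +
        624 * (n : ℝ) ^ 2 * D.card * (harmonic n : ℝ) * 2 ^ (i + 1) := by
    intro i hi
    have hi' := Finset.mem_range.1 hi
    have hready := preprocess_ready W ω (by omega : 1 ≤ i + 1) (by omega)
    have hv : (((preprocess W ω).val.entry (layer n (i + 1))).visited.length : ℝ) ≤
        2 * (centerCount ω (i + 1) : ℝ) := by
      exact_mod_cast hready.loop.visited_length_le
    have hC := hω (i + 1) (by omega) (by omega)
    have hA := hready.affectedTotal_le D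
    push_cast at hA
    exact repairLayer_cost_real hN (by linarith) (one_le_pow₀ (by norm_num)) (Nat.cast_nonneg _)
      hH hs (Nat.cast_nonneg _) (blockSize_le (by omega)) (by linarith) hA
  refine (Finset.sum_le_sum hterm).trans ?_
  rw [Finset.sum_add_distrib, Finset.sum_add_distrib, Finset.sum_const, Finset.card_range,
    nsmul_eq_mul, ← Finset.mul_sum, ← Finset.mul_sum]
  refine add_le_add (add_le_add le_rfl ?_) ?_
  · exact mul_le_of_le_one_right (by positivity) (sum_inv_two_pow_le _)
  · have h1 := (sum_two_pow_le (lastRepaired n D.card)).trans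
      (mul_le_mul_of_nonneg_left (two_pow_lastRepaired_le hk hkn) (by norm_num))
    have h2 : 0 ≤ 624 * (n : ℝ) ^ 2 * D.card * (harmonic n : ℝ) := by positivity
    calc _ ≤ 624 * (n : ℝ) ^ 2 * D.card * (harmonic n : ℝ) *
          (2 * √((n : ℝ) / (D.card : ℝ))) := mul_le_mul_of_nonneg_left h1 h2
      _ = _ := by ring

theorem throughCenters_cost_real {n : ℕ} {c : ℝ} (hn : 2 ≤ n) (hc : 1 ≤ c) (W : WMatrix n)
    {ω : Coins n} (hω : FewCenters c ω) {D : Finset (Fin n)} (hD : D.Nonempty) :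
    ((throughCenters W ((preprocess W ω).val.entry (layer n (centerLayer n D.card)))
      (nodeSet D)).cost : ℝ) ≤ 15 * (n : ℝ) ^ 2 +
        440 * ((n : ℝ) ^ 3 * (sampleRate n c / √((n : ℝ) / (D.card : ℝ)))) := by
  have hk : 1 ≤ D.card := hD.card_pos
  have hkn : D.card ≤ n := by simpa using D.card_le_univ
  have hx1 := one_le_sampleRate (by omega : 1 ≤ n) hc
  have hN : (1 : ℝ) ≤ n := by exact_mod_cast (by omega : 1 ≤ n)
  have hh := one_le_sqrt_div hk hkn
  set hi := centerLayer n D.card with hhi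
  set L := (preprocess W ω).val.entry (layer n hi) with hL
  have hC : ((Finset.univ.filter fun u => L.center.entry u = true).card : ℝ) ≤
      4 * (n * (sampleRate n c / √((n : ℝ) / (D.card : ℝ)))) := by
    rcases Nat.eq_zero_or_pos hi with h0 | h0
    -- The case h = 1, in which layer 0 is used, has no centers and satisfies the bound trivially.
    · have : (Finset.univ.filter fun u => L.center.entry u = true) = ∅ := by
        refine Finset.filter_eq_empty_iff.2 fun u _ => ?_
        rw [hL, h0, preprocess_center_zero]
        simp
      rw [this]
      simp only [Finset.card_empty, Nat.cast_zero]
      positivity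
    · have htop := centerLayer_le_topLayer hk hkn
      rw [hL, (preprocess_ready W ω h0 htop).loop.layer.center_eq]
      refine (hω hi h0 htop).trans ?_
      have := div_le_div_of_nonneg_left (by linarith : 0 ≤ sampleRate n c) (by linarith)
        (le_two_pow_centerLayer hk hkn)
      exact mul_le_mul_of_nonneg_left (mul_le_mul_of_nonneg_left this (by linarith)) (by norm_num)
  have h := throughCenters_cost_le W L (nodeSet D)
  have h' : ((throughCenters W L (nodeSet D)).cost : ℝ) ≤ 15 * ((n : ℝ) * n) +
      ((Finset.univ.filter fun u => L.center.entry u = true).card : ℝ) *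
        (42 * (n * (blockSize n : ℝ)) + 26 * (n * n)) := by exact_mod_cast h
  have hb : (n : ℝ) * (blockSize n : ℝ) ≤ 2 * n ^ 2 := by
    have h1 := blockSize_le (by omega : 1 ≤ n)
    have h2 : √(n : ℝ) ≤ n := by
      rw [Real.sqrt_le_left (by linarith)]
      nlinarith
    nlinarith
  have h2 : ((Finset.univ.filter fun u => L.center.entry u = true).card : ℝ) *
        (42 * (n * (blockSize n : ℝ)) + 26 * (n * n)) ≤
      4 * (n * (sampleRate n c / √((n : ℝ) / (D.card : ℝ)))) * (110 * n ^ 2) :=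
    mul_le_mul hC (by nlinarith) (by positivity) (by positivity)
  nlinarith

/-- Here s = √n, r = √|D|, h = s/r, x is the sampling rate, H the harmonic number and l the number
of repaired layers. Every term is compared with P = s⁵r = n^{2.5}·√|D|: both n²·|D|·h and n³/h are
equal to P. -/
theorem deletion_cost_arith {s r x H l : ℝ} (hs : 1 ≤ s) (hr : 1 ≤ r) (hx : 1 ≤ x)
    (hl : l ≤ s / r) :
    11 * (s ^ 2) ^ 2 + (l * ((s ^ 2) ^ 2 * (18 + 192 * x + 78 * r ^ 2)) +
      1768 * (s ^ 2) ^ 2 * s * x + 1248 * (s ^ 2) ^ 2 * r ^ 2 * H * (s / r)) +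
      (15 * (s ^ 2) ^ 2 + 440 * ((s ^ 2) ^ 3 * (x / (s / r)))) + (s ^ 2) ^ 2 * (12 * (s / r)) ≤
    s ^ 5 * r * (2600 * x + 1248 * H) := by
  have hs0 : 0 < s := by linarith
  have hr0 : 0 < r := by linarith
  set P := s ^ 5 * r with hP
  have hP0 : 0 ≤ P := by positivity
  have e1 : (s ^ 2) ^ 2 ≤ P := by
    calc (s ^ 2) ^ 2 = s ^ 4 * 1 * 1 := by ring
      _ ≤ s ^ 4 * s * r := by gcongr
      _ = P := by ring
  have e2 : (s ^ 2) ^ 2 * (s / r) ≤ P := by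
    calc (s ^ 2) ^ 2 * (s / r) ≤ (s ^ 2) ^ 2 * (s * r) := by
          refine mul_le_mul_of_nonneg_left ?_ (by positivity)
          exact (div_le_self hs0.le hr).trans (le_mul_of_one_le_right hs0.le hr)
      _ = P := by ring
  have e3 : l * ((s ^ 2) ^ 2 * (18 + 192 * x + 78 * r ^ 2)) ≤ P * (18 + 192 * x + 78) := by
    calc l * ((s ^ 2) ^ 2 * (18 + 192 * x + 78 * r ^ 2))
        ≤ s / r * ((s ^ 2) ^ 2 * (18 + 192 * x + 78 * r ^ 2)) :=
          mul_le_mul_of_nonneg_right hl (by positivity)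
      _ = (s ^ 2) ^ 2 * (s / r) * (18 + 192 * x) + P * 78 := by
          rw [hP]; field_simp
      _ ≤ P * (18 + 192 * x) + P * 78 :=
          add_le_add (mul_le_mul_of_nonneg_right e2 (by linarith)) le_rfl
      _ = _ := by ring
  have e4 : (s ^ 2) ^ 2 * s ≤ P := by
    calc (s ^ 2) ^ 2 * s = s ^ 5 * 1 := by ring
      _ ≤ P := mul_le_mul_of_nonneg_left hr (by positivity)
  have e5 : 1768 * (s ^ 2) ^ 2 * s * x ≤ 1768 * (P * x) := by
    have := mul_le_mul_of_nonneg_right e4 (by linarith : 0 ≤ x)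
    nlinarith
  have e6 : 1248 * (s ^ 2) ^ 2 * r ^ 2 * H * (s / r) = 1248 * (P * H) := by
    rw [hP]; field_simp
  have e7 : (s ^ 2) ^ 3 * (x / (s / r)) = P * x := by
    rw [hP]; field_simp
  rw [e6, e7]
  have e8 : P ≤ P * x := le_mul_of_one_le_right hP0 hx
  nlinarith

theorem batchDeletion_cost_real {n : ℕ} {c : ℝ} (hn : 2 ≤ n) (hc : 1 ≤ c) (W : WMatrix n)
    {ω : Coins n} (hω : FewCenters c ω) {D : Finset (Fin n)} (hD : D.Nonempty) :
    ((batchDeletion W (preprocess W ω).val (nodeSet D)).cost : ℝ) ≤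
      50000 * c * ((n : ℝ) ^ (5 / 2 : ℝ) * √(D.card : ℝ) * Real.log n) := by
  have hk : 1 ≤ D.card := hD.card_pos
  have hkn : D.card ≤ n := by simpa using D.card_le_univ
  have hx1 := one_le_sampleRate (by omega : 1 ≤ n) hc
  have hx := sampleRate_le hn hc
  have hlog := le_log_of_two_le hn
  have hN : (1 : ℝ) ≤ n := by exact_mod_cast (by omega : 1 ≤ n)
  have hk' : (1 : ℝ) ≤ D.card := by exact_mod_cast hk
  have hkn' : (D.card : ℝ) ≤ n := by exact_mod_cast hkn
  have hh1 := one_le_sqrt_div hk hkn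
  -- The number of layers is bounded crudely by 2^lo ≤ h instead of log h; the terms it multiplies
  -- have room for this.
  have hlo : (lastRepaired n D.card : ℝ) ≤ √((n : ℝ) / (D.card : ℝ)) := by
    refine le_trans ?_ (two_pow_lastRepaired_le hk hkn)
    exact_mod_cast Nat.lt_two_pow_self.le
  have hhi : (centerLayer n D.card : ℝ) ≤ 2 * √((n : ℝ) / (D.card : ℝ)) := by
    have : (centerLayer n D.card : ℝ) ≤ lastRepaired n D.card + 1 := by
      exact_mod_cast centerLayer_le_succ n D.card
    linarith
  have hTn : (topLayer n : ℝ) ≤ n := by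
    exact_mod_cast Nat.clog_le_of_le_pow Nat.lt_two_pow_self.le
  have h1 := repairAll_cost_real hn hc W hω hD
  have h2 := throughCenters_cost_real hn hc W hω hD
  have h3 : ((batchSize (nodeSet D)).cost : ℝ) ≤ n * 3 := by
    exact_mod_cast batchSize_cost (nodeSet D)
  have h4 : ∀ δ, ((layerMin (n := n) δ (centerLayer n D.card)).cost : ℝ) ≤
      (n : ℝ) ^ 2 * (12 * √((n : ℝ) / (D.card : ℝ))) := fun δ => by
    have h : ((layerMin (n := n) δ (centerLayer n D.card)).cost : ℝ) ≤
      n * n * (4 * (centerLayer n D.card : ℝ) + 4) := by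
      exact_mod_cast layerMin_cost_le δ (centerLayer n D.card)
    refine h.trans ?_
    rw [← sq]
    exact mul_le_mul_of_nonneg_left (by linarith) (by positivity)
  -- The cost of the final minimum has a bound independent of the matrices, so it is replaced by a
  -- number.
  obtain ⟨m, hm, h5⟩ : ∃ m : ℕ, (m : ℝ) ≤ (n : ℝ) ^ 2 * (12 * √((n : ℝ) / (D.card : ℝ))) ∧
      (batchDeletion W (preprocess W ω).val (nodeSet D)).cost = (batchSize (nodeSet D)).cost +
        (1 + (1 + (1 + (Fintype.card (Fin n × Fin n) + (Fintype.card (LayerIndex n) +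
          ((repairAll W (preprocess W ω).val (nodeSet D) (lastRepaired n D.card)).cost + (1 +
            ((throughCenters W ((preprocess W ω).val.entry (layer n (centerLayer n D.card)))
              (nodeSet D)).cost + (1 + m))))))))) :=
    ⟨_, h4 _, (batchDeletion_eq W (preprocess W ω).val D).2⟩
  generalize (batchDeletion W (preprocess W ω).val (nodeSet D)).cost = total at h5 ⊢
  generalize (repairAll W (preprocess W ω).val (nodeSet D) (lastRepaired n D.card)).cost = a
    at h1 h5
  generalize (throughCenters W ((preprocess W ω).val.entry (layer n (centerLayer n D.card)))
    (nodeSet D)).cost = b at h2 h5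
  generalize (batchSize (nodeSet D)).cost = d at h3 h5
  have hs : (1 : ℝ) ≤ √n := Real.one_le_sqrt.2 hN
  have hr : (1 : ℝ) ≤ √(D.card : ℝ) := Real.one_le_sqrt.2 hk'
  have hH : (harmonic n : ℝ) ≤ 3 * (c * Real.log n) := by
    have := harmonic_le_one_add_log n
    nlinarith
  have hdiv : √((n : ℝ) / (D.card : ℝ)) = √n / √(D.card : ℝ) := Real.sqrt_div (by linarith) _
  have key := deletion_cost_arith (H := (harmonic n : ℝ)) hs hr hx1 (hdiv ▸ hlo)
  rw [← hdiv, Real.sq_sqrt (by linarith), Real.sq_sqrt (by linarith)] at key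
  have hpow : (n : ℝ) ^ (5 / 2 : ℝ) = √n ^ 5 := by
    rw [Real.sqrt_eq_rpow, ← Real.rpow_natCast, ← Real.rpow_mul (by linarith)]
    norm_num
  have hsmall : (n : ℝ) * 3 + (5 + (n * n + (topLayer n + 1))) ≤ 11 * (n : ℝ) ^ 2 := by
    nlinarith
  have hcost : (total : ℝ) ≤
      √n ^ 5 * √(D.card : ℝ) * (2600 * sampleRate n c + 1248 * (harmonic n : ℝ)) := by
    refine le_trans ?_ key
    rw [h5]
    simp only [Fintype.card_prod, Fintype.card_fin]
    push_cast
    linarith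
  rw [hpow]
  refine hcost.trans ?_
  calc √n ^ 5 * √(D.card : ℝ) * (2600 * sampleRate n c + 1248 * (harmonic n : ℝ))
      ≤ √n ^ 5 * √(D.card : ℝ) * (50000 * (c * Real.log n)) := by
        refine mul_le_mul_of_nonneg_left ?_ (by positivity)
        have : 0 ≤ c * Real.log n := by positivity
        -- By x ≤ 8c ln n and H_n ≤ 3c ln n, the factor is at most (2600·8 + 1248·3)·c ln n, and
        -- this is below 50000·c ln n.
        linarith
    _ = _ := by ring

end BatchDeletion

end

open BatchDeletion
theorem mainTheorem2 :
    ∃ K : ℝ, 0 < K ∧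
      ∀ (c : ℝ), 1 ≤ c → ∀ (n : ℕ), 2 ≤ n → ∀ (G : WDigraph n) (D : Finset (Fin n)),
        D.Nonempty →
        1 - 1 / (n : ℝ) ^ c ≤
            (coinMeasure n c).real
              {ω | ((preprocess G.matrix ω).cost : ℝ) ≤ K * c * ((n : ℝ) ^ 3 * Real.log n ^ 2) ∧
                ((batchDeletion G.matrix (preprocess G.matrix ω).val (nodeSet D)).cost : ℝ) ≤
                  K * c * ((n : ℝ) ^ (5 / 2 : ℝ) * √(D.card : ℝ) * Real.log n)} ∧
          1 - 1 / (n : ℝ) ^ c ≤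
            (coinMeasure n c).real
              {ω | ∀ s t : Fin n, s ∉ D → t ∉ D →
                (batchDeletion G.matrix (preprocess G.matrix ω).val (nodeSet D)).val.entry (s, t) =
                  G.dist D s t} := by
  refine ⟨50000, by norm_num, fun c hc n hn G D hD => ⟨?_, prob_correct (by omega) hc G hD⟩⟩
  -- Both time bounds follow from the single event that no layer has too many centers.
  refine (prob_few_centers hn hc).trans (MeasureTheory.measureReal_mono fun ω hω => ?_)
  exact ⟨preprocess_cost_real hn hc G.matrix hω, batchDeletion_cost_real hn hc G.matrix hω hD⟩
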